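/- Let $X=\mathbb C/2\pi i\mathbb Z$, $S(w)=\sinh w$, $w_\pm=\pm i\pi/2$, and for a phase $\theta$ put $S_\theta=e^{-i\theta}S$, $F_\theta=\operatorname{Re}S_\theta$. The negative gradient flow of $F_\theta$ for the flat metric is $\dot w=-\overline{e^{-i\theta}\cosh w}$. The thimble $\mathcal J_\pm^\theta\subset X$ is the stable manifold of $w_\pm$ (the points whose forward flow line tends to $w_\pm$), oriented so that at $w_+$ it runs to the right (positive inner product of its direction with $1$) and at $w_-$ upwards (positive inner product with $i$). For $0<\delta<\pi/4$ write $\mathcal J_\pm^{<}$, $\mathcal J_\pm^{>}$ for the thimbles in the phases $\theta=\frac\pi2-\delta$, $\theta=\frac\pi2+\delta$. Put $\mathcal A=S_{\pi/2}=-i\sinh w$, so that $\mathcal A(w_\pm)=\pm1$, and $I_{\mathcal J}(\hbar)=\int_{\mathcal J}e^{-\mathcal A(w)/\hbar}\,dw$. Let $$\widetilde I_+=\sqrt{2\pi\hbar}\,e^{-1/\hbar}\sum_{m\ge0}(-1)^ma_m\hbar^m,\qquad \widetilde I_-=i\sqrt{2\pi\hbar}\,e^{1/\hbar}\sum_{m\ge0}a_m\hbar^m,\qquad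 a_m=\frac{((2m-1)!!)^2}{m!\,8^m}.$$ For $\omega\ne0$ let $\Delta_\omega^+=\mathcal B^{-1}\circ\tau_{-\omega}\circ\operatorname{var}_\omega^+\circ\mathcal B$ act on $\hbar^{1/2}\mathbb C[[\hbar]]$, where $\mathcal B(\hbar^{m+1/2})=\xi^{m-1/2}/\Gamma(m+\tfrac12)$, $(\tau_{-\omega}f)(\xi)=f(\xi+\omega)$, and $\operatorname{var}_\omega^+$ is the analytic continuation along a path $\gamma_\omega^+$ from near $0$ to a point just behind $\omega$ on the ray $\mathbb R_{>0}\omega$, passing to the right of the ray, minus the continuation along $\gamma_\omega^+$ followed by a small clockwise loop around $\omega$. Let $\Delta_\omega^+$ commute with the factors $e^{-\sigma/\hbar}$, and let $\dot\Delta_\omega^+=e^{-\omega/\hbar}\Delta_\omega^+$ and $\mathfrak S^+=\mathrm{Id}+\sum_{\omega>0}\dot\Delta_\omega^+$. Then: (1) $\dot\Delta_2^+\widetilde I_-=2\widetilde I_+$, $\dot\Delta_2^+\widetilde I_+=0$, $\dot\Delta_{-2}^+\widetilde I_+=-2\widetilde I_-$, $\dot\Delta_{-2}^+\widetilde I_-=0$.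 (2) $\mathfrak S^+(\widetilde I_+,\widetilde I_-)=(\widetilde I_+,\widetilde I_-)\begin{pmatrix}1&2\\0&1\end{pmatrix}$. (3) For $0<\delta<\pi/4$ and $\theta=\frac\pi2\pm\delta$ each thimble is an injectively and regularly parametrized curve; the integrals $I_{\mathcal J_\pm^{\theta}}(\hbar)$ converge absolutely for $|\arg\hbar-(\theta-\frac\pi2)|<\frac\pi2$ and satisfy $I_{\mathcal J_\pm^\theta}(\hbar)\sim\widetilde I_\pm(\hbar)$ as $\hbar\to0$ in the sector $|\arg\hbar-(\theta-\frac\pi2)|<\delta$. For $|\arg\hbar|<\delta$, $$(I_{\mathcal J_+^<},I_{\mathcal J_-^<})=(I_{\mathcal J_+^>},I_{\mathcal J_-^>})\begin{pmatrix}1&2\\0&1\end{pmatrix},\qquad (I_{\mathcal J_+^>},I_{\mathcal J_-^>})=(I_{\mathcal J_+^<},I_{\mathcal J_-^<})\begin{pmatrix}1&-2\\0&1\end{pmatrix}.$$ (4) Let $0<\delta<\pi/4$, $R>1$, and let $A\subset X$ contain $\{F_{\pi/2-\delta}\ge R\}\cap\{F_{\pi/2+\delta}\ge R\}$ (for instance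 this intersection itself, or one of the ends $\{F_\theta\ge R\}$ with $|\theta-\frac\pi2|\le\delta$). Then the oriented thimbles $\mathcal J_\pm^{<}$, $\mathcal J_\pm^{>}$ have well-defined classes in $H_1(X,A;\mathbb Z)$, and $$([\mathcal J_+^>],[\mathcal J_-^>])=([\mathcal J_+^<],[\mathcal J_-^<])\begin{pmatrix}1&-2\\0&1\end{pmatrix},\qquad ([\mathcal J_+^<],[\mathcal J_-^<])=([\mathcal J_+^>],[\mathcal J_-^>])\begin{pmatrix}1&2\\0&1\end{pmatrix};$$ in particular $[\mathcal J_-^>]=[\mathcal J_-^<]-2[\mathcal J_+^<]$. (5) The trajectories $w:\mathbb R\to X$ of the flow at $\theta=\frac\pi2$ with $w(s)\to w_+$ as $s\to-\infty$ and $w(s)\to w_-$ as $s\to+\infty$ are exactly $w(s)=i\left(2\arctan(e^{-(s-s_0)})-\frac\pi2\right)$ and $w(s)=i\left(2\arctan(e^{s-s_0})+\frac\pi2\right)$, $s_0\in\mathbb R$. Up to translation of time there are exactly two of them, the number that is the off-diagonal entry of the Stokes matrix. -/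

import Mathlib

open Complex Filter Topology Asymptotics
open scoped Nat ComplexConjugate

namespace BesselStokes

noncomputable section

/-! ### Relative singular homology -/

/-- Singular `n`-chains with integer coefficients. -/
abbrev SingularChain (X : Type) [TopologicalSpace X] (n : ℕ) : Type :=
  C(stdSimplex ℝ (Fin (n + 1)), X) →₀ ℤ

/-- The `i`-th face inclusion of the standard simplices. -/
def faceMap (n : ℕ) (i : Fin (n + 2)) :
    C(stdSimplex ℝ (Fin (n + 1)), stdSimplex ℝ (Fin (n + 2))) :=
  ⟨stdSimplex.map i.succAbove, stdSimplex.continuous_map _⟩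

/-- The singular boundary operator. -/
def boundary (X : Type) [TopologicalSpace X] (n : ℕ) :
    SingularChain X (n + 1) →ₗ[ℤ] SingularChain X n :=
  Finsupp.linearCombination ℤ fun σ =>
    ∑ i : Fin (n + 2), (-1 : ℤ) ^ (i : ℕ) • Finsupp.single (σ.comp (faceMap n i)) (1 : ℤ)

/-- Chains supported in the subset `A`. -/
def chainsIn {X : Type} [TopologicalSpace X] (A : Set X) (n : ℕ) :
    Submodule ℤ (SingularChain X n) :=
  Finsupp.supported ℤ ℤ {σ | ∀ x, σ x ∈ A}

/-- Relative cycles of degree `n + 1`. -/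
def relCycles {X : Type} [TopologicalSpace X] (A : Set X) (n : ℕ) :
    Submodule ℤ (SingularChain X (n + 1)) :=
  (chainsIn A n).comap (boundary X n)

/-- Relative boundaries of degree `n + 1`. -/
def relBoundaries {X : Type} [TopologicalSpace X] (A : Set X) (n : ℕ) :
    Submodule ℤ (SingularChain X (n + 1)) :=
  LinearMap.range (boundary X (n + 1)) ⊔ chainsIn A (n + 1)

/-- The relative singular homology group `H_{n+1}(X, A; ℤ)`. -/
abbrev RelHomologySucc {X : Type} [TopologicalSpace X] (A : Set X) (n : ℕ) : Type :=
  relCycles A n ⧸ (relBoundaries A n).submoduleOf (relCycles A n)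

/-! ### The action on the cylinder and its gradient flow -/

/-- The cylinder `ℂ / 2πiℤ`. -/
abbrev Cylinder : Type := ℂ ⧸ AddSubgroup.zmultiples (2 * Real.pi * I : ℂ)

/-- The quotient map `ℂ → ℂ / 2πiℤ`. -/
def toCyl (w : ℂ) : Cylinder := QuotientAddGroup.mk w

/-- The rotated action `S_θ = e^{-iθ} sinh`. -/
def rotAction (θ : ℝ) (w : ℂ) : ℂ := exp (-(θ * I)) * sinh w

/-- The vector field `- conj (e^{-iθ} S'(w))` of the negative gradient flow of `Re S_θ` for the
flat metric. -/
def flowField (θ : ℝ) (w : ℂ) : ℂ := -conj (exp (-(θ * I)) * cosh w)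

/-- The two critical points `w_+ = iπ/2` (index `0`) and `w_- = -iπ/2` (index `1`). -/
def critPt : Fin 2 → ℂ := ![Real.pi / 2 * I, -(Real.pi / 2 * I)]

/-- The Lefschetz thimble of `p` in phase `θ`: the stable manifold of `p`, i.e. the set of all
starting points whose forward flow line exists for all positive times and tends to `p`. (Flow lines
on the cylinder are written through their lifts to `ℂ`.) -/
def thimble (θ : ℝ) (p : Cylinder) : Set Cylinder :=
  {z | ∃ W : ℝ → ℂ, toCyl (W 0) = z ∧
    (∀ s, 0 ≤ s → HasDerivWithinAt W (flowField θ (W s)) (Set.Ici 0) s) ∧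
    Tendsto (fun s => toCyl (W s)) atTop (𝓝 p)}

/-- The end `{F_θ ≥ R}` of the cylinder, where `F_θ = Re S_θ`. -/
def posEnd (θ R : ℝ) : Set Cylinder := toCyl '' {w | R ≤ (rotAction θ w).re}

/-- The orienting directions of the thimbles: that of `w_+` runs to the right, that of `w_-` runs
upwards. -/
def orientDir : Fin 2 → ℂ := ![1, I]

/-- `Γ` is (the lift to `ℂ` of) a regular parametrization by `ℝ` of the whole thimble of the
critical point number `j` in phase `θ`, starting at the critical point at time `0` and running
there in the positive direction. -/
structure IsThimbleParam (θ : ℝ) (j : Fin 2) (Γ : ℝ → ℂ) : Prop where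
  contDiff : ContDiff ℝ 1 Γ
  deriv_ne : ∀ t, deriv Γ t ≠ 0
  injective : Function.Injective fun t => toCyl (Γ t)
  range_eq : Set.range (fun t => toCyl (Γ t)) = thimble θ (toCyl (critPt j))
  base : toCyl (Γ 0) = toCyl (critPt j)
  orient : 0 < (conj (orientDir j) * deriv Γ 0).re

/-- The class in `H_1(X, A; ℤ)` of the oriented thimble: it is represented by an arc of the
thimble, outside which the thimble stays in `A`. -/
def IsThimbleClass (A : Set Cylinder) (θ : ℝ) (j : Fin 2) (h : RelHomologySucc A 0) : Prop :=
  ∃ (Γ : ℝ → ℂ) (a b : ℝ) (σ : C(stdSimplex ℝ (Fin 2), Cylinder)) (z : relCycles A 0),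
    IsThimbleParam θ j Γ ∧ a < b ∧
    (∀ t ≤ a, toCyl (Γ t) ∈ A) ∧ (∀ t ≥ b, toCyl (Γ t) ∈ A) ∧
    (∀ x, σ x = toCyl (Γ (a * x 0 + b * x 1))) ∧
    (z : SingularChain Cylinder 1) = Finsupp.single σ 1 ∧
    h = Submodule.Quotient.mk z

/-- `w` is a trajectory of the negative gradient flow in phase `θ` on the cylinder which runs from
`p` to `q`. -/
def IsConnecting (θ : ℝ) (p q : Cylinder) (w : ℝ → Cylinder) : Prop :=
  (∃ W : ℝ → ℂ, (∀ s, HasDerivAt W (flowField θ (W s)) s) ∧ ∀ s, w s = toCyl (W s)) ∧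
    Tendsto w atBot (𝓝 p) ∧ Tendsto w atTop (𝓝 q)

/-- Equality of connecting trajectories up to a translation of time. -/
def shiftSetoid (θ : ℝ) (p q : Cylinder) : Setoid {w : ℝ → Cylinder // IsConnecting θ p q w} where
  r w w' := ∃ c : ℝ, ∀ s, w'.1 s = w.1 (s + c)
  iseqv :=
    { refl := fun _ => ⟨0, fun s => by rw [add_zero]⟩
      symm := fun {_ _} ⟨c, hc⟩ => ⟨-c, fun s => by rw [hc, neg_add_cancel_right]⟩
      trans := fun {_ _ _} ⟨c, hc⟩ ⟨d, hd⟩ =>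
        ⟨d + c, fun s => by rw [hd, hc, add_assoc]⟩ }

/-! ### Thimble integrals -/

/-- The integrand of `∫ e^{-𝒜(w)/ħ} dw` along the curve `Γ`, where `𝒜 = S_{π/2} = -i sinh`, the
action rotated by the Stokes phase `π/2` (so that `ħ` is the original parameter times
`e^{-iπ/2}`). -/
def thimbleIntegrand (Γ : ℝ → ℂ) (ħ : ℂ) (t : ℝ) : ℂ :=
  exp (-rotAction (Real.pi / 2) (Γ t) / ħ) * deriv Γ t

/-- The exponential integral along the curve `Γ`. -/
def thimbleIntegral (Γ : ℝ → ℂ) (ħ : ℂ) : ℂ := ∫ t, thimbleIntegrand Γ ħ t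

/-- The open sector of all `ħ` with `|arg ħ - β| < η`. -/
def sector (β η : ℝ) : Set ℂ := {ħ | ħ ≠ 0 ∧ |arg ħ - β| < η}

/-- `f(ħ) ∼ e^{-σ/ħ} ħ^{1/2} ψ(ħ)` as `ħ → 0` in `U`. -/
def HasSaddleExpansion (f : ℂ → ℂ) (U : Set ℂ) (σ : ℂ) (ψ : PowerSeries ℂ) : Prop :=
  ∀ N : ℕ,
    (fun ħ : ℂ => exp (σ / ħ) * f ħ -
        ħ ^ (1 / 2 : ℂ) * ∑ m ∈ Finset.range N, PowerSeries.coeff m ψ * ħ ^ m)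
      =O[𝓝[U] 0] fun ħ : ℂ => ħ ^ (1 / 2 : ℂ) * ħ ^ N

/-! ### Formal series, Borel transform, alien operators -/

/-- Formal sums `∑_σ e^{-σ/ħ} ħ^{1/2} T_σ(ħ)` with finitely many exponentials. -/
abbrev Transseries : Type := ℂ →₀ PowerSeries ℂ

/-- `a_m = ((2m-1)!!)² / (m! 8^m)`. -/
def besselCoeff (m : ℕ) : ℂ := ((2 * m - 1)‼ : ℂ) ^ 2 / ((m ! : ℂ) * 8 ^ m)

/-- The power series factors `√(2π) ∑ (-1)^m a_m ħ^m` and `i √(2π) ∑ a_m ħ^m` of the two saddle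
series. -/
def saddleSeries : Fin 2 → PowerSeries ℂ :=
  ![PowerSeries.mk fun m => (Real.sqrt (2 * Real.pi) : ℂ) * ((-1) ^ m * besselCoeff m),
    PowerSeries.mk fun m => I * (Real.sqrt (2 * Real.pi) : ℂ) * besselCoeff m]

/-- The saddle expansions `Ĩ_+` (index `0`) and `Ĩ_-` (index `1`). -/
def saddleExpansion (j : Fin 2) : Transseries :=
  Finsupp.single (rotAction (Real.pi / 2) (critPt j)) (saddleSeries j)

/-- The shifted Borel transform `∑ a_m ξ^{m+α-1} / Γ(m+α)` of `ħ^α ∑ a_m ħ^m`; the power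
`ξ^{α-1}` is taken in the branch which is continuous along the ray through the unit vector `u`. -/
def borel (α u : ℂ) (ψ : PowerSeries ℂ) (ξ : ℂ) : ℂ :=
  u ^ (α - 1) * (ξ / u) ^ (α - 1) * ∑' m : ℕ, PowerSeries.coeff m ψ / Gamma (m + α) * ξ ^ m

/-- The Borel transform converges near the origin. -/
def BorelConvergent (α : ℂ) (ψ : PowerSeries ℂ) : Prop :=
  ∃ r : ℝ, 0 < r ∧ ∀ ξ : ℂ, ‖ξ‖ < r →
    Summable fun m : ℕ => PowerSeries.coeff m ψ / Gamma (m + α) * ξ ^ m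

/-- The germ of `g` at `γ 1` is the analytic continuation of the germ of `f` at `γ 0` along the
path `γ : [0, 1] → ℂ`. -/
def IsContinuation (γ : ℝ → ℂ) (f g : ℂ → ℂ) : Prop :=
  ∃ F : ℝ → ℂ → ℂ,
    (∀ t ∈ Set.Icc (0 : ℝ) 1, AnalyticAt ℂ (F t) (γ t)) ∧
    (∀ t ∈ Set.Icc (0 : ℝ) 1, ∀ᶠ s in 𝓝[Set.Icc 0 1] t, F s =ᶠ[𝓝 (γ s)] F t) ∧
    F 0 =ᶠ[𝓝 (γ 0)] f ∧ F 1 =ᶠ[𝓝 (γ 1)] g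

/-- The unit vector in the direction of `ω`. -/
def dir (ω : ℂ) : ℂ := ω / (‖ω‖ : ℂ)

/-- The path `γ_ω^+`: from a point of the ray `ℝ_{>0} ω` near `0` to a point of this ray just
behind `ω`, passing slightly to the right of the ray in between. -/
def alienPath (ω : ℂ) (ε t : ℝ) : ℂ :=
  dir ω * ((ε + t * ‖ω‖ : ℝ) - (4 * ε * t * (1 - t) : ℝ) * I)

/-- The clockwise loop around `ω` based at the endpoint of `γ_ω^+`; the path `γ_ω^-` is `γ_ω^+`
followed by this loop. -/
def alienLoop (ω : ℂ) (ε t : ℝ) : ℂ := ω + ε * dir ω * exp (-(2 * Real.pi * t * I))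

/-- `Δ_ω^+ (ħ^α ψ) = ħ^α χ`, where `Δ_ω^+ = ℬ⁻¹ ∘ τ_{-ω} ∘ var_ω^+ ∘ ℬ`, and `var_ω^+` is the
continuation along `γ_ω^+` minus the continuation along `γ_ω^-`. -/
def HasAlien (α ω : ℂ) (ψ χ : PowerSeries ℂ) : Prop :=
  BorelConvergent α ψ ∧ BorelConvergent α χ ∧
    ∀ᶠ ε in 𝓝[>] (0 : ℝ), ∃ g g' : ℂ → ℂ,
      IsContinuation (alienPath ω ε) (borel α (dir ω) ψ) g ∧
      IsContinuation (alienLoop ω ε) g g' ∧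
      (fun ξ => g ξ - g' ξ) =ᶠ[𝓝 (ω + ε * dir ω)] fun ξ => borel α (dir ω) χ (ξ - ω)

/-- The pointed alien operator `e^{-ω/ħ} Δ_ω^+` maps `T` to `T'`. It acts on each summand
`e^{-σ/ħ} ħ^{1/2} T_σ`, giving `e^{-(σ+ω)/ħ} Δ_ω^+ (ħ^{1/2} T_σ)`. -/
def HasPointedAlien (ω : ℂ) (T T' : Transseries) : Prop :=
  ∀ σ, HasAlien (1 / 2) ω (T σ) (T' (σ + ω))

/-- The Stokes automorphism `𝔖^+ = Id + ∑_{ω > 0} e^{-ω/ħ} Δ_ω^+` along the positive Borel ray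
maps `T` to `T'`. -/
def HasStokes (T T' : Transseries) : Prop :=
  ∃ D : ℝ → Transseries,
    (∀ ω : ℝ, 0 < ω → HasPointedAlien (ω : ℂ) T (D ω)) ∧
    {ω : ℝ | 0 < ω ∧ D ω ≠ 0}.Finite ∧
    T' = T + ∑ᶠ ω ∈ Set.Ioi (0 : ℝ), D ω

end

end BesselStokes

open BesselStokes

/-! ### Borel transforms of the saddle series and the alien operators. -/

namespace BesselStokes

noncomputable section

/-! ### The binomial series of exponent `-1/2` -/

/-! One binomial series governs everything: `(1 - x)^{-1/2} = ∑ b_m x^m`, with `b_m` the `halfBinom`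
coefficients.

Resurgence. Dividing `a_m` by `Γ(m + 1/2)` leaves `b_m / 2^m` up to the factor `√π`
(`besselCoeff_eq`), so the Borel transforms are constant multiples of `ξ^{-1/2} (1 ∓ ξ/2)^{-1/2}`,
each with a single singular point besides `0`. Passing to the right of that point produces a factor
`-i`, and a loop around it reverses the sign. Hence the variation is `-2i` times the continued
function, and recentred at the singular point that function is the Borel transform of the other
saddle (`inv_sqrt_mul_inv_sqrt_shift`, `hasAlien_besselSeries`). The prefactors `1` and `i` of the
saddles turn `-2i` into `2` and `-2`.

Thimbles. At a critical point `p` the half-angle formula `sinh (p + z) = sinh p (1 + 2 sinh² (z/2))`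
makes `sinh (z/2)` a coordinate in which the action is exactly quadratic. The thimble is therefore
`p + 2 arcsinh (κ t)` with `2 κ² sinh p = e^{iθ}`: the conserved imaginary part of `S_θ` puts every
point of the thimble on this curve, and the flow on the curve is a scalar equation that is solved
explicitly (`IsThimbleDir.range_thimbleCurve`). Any other parametrization is an increasing change of
variable (`IsThimbleDir.exists_isReparam`). In the coordinate `t` the integral is a Gaussian against
`2κ (1 + κ² t²)^{-1/2}`, and Watson's lemma gives the expansion.

Jump. Let `P` be a primitive of `e^{-𝒜/ħ}` on `ℂ`, `c` its increment over a period, and `R`, `L` its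
values far out at the right and left ends of the strip around height `π/2`. The upper thimble gives
`R - L` in both phases. The lower one gives `R - (L - c)` before the Stokes phase and `L - (R - c)`
after it, because its two ends change sides. The difference is `2 (R - L)`. The homology classes
obey the same bookkeeping, with `P` replaced by the class of a path from `0` to `w` (`potential`),
which is locally constant where the path stays in `A`.

Connecting trajectories. At the Stokes phase the action is real along them and lies between the two
critical values, which forces `Re w = 0`; what remains is the equation `y' = -cos y`. -/

/-- The Taylor coefficients of `(1 - x)^{-1/2}`. -/
def halfBinom (m : ℕ) : ℂ := ((2 * m - 1)‼ : ℂ) / (2 ^ m * (m ! : ℂ))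

lemma doubleFactorial_two_mul_succ_sub_one (n : ℕ) :
    (2 * (n + 1) - 1)‼ = (2 * n + 1) * (2 * n - 1)‼ := by
  cases n with
  | zero => rfl
  | succ k => exact Nat.doubleFactorial_add_two (2 * k + 1)

lemma ascPochhammer_half_eval (n : ℕ) :
    Polynomial.eval (1 / 2 : ℂ) (ascPochhammer ℂ n) = ((2 * n - 1)‼ : ℂ) / 2 ^ n := by
  induction n with
  | zero => simp
  | succ n ih =>
    rw [ascPochhammer_succ_eval, ih, doubleFactorial_two_mul_succ_sub_one]
    push_cast
    field_simp
    ring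

/-- This is the form in which the coefficients of the general series of `(1 - x)^{-a}` appear; for
`a = 1/2` they are rising factorials of `1/2` divided by `n!`. -/
lemma choose_half (n : ℕ) : Ring.choose ((1 / 2 : ℂ) + n - 1) n = halfBinom n := by
  have h := Ring.factorial_nsmul_multichoose_eq_ascPochhammer (1 / 2 : ℂ) n
  rw [Polynomial.ascPochhammer_smeval_eq_eval, ascPochhammer_half_eval] at h
  have h1 : Ring.choose ((1 / 2 : ℂ) + n - 1) n = Ring.multichoose (1 / 2 : ℂ) n := by
    unfold Ring.choose
    congr 1
    ring
  have h2 : (n ! : ℂ) ≠ 0 := by exact_mod_cast n.factorial_ne_zero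
  rw [h1, halfBinom]
  rw [nsmul_eq_mul] at h
  field_simp at h ⊢
  linear_combination h

lemma hasFPowerSeriesOnBall_inv_sqrt_one_sub :
    HasFPowerSeriesOnBall (fun x : ℂ => (1 - x) ^ (-(1 / 2) : ℂ))
      (FormalMultilinearSeries.ofScalars ℂ halfBinom) 0 1 := by
  have h := one_div_one_sub_cpow_hasFPowerSeriesOnBall_zero (1 / 2)
  simp only [choose_half] at h
  have h' : (fun x : ℂ => (1 - x) ^ (-(1 / 2) : ℂ)) = fun x : ℂ => 1 / (1 - x) ^ (1 / 2 : ℂ) :=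
    funext fun x => by rw [cpow_neg, one_div ((1 - x) ^ (1 / 2 : ℂ))]
  rw [h']
  exact h

lemma hasSum_inv_sqrt_one_sub {x : ℂ} (hx : ‖x‖ < 1) :
    HasSum (fun m : ℕ => halfBinom m * x ^ m) ((1 - x) ^ (-(1 / 2) : ℂ)) := by
  have h := hasFPowerSeriesOnBall_inv_sqrt_one_sub.hasSum (y := x)
    (by simpa [enorm_eq_nnnorm, ← NNReal.coe_lt_coe] using hx)
  simpa [FormalMultilinearSeries.ofScalars_apply_eq, mul_comm] using h

/-! ### The saddle series and their Borel transforms -/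

/-- The series `C ∑ s^m a_m ħ^m`. -/
def besselSeries (C s : ℂ) : PowerSeries ℂ := PowerSeries.mk fun m => C * (s ^ m * besselCoeff m)

lemma saddleSeries_zero :
    saddleSeries 0 = besselSeries (Real.sqrt (2 * Real.pi) : ℂ) (-1) := rfl

lemma saddleSeries_one :
    saddleSeries 1 = besselSeries (I * (Real.sqrt (2 * Real.pi) : ℂ)) 1 := by
  simp [saddleSeries, besselSeries]

lemma Gamma_nat_add_half' (m : ℕ) :
    Gamma (m + 1 / 2) = ((2 * m - 1)‼ : ℂ) * (Real.sqrt Real.pi : ℂ) / 2 ^ m := by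
  have h := congrArg (fun x : ℝ => (x : ℂ)) (Real.Gamma_nat_add_half m)
  rw [← Complex.Gamma_ofReal] at h
  push_cast at h
  exact h

lemma sqrt_pi_ne_zero : (Real.sqrt Real.pi : ℂ) ≠ 0 := by
  simpa using (Real.sqrt_pos.2 Real.pi_pos).ne'

/-- One of the two double factorials in `a_m` is `2^m Γ(m + 1/2) / √π`. The Borel transform divides
this Gamma factor out and leaves a binomial series. -/
lemma besselCoeff_eq (m : ℕ) :
    besselCoeff m = halfBinom m * Gamma (m + 1 / 2) / ((Real.sqrt Real.pi : ℂ) * 2 ^ m) := by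
  have h2 : (m ! : ℂ) ≠ 0 := by exact_mod_cast m.factorial_ne_zero
  rw [besselCoeff, Gamma_nat_add_half', halfBinom]
  have := sqrt_pi_ne_zero
  rw [show (8 : ℂ) = 2 * 2 * 2 by norm_num, mul_pow, mul_pow]
  field_simp

lemma Gamma_nat_add_half_ne_zero (m : ℕ) : Gamma (m + 1 / 2 : ℂ) ≠ 0 := by
  apply Complex.Gamma_ne_zero_of_re_pos
  norm_num
  positivity

lemma hasSum_borel_besselSeries (C s : ℂ) {ξ : ℂ} (h : ‖s * ξ‖ < 2) :
    HasSum (fun m : ℕ => PowerSeries.coeff m (besselSeries C s) / Gamma (m + 1 / 2) * ξ ^ m)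
      (C / (Real.sqrt Real.pi : ℂ) * (1 - s * ξ / 2) ^ (-(1 / 2) : ℂ)) := by
  have h1 : ‖s * ξ / 2‖ < 1 := by
    rw [norm_div, Complex.norm_ofNat, div_lt_one (by norm_num)]
    exact h
  have h2 := (hasSum_inv_sqrt_one_sub h1).mul_left (C / (Real.sqrt Real.pi : ℂ))
  suffices h3 : (fun m : ℕ => PowerSeries.coeff m (besselSeries C s) / Gamma (m + 1 / 2) * ξ ^ m) =
      fun m : ℕ => C / (Real.sqrt Real.pi : ℂ) * (halfBinom m * (s * ξ / 2) ^ m) by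
    rw [h3]
    exact h2
  funext m
  have hG := Gamma_nat_add_half_ne_zero m
  have := sqrt_pi_ne_zero
  simp only [besselSeries, PowerSeries.coeff_mk]
  rw [besselCoeff_eq, div_pow, mul_pow]
  generalize Gamma (m + 1 / 2 : ℂ) = G at hG ⊢
  field_simp

lemma borelConvergent_besselSeries (C s : ℂ) (hs : ‖s‖ = 1) :
    BorelConvergent (1 / 2) (besselSeries C s) :=
  ⟨2, by norm_num, fun ξ hξ =>
    (hasSum_borel_besselSeries C s (by rw [norm_mul, hs, one_mul]; exact hξ)).summable⟩

lemma borelConvergent_zero (α : ℂ) : BorelConvergent α 0 :=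
  ⟨1, one_pos, fun ξ _ => by simp⟩

lemma borel_zero (α u ξ : ℂ) : borel α u 0 ξ = 0 := by simp [borel]

lemma borel_besselSeries (C s u : ℂ) {ξ : ℂ} (h : ‖s * ξ‖ < 2) :
    borel (1 / 2) u (besselSeries C s) ξ =
      u ^ (-(1 / 2) : ℂ) * (C / (Real.sqrt Real.pi : ℂ)) *
        ((ξ / u) ^ (-(1 / 2) : ℂ) * (1 - s * ξ / 2) ^ (-(1 / 2) : ℂ)) := by
  rw [borel, (hasSum_borel_besselSeries C s h).tsum_eq,
    show (1 / 2 - 1 : ℂ) = -(1 / 2) by norm_num]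
  ring

/-! ### Branches of powers -/

/-- The logarithm is additive as long as the sum of the arguments stays in `(-π, π]`. -/
lemma cpow_mul_exp_I {z : ℂ} (hz : z ≠ 0) {β : ℝ} (h1 : -Real.pi < z.arg + β)
    (h2 : z.arg + β ≤ Real.pi) (c : ℂ) :
    (z * exp (β * I)) ^ c = z ^ c * exp (β * I * c) := by
  have h : log (z * exp (β * I)) = log z + β * I := by
    conv_lhs => rw [← exp_log hz, ← Complex.exp_add]
    rw [log_exp] <;> simp [log_im, h1, h2]
  rw [cpow_def_of_ne_zero (mul_ne_zero hz (exp_ne_zero _)), cpow_def_of_ne_zero hz, h, add_mul,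
    Complex.exp_add]

lemma cpow_mul_exp_I_of_re_pos {z : ℂ} (hz : 0 < z.re) {β : ℝ} (hβ : |β| ≤ Real.pi / 2) (c : ℂ) :
    (z * exp (β * I)) ^ c = z ^ c * exp (β * I * c) := by
  have h := abs_lt.1 (abs_arg_lt_pi_div_two_iff.2 (Or.inl hz))
  have h' := abs_le.1 hβ
  apply cpow_mul_exp_I
  · rintro rfl
    simp at hz
  · linarith
  · linarith

/-- The branch of `(1 - η/2)^{-1/2}` which is analytic off the upward vertical cut from `2`. -/
def lowerRoot (η : ℂ) : ℂ :=
  exp (-(Real.pi / 4 * I)) * ((1 - η / 2) * exp ((-(Real.pi / 2) : ℝ) * I)) ^ (-(1 / 2) : ℂ)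

lemma exp_neg_pi_div_two : exp ((-(Real.pi / 2) : ℝ) * I) = -I := by
  push_cast
  rw [neg_mul, Complex.exp_neg, Complex.exp_pi_div_two_mul_I]
  simp

lemma lowerRoot_eq_of_re_lt {η : ℂ} (h : η.re < 2) :
    lowerRoot η = (1 - η / 2) ^ (-(1 / 2) : ℂ) := by
  have h1 : 0 < (1 - η / 2).re := by
    simp
    linarith
  rw [lowerRoot, cpow_mul_exp_I_of_re_pos h1 (by rw [abs_neg, abs_of_pos (by positivity)]),
    mul_left_comm, ← Complex.exp_add]
  rw [show -(Real.pi / 4 * I : ℂ) + (-(Real.pi / 2) : ℝ) * I * -(1 / 2) = 0 by push_cast; ring]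
  simp

/-- The cut points upwards, so the region to the right of `2` is reached from below. There the
argument of `1 - η/2` has grown by `π`, which gives the factor `e^{-iπ/2} = -i`. -/
lemma lowerRoot_eq_of_lt_re {η : ℂ} (h : 2 < η.re) :
    lowerRoot η = -I * (η / 2 - 1) ^ (-(1 / 2) : ℂ) := by
  have h1 : 0 < (η / 2 - 1).re := by
    simp
    linarith
  have h2 : (1 - η / 2) * exp ((-(Real.pi / 2) : ℝ) * I) =
      (η / 2 - 1) * exp ((Real.pi / 2 : ℝ) * I) := by
    rw [exp_neg_pi_div_two]
    push_cast
    rw [Complex.exp_pi_div_two_mul_I]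
    ring
  rw [lowerRoot, h2, cpow_mul_exp_I_of_re_pos h1 (by rw [abs_of_pos (by positivity)]),
    mul_left_comm, ← Complex.exp_add, mul_comm, ← exp_neg_pi_div_two]
  congr 2
  push_cast
  ring

/-- The power is cut where `-i (1 - η/2) ≤ 0`, that is, where `η` lies on the half line `2 + i [0,
∞)`. -/
lemma analyticAt_lowerRoot {η : ℂ} (h : η.re ≠ 2 ∨ η.im < 0) : AnalyticAt ℂ lowerRoot η := by
  unfold lowerRoot
  refine analyticAt_const.mul (AnalyticAt.cpow ?_ analyticAt_const ?_)
  · fun_prop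
  · rw [exp_neg_pi_div_two, mem_slitPlane_iff]
    simp
    rcases h with h | h
    · right
      intro h'
      apply h
      linarith
    · left
      linarith

/-! ### Continuation along paths -/

/-- A single function that is analytic along the whole path serves as a constant family of germs. -/
lemma isContinuation_of_analyticAt {γ : ℝ → ℂ} {f g : ℂ → ℂ}
    (hg : ∀ t ∈ Set.Icc (0 : ℝ) 1, AnalyticAt ℂ g (γ t)) (hf : g =ᶠ[𝓝 (γ 0)] f) :
    IsContinuation γ f g :=
  ⟨fun _ => g, hg, fun _ _ => Eventually.of_forall fun _ => EventuallyEq.rfl, hf,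
    EventuallyEq.rfl⟩

lemma isContinuation_zero (γ : ℝ → ℂ) : IsContinuation γ (fun _ => 0) fun _ => 0 :=
  isContinuation_of_analyticAt (fun _ _ => analyticAt_const) EventuallyEq.rfl

lemma hasAlien_zero (α ω : ℂ) : HasAlien α ω 0 0 := by
  refine ⟨borelConvergent_zero α, borelConvergent_zero α, Eventually.of_forall fun ε =>
    ⟨fun _ => 0, fun _ => 0, ?_, isContinuation_zero _, ?_⟩⟩
  · have h : borel α (dir ω) 0 = fun _ => 0 := funext fun ξ => borel_zero α _ ξ
    rw [h]
    exact isContinuation_zero _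
  · exact Eventually.of_forall fun ξ => by simp [borel_zero]

lemma dir_mul_pos {u : ℂ} (hu : ‖u‖ = 1) {r : ℝ} (hr : 0 < r) : dir (u * r) = u := by
  have : (r : ℂ) ≠ 0 := by exact_mod_cast hr.ne'
  simp [dir, hu, abs_of_pos hr, this]

lemma norm_mul_pos {u : ℂ} (hu : ‖u‖ = 1) {r : ℝ} (hr : 0 < r) : ‖u * (r : ℂ)‖ = r := by
  simp [hu, abs_of_pos hr]

lemma ne_zero_of_norm_eq_one {u : ℂ} (hu : ‖u‖ = 1) : u ≠ 0 := by
  rintro rfl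
  simp at hu

/-- Division by `u` turns the ray into the positive real axis, so that one computation covers both
directions `u = 1` and `u = -1`. -/
lemma alienPath_div {u : ℂ} (hu : ‖u‖ = 1) {r : ℝ} (hr : 0 < r) (ε t : ℝ) :
    alienPath (u * r) ε t / u = ((ε + t * r : ℝ) : ℂ) - (4 * ε * t * (1 - t) : ℝ) * I := by
  rw [alienPath, dir_mul_pos hu hr, norm_mul_pos hu hr]
  field_simp [ne_zero_of_norm_eq_one hu]

lemma alienLoop_div {u : ℂ} (hu : ‖u‖ = 1) {r : ℝ} (hr : 0 < r) (ε t : ℝ) :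
    alienLoop (u * r) ε t / u = r + ε * exp (-(2 * Real.pi * t * I)) := by
  rw [alienLoop, dir_mul_pos hu hr]
  field_simp [ne_zero_of_norm_eq_one hu]

lemma analyticAt_comp_div {f : ℂ → ℂ} {u ξ : ℂ} (K : ℂ) (hf : AnalyticAt ℂ f (ξ / u)) :
    AnalyticAt ℂ (fun x => K * f (x / u)) ξ := by
  have h : AnalyticAt ℂ (fun x : ℂ => x / u) ξ := by
    simp only [div_eq_mul_inv]
    fun_prop
  exact analyticAt_const.mul (AnalyticAt.fun_comp hf h)

/-- The alien operator vanishes if the Borel transform is analytic along the path and the loop. -/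
lemma hasAlien_zero_of_analyticAt {u : ℂ} (hu : ‖u‖ = 1) {r : ℝ} (hr : 0 < r)
    {ψ : PowerSeries ℂ} (hψ : BorelConvergent (1 / 2) ψ) {K : ℂ} {f : ℂ → ℂ}
    (h : ∀ᶠ ε : ℝ in 𝓝[>] (0 : ℝ),
      (∀ᶠ ξ in 𝓝 ((ε : ℂ) * u), K * f (ξ / u) = borel (1 / 2) u ψ ξ) ∧
      (∀ t ∈ Set.Icc (0 : ℝ) 1, AnalyticAt ℂ f (alienPath (u * r) ε t / u)) ∧
      ∀ t ∈ Set.Icc (0 : ℝ) 1, AnalyticAt ℂ f (alienLoop (u * r) ε t / u)) :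
    HasAlien (1 / 2) (u * r) ψ 0 := by
  refine ⟨hψ, borelConvergent_zero _, h.mono fun ε hε =>
    ⟨fun ξ => K * f (ξ / u), fun ξ => K * f (ξ / u), ?_, ?_, ?_⟩⟩
  · refine isContinuation_of_analyticAt (fun t ht => analyticAt_comp_div _ (hε.2.1 t ht)) ?_
    rw [dir_mul_pos hu hr]
    have h0 : alienPath (u * r) ε 0 = ε * u := by
      rw [alienPath, dir_mul_pos hu hr]
      simp [mul_comm]
    rw [h0]
    exact hε.1
  · exact isContinuation_of_analyticAt (fun t ht => analyticAt_comp_div _ (hε.2.2 t ht))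
      EventuallyEq.rfl
  · exact Eventually.of_forall fun ξ => by simp [borel_zero]

lemma alienPath_div_re {u : ℂ} (hu : ‖u‖ = 1) {r : ℝ} (hr : 0 < r) (ε t : ℝ) :
    (alienPath (u * r) ε t / u).re = ε + t * r := by
  rw [alienPath_div hu hr]
  simp

lemma alienPath_div_im {u : ℂ} (hu : ‖u‖ = 1) {r : ℝ} (hr : 0 < r) (ε t : ℝ) :
    (alienPath (u * r) ε t / u).im = -(4 * ε * t * (1 - t)) := by
  rw [alienPath_div hu hr]
  simp

lemma abs_alienLoop_div_re_sub_le {u : ℂ} (hu : ‖u‖ = 1) {r : ℝ} (hr : 0 < r) {ε : ℝ}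
    (hε : 0 < ε) (t : ℝ) : |(alienLoop (u * r) ε t / u).re - r| ≤ ε := by
  have h1 : (alienLoop (u * r) ε t / u).re - r = (ε * exp ((-(2 * Real.pi * t) : ℝ) * I)).re := by
    rw [alienLoop_div hu hr]
    push_cast
    simp [neg_mul]
  rw [h1]
  refine (abs_re_le_norm _).trans ?_
  rw [norm_mul, norm_exp_ofReal_mul_I]
  simp [abs_of_pos hε]

lemma eventually_norm_lt_two {u : ℂ} (hu : ‖u‖ = 1) {ε : ℝ} (hε : 0 < ε) (h2 : ε < 2) :
    ∀ᶠ ξ in 𝓝 (ε * u : ℂ), ‖ξ‖ < 2 := by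
  apply continuous_norm.continuousAt.eventually_lt continuousAt_const
  simp [hu, abs_of_pos hε, h2]

lemma analyticAt_inv_sqrt {η : ℂ} (h : 0 < η.re) :
    AnalyticAt ℂ (fun η : ℂ => η ^ (-(1 / 2) : ℂ)) η :=
  analyticAt_id.cpow analyticAt_const (mem_slitPlane_iff.2 (Or.inl h))

/-- No singularity lies on the ray opposite to the one through the singular point. -/
lemma hasAlien_besselSeries_neg {u : ℂ} (hu : ‖u‖ = 1) {r : ℝ} (hr : 0 < r) (C : ℂ) :
    HasAlien (1 / 2) (u * r) (besselSeries C (-u⁻¹)) 0 := by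
  have hs : ‖-u⁻¹‖ = 1 := by simp [hu]
  have han : ∀ η : ℂ, 0 < η.re →
      AnalyticAt ℂ (fun η : ℂ => η ^ (-(1 / 2) : ℂ) * (1 + η / 2) ^ (-(1 / 2) : ℂ)) η := by
    intro η hη
    refine (analyticAt_inv_sqrt hη).mul (AnalyticAt.cpow (by fun_prop) analyticAt_const ?_)
    refine mem_slitPlane_iff.2 (Or.inl ?_)
    simp
    linarith
  refine hasAlien_zero_of_analyticAt hu hr (borelConvergent_besselSeries _ _ hs)
    (K := u ^ (-(1 / 2) : ℂ) * (C / (Real.sqrt Real.pi : ℂ)))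
    (f := fun η : ℂ => η ^ (-(1 / 2) : ℂ) * (1 + η / 2) ^ (-(1 / 2) : ℂ)) ?_
  -- The bound `ε < 2` puts the starting point into the disc of convergence, and `ε < r` keeps the
  -- loop in the right half plane.
  filter_upwards [Ioo_mem_nhdsGT (lt_min two_pos hr)] with ε hε
  have hε' := lt_min_iff.1 hε.2
  refine ⟨?_, fun t ht => han _ ?_, fun t _ => han _ ?_⟩
  · filter_upwards [eventually_norm_lt_two hu hε.1 hε'.1] with ξ hξ
    rw [borel_besselSeries C _ u (by rw [norm_mul, hs, one_mul]; exact hξ)]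
    congr 3
    ring
  · rw [alienPath_div_re hu hr]
    have := mul_nonneg ht.1 hr.le
    linarith [hε.1]
  · have := abs_le.1 (abs_alienLoop_div_re_sub_le hu hr hε.1 t)
    linarith

lemma analyticAt_lowerBranch {η : ℂ} (h0 : 0 < η.re) (h : η.re ≠ 2 ∨ η.im < 0) :
    AnalyticAt ℂ (fun η : ℂ => η ^ (-(1 / 2) : ℂ) * lowerRoot η) η :=
  (analyticAt_inv_sqrt h0).mul (analyticAt_lowerRoot h)

lemma lowerBranch_eq_borel {u : ℂ} (hu : ‖u‖ = 1) (C : ℂ) {ε : ℝ} (hε : 0 < ε) (h2 : ε < 2) :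
    ∀ᶠ ξ in 𝓝 (ε * u : ℂ), u ^ (-(1 / 2) : ℂ) * (C / (Real.sqrt Real.pi : ℂ)) *
        ((ξ / u) ^ (-(1 / 2) : ℂ) * lowerRoot (ξ / u)) =
      borel (1 / 2) u (besselSeries C u⁻¹) ξ := by
  filter_upwards [eventually_norm_lt_two hu hε h2] with ξ hξ
  rw [borel_besselSeries C _ u (by simpa [hu] using hξ), lowerRoot_eq_of_re_lt]
  · congr 3
    ring
  · refine (re_le_norm _).trans_lt ?_
    simpa [hu] using hξ

/-- Between its end points the path is strictly below the axis, where the branch is analytic even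
over `Re η = 2`. The end points are real and have to differ from `2`. -/
lemma analyticAt_lowerBranch_alienPath {u : ℂ} (hu : ‖u‖ = 1) {r : ℝ} (hr : 0 < r) {ε : ℝ}
    (hε : 0 < ε) (h2 : ε < 2) (hrε : ε + r ≠ 2) {t : ℝ} (ht : t ∈ Set.Icc (0 : ℝ) 1) :
    AnalyticAt ℂ (fun η : ℂ => η ^ (-(1 / 2) : ℂ) * lowerRoot η) (alienPath (u * r) ε t / u) := by
  apply analyticAt_lowerBranch
  · rw [alienPath_div_re hu hr]
    have := mul_nonneg ht.1 hr.le
    linarith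
  · rw [alienPath_div_re hu hr, alienPath_div_im hu hr]
    rcases ht.1.eq_or_lt with rfl | h0
    · left
      simpa using h2.ne
    rcases ht.2.eq_or_lt with rfl | h1
    · left
      simpa using hrε
    · right
      have := mul_pos (mul_pos hε h0) (sub_pos.2 h1)
      linarith

/-- The only singularity on the ray through the singular point is the latter. -/
lemma hasAlien_besselSeries_of_ne {u : ℂ} (hu : ‖u‖ = 1) {r : ℝ} (hr : 0 < r) (hr2 : r ≠ 2)
    (C : ℂ) : HasAlien (1 / 2) (u * r) (besselSeries C u⁻¹) 0 := by
  have hs : ‖u⁻¹‖ = 1 := by simp [hu]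
  refine hasAlien_zero_of_analyticAt hu hr (borelConvergent_besselSeries _ _ hs)
    (K := u ^ (-(1 / 2) : ℂ) * (C / (Real.sqrt Real.pi : ℂ)))
    (f := fun η : ℂ => η ^ (-(1 / 2) : ℂ) * lowerRoot η) ?_
  have h0 : 0 < |r - 2| := abs_pos.2 (sub_ne_zero.2 hr2)
  -- The additional bound `ε < |r - 2|` keeps the end of the path and the whole loop off the line
  -- `Re η = 2`.
  filter_upwards [Ioo_mem_nhdsGT (lt_min (lt_min two_pos hr) h0)] with ε hε
  obtain ⟨h12, h3⟩ := lt_min_iff.1 hε.2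
  obtain ⟨h1, h2⟩ := lt_min_iff.1 h12
  refine ⟨lowerBranch_eq_borel hu C hε.1 h1,
    fun t ht => analyticAt_lowerBranch_alienPath hu hr hε.1 h1 ?_ ht,
    fun t _ => ?_⟩
  · intro h
    rw [show r - 2 = -ε by linarith, abs_neg, abs_of_pos hε.1] at h3
    exact h3.false
  · have := abs_alienLoop_div_re_sub_le hu hr hε.1 t
    apply analyticAt_lowerBranch
    · linarith [(abs_le.1 this).1]
    · left
      intro h
      rw [h, abs_sub_comm] at this
      exact absurd this (not_le.2 h3)

/-! ### The continuation around the singular point -/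

/-- The continuation of `z^{-1/2}` along the clockwise circle. -/
def loopRoot (t : ℝ) (z : ℂ) : ℂ :=
  exp (Real.pi * t * I) * (z * exp ((2 * Real.pi * t : ℝ) * I)) ^ (-(1 / 2) : ℂ)

/-- A change of the parameter by at most `1/4` rotates by at most `π/2`, and a point of the right
half plane then does not cross the cut. This is the local compatibility of the germs along the loop.
-/
lemma loopRoot_eq {s t : ℝ} (hst : |t - s| ≤ 1 / 4) {z : ℂ}
    (hz : 0 < (z * exp ((2 * Real.pi * s : ℝ) * I)).re) : loopRoot s z = loopRoot t z := by
  have h : z * exp ((2 * Real.pi * t : ℝ) * I) =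
      z * exp ((2 * Real.pi * s : ℝ) * I) * exp ((2 * Real.pi * (t - s) : ℝ) * I) := by
    rw [mul_assoc z, ← Complex.exp_add]
    congr 2
    push_cast
    ring
  rw [loopRoot, loopRoot, h, cpow_mul_exp_I_of_re_pos hz, mul_left_comm (exp (Real.pi * t * I)),
    ← Complex.exp_add, mul_comm]
  · congr 2
    push_cast
    ring
  · rw [abs_mul, abs_of_pos (by positivity)]
    nlinarith [Real.pi_pos]

lemma loopRoot_zero (z : ℂ) : loopRoot 0 z = z ^ (-(1 / 2) : ℂ) := by simp [loopRoot]

lemma loopRoot_one (z : ℂ) : loopRoot 1 z = -z ^ (-(1 / 2) : ℂ) := by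
  simp [loopRoot, Complex.exp_pi_mul_I]

lemma circle_mul_exp (ε t : ℝ) :
    (ε * exp (-(2 * Real.pi * t * I))) * exp ((2 * Real.pi * t : ℝ) * I) = ε := by
  rw [mul_assoc, ← Complex.exp_add]
  push_cast
  simp

lemma analyticAt_loopRoot {t : ℝ} {z : ℂ} (hz : 0 < (z * exp ((2 * Real.pi * t : ℝ) * I)).re) :
    AnalyticAt ℂ (loopRoot t) z := by
  unfold loopRoot
  exact analyticAt_const.mul (AnalyticAt.cpow (by fun_prop) analyticAt_const
    (mem_slitPlane_iff.2 (Or.inl hz)))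

lemma real_mul_cpow {x : ℝ} (hx : 0 < x) {z : ℂ} (hz : z ≠ 0) (c : ℂ) :
    (x * z) ^ c = (x : ℂ) ^ c * z ^ c := by
  have hx' : (x : ℂ) ≠ 0 := by exact_mod_cast hx.ne'
  rw [cpow_def_of_ne_zero (mul_ne_zero hx' hz), cpow_def_of_ne_zero hx', cpow_def_of_ne_zero hz,
    log_ofReal_mul hx hz, ← ofReal_log hx.le, add_mul, Complex.exp_add]

/-- On both sides a factor `2^{-1/2}` can be pulled out of one root. The identity exchanges the
branch points `0` and `2`, and this is why the variation of one saddle is the Borel transform of the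
other. -/
lemma inv_sqrt_mul_inv_sqrt_shift {η : ℂ} (h : 2 < η.re) :
    η ^ (-(1 / 2) : ℂ) * (η / 2 - 1) ^ (-(1 / 2) : ℂ) =
      (η - 2) ^ (-(1 / 2) : ℂ) * (1 + (η - 2) / 2) ^ (-(1 / 2) : ℂ) := by
  have h1 : η / 2 - 1 ≠ 0 := by
    intro h'
    have := congrArg re h'
    simp at this
    linarith
  have h2 : 1 + (η - 2) / 2 ≠ 0 := by
    intro h'
    have := congrArg re h'
    simp at this
    linarith
  have e1 : η = (2 : ℝ) * (1 + (η - 2) / 2) := by push_cast; ring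
  have e2 : η - 2 = (2 : ℝ) * (η / 2 - 1) := by push_cast; ring
  have e3 := real_mul_cpow two_pos h1 (-(1 / 2))
  have e4 := real_mul_cpow two_pos h2 (-(1 / 2))
  rw [← e2] at e3
  rw [← e1] at e4
  rw [e3, e4]
  ring

/-- The rotation in `loopRoot t` undoes the turn of the loop, so its argument at the base point of
the germ is always the positive number `ε/2`. -/
lemma alienLoop_div_half {u : ℂ} (hu : ‖u‖ = 1) (ε t : ℝ) :
    (alienLoop (u * (2 : ℝ)) ε t / u / 2 - 1) * exp ((2 * Real.pi * t : ℝ) * I) =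
      (ε / 2 : ℝ) := by
  rw [alienLoop_div hu two_pos, ← circle_mul_exp (ε / 2) t]
  push_cast
  ring

/-- The alien operator at the singular point. -/
lemma hasAlien_besselSeries {u : ℂ} (hu : ‖u‖ = 1) (C : ℂ) :
    HasAlien (1 / 2) (u * (2 : ℝ)) (besselSeries C u⁻¹) (besselSeries (-2 * I * C) (-u⁻¹)) := by
  have hs : ‖u⁻¹‖ = 1 := by simp [hu]
  have hs' : ‖-u⁻¹‖ = 1 := by simp [hu]
  have hu0 := ne_zero_of_norm_eq_one hu
  refine ⟨borelConvergent_besselSeries _ _ hs, borelConvergent_besselSeries _ _ hs', ?_⟩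
  set K := u ^ (-(1 / 2) : ℂ) * (C / (Real.sqrt Real.pi : ℂ)) with hK
  filter_upwards [Ioo_mem_nhdsGT (two_pos : (0 : ℝ) < 2)] with ε hε
  -- Only the root that is singular at `2` moves along the loop. The factor `ξ^{-1/2}` keeps its
  -- principal branch, since the loop stays in the right half plane.
  set F : ℝ → ℂ → ℂ := fun t ξ =>
    K * ((ξ / u) ^ (-(1 / 2) : ℂ) * (-I * loopRoot t (ξ / u / 2 - 1))) with hF
  have hbase : alienLoop (u * (2 : ℝ)) ε 0 = u * (2 : ℝ) + ε * u := by
    rw [alienLoop, dir_mul_pos hu two_pos]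
    simp
  have hre : ∀ᶠ ξ in 𝓝 (u * (2 : ℝ) + ε * u : ℂ), 2 < (ξ / u).re := by
    have hc : Continuous fun ξ : ℂ => (ξ / u).re := by fun_prop
    refine continuousAt_const.eventually_lt hc.continuousAt ?_
    rw [show (u * (2 : ℝ) + ε * u : ℂ) / u = ((2 + ε : ℝ) : ℂ) by push_cast; field_simp]
    simpa using hε.1
  refine ⟨fun ξ => K * ((ξ / u) ^ (-(1 / 2) : ℂ) * lowerRoot (ξ / u)), F 1, ?_, ⟨F, ?_, ?_, ?_,
    EventuallyEq.rfl⟩, ?_⟩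
  · refine isContinuation_of_analyticAt (fun t ht => analyticAt_comp_div _
      (analyticAt_lowerBranch_alienPath hu two_pos hε.1 hε.2 (by linarith [hε.1]) ht)) ?_
    rw [dir_mul_pos hu two_pos]
    have h : alienPath (u * (2 : ℝ)) ε 0 = ε * u := by
      rw [alienPath, dir_mul_pos hu two_pos]
      simp [mul_comm]
    rw [h]
    exact lowerBranch_eq_borel hu C hε.1 hε.2
  · intro t _
    refine analyticAt_comp_div K
      (f := fun η => η ^ (-(1 / 2) : ℂ) * (-I * loopRoot t (η / 2 - 1))) ?_
    refine (analyticAt_inv_sqrt ?_).mul (analyticAt_const.mul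
      (AnalyticAt.fun_comp (analyticAt_loopRoot ?_) (by fun_prop)))
    · have := abs_le.1 (abs_alienLoop_div_re_sub_le hu two_pos hε.1 t)
      linarith [hε.2]
    · rw [alienLoop_div_half hu]
      simpa using hε.1
  · intro t _
    apply eventually_nhdsWithin_of_eventually_nhds
    filter_upwards [Metric.closedBall_mem_nhds t (by norm_num : (0 : ℝ) < 1 / 4)] with s hs
    have hc : Continuous fun ξ : ℂ => ((ξ / u / 2 - 1) * exp ((2 * Real.pi * s : ℝ) * I)).re := by
      fun_prop
    have h0 : ∀ᶠ ξ in 𝓝 (alienLoop (u * (2 : ℝ)) ε s),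
        0 < ((ξ / u / 2 - 1) * exp ((2 * Real.pi * s : ℝ) * I)).re := by
      refine continuousAt_const.eventually_lt hc.continuousAt ?_
      rw [alienLoop_div_half hu]
      simpa using hε.1
    filter_upwards [h0] with ξ hξ
    simp only [hF]
    rw [loopRoot_eq (t := t) _ hξ]
    rwa [Metric.mem_closedBall, Real.dist_eq, abs_sub_comm] at hs
  · rw [hbase]
    filter_upwards [hre] with ξ hξ
    simp only [hF]
    rw [loopRoot_zero, lowerRoot_eq_of_lt_re hξ]
  · rw [dir_mul_pos hu two_pos]
    have hnear : ∀ᶠ ξ in 𝓝 (u * (2 : ℝ) + ε * u : ℂ), ‖-u⁻¹ * (ξ - u * (2 : ℝ))‖ < 2 := by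
      have hc : Continuous fun ξ : ℂ => ‖-u⁻¹ * (ξ - u * (2 : ℝ))‖ := by fun_prop
      refine hc.continuousAt.eventually_lt continuousAt_const ?_
      rw [norm_mul, hs', one_mul, add_sub_cancel_left, norm_mul, hu]
      simpa [abs_of_pos hε.1] using hε.2
    filter_upwards [hre, hnear] with ξ hξ hξ'
    have e1 : (ξ - u * (2 : ℝ)) / u = ξ / u - 2 := by
      push_cast
      field_simp
    have e2 : 1 - -u⁻¹ * (ξ - u * (2 : ℝ)) / 2 = 1 + (ξ / u - 2) / 2 := by
      rw [← e1]
      ring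
    rw [borel_besselSeries _ _ u hξ', e1, e2, ← inv_sqrt_mul_inv_sqrt_shift hξ,
      lowerRoot_eq_of_lt_re hξ]
    simp only [hF, hK]
    -- The full turn reverses the sign of the root, so the variation is twice the continuation.
    -- Together with the factor `-i` this is the constant `-2i`.
    rw [loopRoot_one]
    ring

/-! ### The pointed alien operators and the Stokes automorphism -/

lemma rotAction_critPt_zero : rotAction (Real.pi / 2) (critPt 0) = 1 := by
  have h1 : exp (-(((Real.pi / 2 : ℝ) : ℂ) * I)) = -I := by
    rw [← exp_neg_pi_div_two]
    push_cast
    ring_nf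
  rw [rotAction, h1]
  simp [critPt, Complex.sinh_mul_I]

lemma rotAction_critPt_one : rotAction (Real.pi / 2) (critPt 1) = -1 := by
  have h1 : exp (-(((Real.pi / 2 : ℝ) : ℂ) * I)) = -I := by
    rw [← exp_neg_pi_div_two]
    push_cast
    ring_nf
  rw [rotAction, h1]
  simp [critPt, Complex.sinh_mul_I]

lemma saddleExpansion_zero : saddleExpansion 0 =
    Finsupp.single 1 (besselSeries (Real.sqrt (2 * Real.pi) : ℂ) (-1)) := by
  rw [saddleExpansion, rotAction_critPt_zero, saddleSeries_zero]

lemma saddleExpansion_one : saddleExpansion 1 =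
    Finsupp.single (-1) (besselSeries (I * (Real.sqrt (2 * Real.pi) : ℂ)) 1) := by
  rw [saddleExpansion, rotAction_critPt_one, saddleSeries_one]

lemma hasPointedAlien_single {ω σ : ℂ} {ψ χ : PowerSeries ℂ} (h : HasAlien (1 / 2) ω ψ χ) :
    HasPointedAlien ω (Finsupp.single σ ψ) (Finsupp.single (σ + ω) χ) := by
  intro τ
  by_cases hτ : τ = σ
  · subst hτ
    simpa using h
  · rw [Finsupp.single_eq_of_ne hτ, Finsupp.single_eq_of_ne fun h' => hτ (add_right_cancel h')]
    exact hasAlien_zero _ _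

lemma hasPointedAlien_single_zero {ω σ : ℂ} {ψ : PowerSeries ℂ} (h : HasAlien (1 / 2) ω ψ 0) :
    HasPointedAlien ω (Finsupp.single σ ψ) 0 := by
  simpa using hasPointedAlien_single (σ := σ) h

lemma zsmul_besselSeries (n : ℤ) (C s : ℂ) :
    n • besselSeries C s = besselSeries (n * C) s := by
  ext m
  rw [map_zsmul]
  simp [besselSeries, mul_assoc]

lemma hasPointedAlien_saddleExpansion_zero {r : ℝ} (hr : 0 < r) :
    HasPointedAlien (r : ℂ) (saddleExpansion 0) 0 := by
  rw [saddleExpansion_zero]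
  apply hasPointedAlien_single_zero
  simpa using hasAlien_besselSeries_neg (u := 1) (by simp) hr (Real.sqrt (2 * Real.pi) : ℂ)

lemma hasPointedAlien_saddleExpansion_one {r : ℝ} (hr : 0 < r) (hr2 : r ≠ 2) :
    HasPointedAlien (r : ℂ) (saddleExpansion 1) 0 := by
  rw [saddleExpansion_one]
  apply hasPointedAlien_single_zero
  simpa using hasAlien_besselSeries_of_ne (u := 1) (by simp) hr hr2
    (I * (Real.sqrt (2 * Real.pi) : ℂ))

lemma hasPointedAlien_two_saddleExpansion_one :
    HasPointedAlien 2 (saddleExpansion 1) ((2 : ℤ) • saddleExpansion 0) := by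
  rw [saddleExpansion_one, saddleExpansion_zero, Finsupp.smul_single, zsmul_besselSeries]
  have h := hasPointedAlien_single (σ := -1) (hasAlien_besselSeries (u := 1) (by simp)
    (I * (Real.sqrt (2 * Real.pi) : ℂ)))
  -- The prefactor `i` of the lower saddle turns `-2i` into `2`.
  have e : -2 * I * (I * (Real.sqrt (2 * Real.pi) : ℂ)) = 2 * (Real.sqrt (2 * Real.pi) : ℂ) := by
    linear_combination -2 * (Real.sqrt (2 * Real.pi) : ℂ) * I_mul_I
  rw [e] at h
  norm_num at h ⊢
  exact h

lemma hasPointedAlien_neg_two_saddleExpansion_zero :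
    HasPointedAlien (-2) (saddleExpansion 0) ((-2 : ℤ) • saddleExpansion 1) := by
  rw [saddleExpansion_one, saddleExpansion_zero, Finsupp.smul_single, zsmul_besselSeries]
  have h := hasPointedAlien_single (σ := 1) (hasAlien_besselSeries (u := -1) (by simp)
    (Real.sqrt (2 * Real.pi) : ℂ))
  -- Here `u = -1`, and `-2i √(2π)` already is `-2` times the prefactor `i √(2π)` of the lower
  -- saddle.
  rw [mul_assoc (-2)] at h
  norm_num at h ⊢
  exact h

lemma hasPointedAlien_neg_two_saddleExpansion_one :
    HasPointedAlien (-2) (saddleExpansion 1) 0 := by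
  rw [saddleExpansion_one]
  apply hasPointedAlien_single_zero
  simpa using hasAlien_besselSeries_neg (u := -1) (by simp) two_pos
    (I * (Real.sqrt (2 * Real.pi) : ℂ))

lemma hasStokes_saddleExpansion (j : Fin 2) : HasStokes (saddleExpansion j)
    (∑ i, (!![1, 2; 0, 1] : Matrix (Fin 2) (Fin 2) ℤ) i j • saddleExpansion i) := by
  fin_cases j
  · refine ⟨fun _ => 0, fun ω hω => hasPointedAlien_saddleExpansion_zero hω, ?_, ?_⟩
    · simp
    · simp
  · refine ⟨fun ω => if ω = 2 then (2 : ℤ) • saddleExpansion 0 else 0, fun ω hω => ?_, ?_, ?_⟩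
    · by_cases h : ω = 2
      · subst h
        simpa using hasPointedAlien_two_saddleExpansion_one
      · simpa [h] using hasPointedAlien_saddleExpansion_one hω h
    · refine (Set.finite_singleton (2 : ℝ)).subset fun ω hω => ?_
      by_contra h
      exact hω.2 (if_neg h)
    · rw [finsum_mem_def, finsum_eq_single _ (2 : ℝ)]
      · simp [add_comm]
      · intro x hx
        simp [Set.indicator, hx]

end

end BesselStokes

/-! ### The thimbles as explicit curves. -/

namespace BesselStokes

noncomputable section

/-! ### The inverse hyperbolic sine -/

/-- The principal branch of `√(1 + ζ²)`. -/
def coshRoot (ζ : ℂ) : ℂ := (1 + ζ ^ 2) ^ (1 / 2 : ℂ)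

/-- The principal branch of the inverse hyperbolic sine. -/
def arcsinh (ζ : ℂ) : ℂ := log (ζ + coshRoot ζ)

lemma coshRoot_sq (ζ : ℂ) : coshRoot ζ ^ 2 = 1 + ζ ^ 2 := by
  rw [coshRoot, one_div]
  exact cpow_nat_inv_pow _ two_ne_zero

/-- The root halves the argument, which then lies in `(-π/2, π/2)`. -/
lemma re_sqrt_pos {z : ℂ} (hz : z ∈ slitPlane) : 0 < (z ^ (1 / 2 : ℂ)).re := by
  have h := mem_slitPlane_iff_arg.1 hz
  have h1 := neg_pi_lt_arg z
  have h2 := (arg_le_pi z).lt_of_ne h.1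
  rw [cpow_def_of_ne_zero h.2, exp_re]
  refine mul_pos (Real.exp_pos _) (Real.cos_pos_of_mem_Ioo ?_)
  have e : (log z * (1 / 2)).im = arg z / 2 := by
    rw [show log z * (1 / 2) = ((1 / 2 : ℝ) : ℂ) * log z by push_cast; ring, im_ofReal_mul, log_im]
    ring
  rw [e]
  constructor <;> linarith

lemma coshRoot_re_pos {ζ : ℂ} (h : 1 + ζ ^ 2 ∈ slitPlane) : 0 < (coshRoot ζ).re :=
  re_sqrt_pos h

lemma ne_zero_of_re_pos {z : ℂ} (h : 0 < z.re) : z ≠ 0 := by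
  rintro rfl
  simp at h

/-- The explicit inverse of `ζ + √(1 + ζ²)` yields both `e^{arcsinh ζ}` and `e^{-arcsinh ζ}`, hence
the values of `sinh` and `cosh`. -/
lemma add_coshRoot_mul_sub (ζ : ℂ) : (ζ + coshRoot ζ) * (coshRoot ζ - ζ) = 1 := by
  linear_combination coshRoot_sq ζ

lemma exp_arcsinh (ζ : ℂ) : exp (arcsinh ζ) = ζ + coshRoot ζ :=
  exp_log (left_ne_zero_of_mul_eq_one (add_coshRoot_mul_sub ζ))

lemma exp_neg_arcsinh (ζ : ℂ) : exp (-arcsinh ζ) = coshRoot ζ - ζ := by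
  rw [Complex.exp_neg, exp_arcsinh, inv_eq_of_mul_eq_one_right (add_coshRoot_mul_sub ζ)]

lemma sinh_arcsinh (ζ : ℂ) : sinh (arcsinh ζ) = ζ := by
  rw [Complex.sinh, exp_arcsinh, exp_neg_arcsinh]
  ring

lemma cosh_arcsinh (ζ : ℂ) : cosh (arcsinh ζ) = coshRoot ζ := by
  rw [Complex.cosh, exp_arcsinh, exp_neg_arcsinh]
  ring

/-- If `ζ + q` with `q = √(1 + ζ²)` were real and nonpositive, its inverse `q - ζ` would have
negative real part, and so would the sum `2q`. -/
lemma add_coshRoot_mem_slitPlane {ζ : ℂ} (h : 1 + ζ ^ 2 ∈ slitPlane) :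
    ζ + coshRoot ζ ∈ slitPlane := by
  have hq := coshRoot_re_pos h
  have h1 := add_coshRoot_mul_sub ζ
  by_contra hn
  rw [mem_slitPlane_iff] at hn
  push Not at hn
  obtain ⟨hre, him⟩ := hn
  have e : ζ + coshRoot ζ = ((ζ + coshRoot ζ).re : ℂ) := Complex.ext rfl (by simpa using him)
  rw [e] at h1
  have h2 := congrArg re h1
  rw [re_ofReal_mul] at h2
  simp only [add_re, sub_re, one_re] at h2 hre
  nlinarith

lemma hasDerivAt_coshRoot {ζ : ℂ} (h : 1 + ζ ^ 2 ∈ slitPlane) :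
    HasDerivAt coshRoot (ζ / coshRoot ζ) ζ := by
  have hq := ne_zero_of_re_pos (coshRoot_re_pos h)
  have h1 : HasDerivAt (fun x : ℂ => 1 + x ^ 2) (2 * ζ) ζ := by
    simpa using (hasDerivAt_pow 2 ζ).const_add 1
  have h2 := h1.cpow_const (c := 1 / 2) h
  refine h2.congr_deriv ?_
  have h3 : (1 + ζ ^ 2) ^ (1 / 2 - 1 : ℂ) = (coshRoot ζ)⁻¹ := by
    rw [show (1 / 2 - 1 : ℂ) = -(1 / 2) by norm_num, cpow_neg, coshRoot]
  rw [h3]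
  field_simp

lemma hasDerivAt_arcsinh {ζ : ℂ} (h : 1 + ζ ^ 2 ∈ slitPlane) :
    HasDerivAt arcsinh (coshRoot ζ)⁻¹ ζ := by
  have hq := ne_zero_of_re_pos (coshRoot_re_pos h)
  have h0 := left_ne_zero_of_mul_eq_one (add_coshRoot_mul_sub ζ)
  have h1 : HasDerivAt (fun x : ℂ => x + coshRoot x) (1 + ζ / coshRoot ζ) ζ :=
    (hasDerivAt_id ζ).add (hasDerivAt_coshRoot h)
  refine (h1.clog (add_coshRoot_mem_slitPlane h)).congr_deriv ?_
  rw [div_eq_iff h0]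
  field_simp
  ring

lemma arcsinh_zero : arcsinh 0 = 0 := by
  simp [arcsinh, coshRoot]

lemma coshRoot_neg (ζ : ℂ) : coshRoot (-ζ) = coshRoot ζ := by
  simp [coshRoot]

lemma arcsinh_neg {ζ : ℂ} (h : 1 + ζ ^ 2 ∈ slitPlane) : arcsinh (-ζ) = -arcsinh ζ := by
  have h1 : -ζ + coshRoot (-ζ) = (ζ + coshRoot ζ)⁻¹ := by
    rw [coshRoot_neg, inv_eq_of_mul_eq_one_right (add_coshRoot_mul_sub ζ)]
    ring
  rw [arcsinh, h1, log_inv _ (slitPlane_arg_ne_pi (add_coshRoot_mem_slitPlane h)), arcsinh]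

/-- `√(1 + ζ²)` is the only square root with positive real part. -/
lemma eq_coshRoot {ζ c : ℂ} (h : 1 + ζ ^ 2 ∈ slitPlane) (hc : 0 < c.re) (hsq : c ^ 2 = 1 + ζ ^ 2) :
    c = coshRoot ζ := by
  have hq := coshRoot_re_pos h
  rcases sq_eq_sq_iff_eq_or_eq_neg.1 (hsq.trans (coshRoot_sq ζ).symm) with h' | h'
  · exact h'
  · rw [h', neg_re] at hc
    linarith

/-! ### The cylinder -/

lemma continuous_toCyl : Continuous toCyl := continuous_quotient_mk'

lemma toCyl_eq_iff {w z : ℂ} : toCyl w = toCyl z ↔ ∃ n : ℤ, w = z + n * (2 * Real.pi * I) := by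
  rw [toCyl, toCyl, QuotientAddGroup.eq, AddSubgroup.mem_zmultiples_iff]
  constructor
  · rintro ⟨n, hn⟩
    refine ⟨-n, ?_⟩
    rw [zsmul_eq_mul] at hn
    push_cast
    linear_combination hn
  · rintro ⟨n, hn⟩
    refine ⟨-n, ?_⟩
    rw [zsmul_eq_mul, hn]
    push_cast
    ring

lemma toCyl_add_int_mul (w : ℂ) (n : ℤ) : toCyl (w + n * (2 * Real.pi * I)) = toCyl w :=
  toCyl_eq_iff.2 ⟨n, rfl⟩

lemma sinh_periodic : Function.Periodic sinh (2 * Real.pi * I) := fun w => by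
  have h : exp (w + 2 * Real.pi * I) = exp w := exp_periodic w
  rw [Complex.sinh, Complex.sinh, Complex.exp_neg, h, Complex.exp_neg]

lemma cosh_periodic : Function.Periodic cosh (2 * Real.pi * I) := fun w => by
  have h : exp (w + 2 * Real.pi * I) = exp w := exp_periodic w
  rw [Complex.cosh, Complex.cosh, Complex.exp_neg, h, Complex.exp_neg]

lemma sinh_eq_of_toCyl_eq {w z : ℂ} (h : toCyl w = toCyl z) : sinh w = sinh z := by
  obtain ⟨n, rfl⟩ := toCyl_eq_iff.1 h
  exact sinh_periodic.int_mul n z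

lemma cosh_eq_of_toCyl_eq {w z : ℂ} (h : toCyl w = toCyl z) : cosh w = cosh z := by
  obtain ⟨n, rfl⟩ := toCyl_eq_iff.1 h
  exact cosh_periodic.int_mul n z

/-- A continuous `2πi`-periodic function has limits along curves which converge on the cylinder. -/
lemma tendsto_of_tendsto_toCyl {f : ℂ → ℂ} (hf : Continuous f)
    (hper : Function.Periodic f (2 * Real.pi * I)) {W : ℝ → ℂ} {l : Filter ℝ} {p : ℂ}
    (h : Tendsto (fun s => toCyl (W s)) l (𝓝 (toCyl p))) :
    Tendsto (fun s => f (W s)) l (𝓝 (f p)) := by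
  have hc : Continuous hper.lift := Continuous.quotient_lift hf _
  exact (hc.tendsto (toCyl p)).comp h

/-- At a critical point `sinh (z/2)` is a coordinate in which the action is exactly quadratic, not
only to second order. -/
lemma sinh_add_of_cosh_eq_zero {p : ℂ} (hp : cosh p = 0) (z : ℂ) :
    sinh (p + z) = sinh p * (1 + 2 * sinh (z / 2) ^ 2) := by
  have h : cosh z = 1 + 2 * sinh (z / 2) ^ 2 := by
    have h1 := Complex.cosh_two_mul (z / 2)
    rw [mul_div_cancel₀ z two_ne_zero, Complex.cosh_sq] at h1
    rw [h1]
    ring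
  rw [Complex.sinh_add, hp, h]
  ring

lemma cosh_add_of_cosh_eq_zero {p : ℂ} (hp : cosh p = 0) (z : ℂ) :
    cosh (p + z) = 2 * sinh p * (sinh (z / 2) * cosh (z / 2)) := by
  have h1 := Complex.sinh_two_mul (z / 2)
  rw [mul_div_cancel₀ z two_ne_zero] at h1
  rw [Complex.cosh_add, hp, h1]
  ring

lemma cos_int_mul_pi' (n : ℤ) : cos (n * Real.pi) = (-1) ^ n := by
  have h := congrArg (fun x : ℝ => (x : ℂ)) (Real.cos_int_mul_pi n)
  push_cast at h
  exact h

lemma sinh_add_int_mul_pi (z : ℂ) (n : ℤ) :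
    sinh (z + n * (Real.pi * I)) = (-1) ^ n * sinh z := by
  have h : ((n : ℂ) * (Real.pi * I)) = ((n : ℂ) * Real.pi) * I := by ring
  rw [Complex.sinh_add, h, Complex.cosh_mul_I, Complex.sinh_mul_I, cos_int_mul_pi',
    Complex.sin_int_mul_pi]
  ring

lemma cosh_add_int_mul_pi (z : ℂ) (n : ℤ) :
    cosh (z + n * (Real.pi * I)) = (-1) ^ n * cosh z := by
  have h : ((n : ℂ) * (Real.pi * I)) = ((n : ℂ) * Real.pi) * I := by ring
  rw [Complex.cosh_add, h, Complex.cosh_mul_I, Complex.sinh_mul_I, cos_int_mul_pi',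
    Complex.sin_int_mul_pi]
  ring

/-! ### The thimble as a curve -/

/-- `κ` is the direction of the thimble of the critical point `p` in phase `θ`. -/
structure IsThimbleDir (θ : ℝ) (p κ : ℂ) : Prop where
  cosh_eq : cosh p = 0
  re_ne : κ.re ≠ 0
  im_ne : κ.im ≠ 0
  normSq_eq : normSq κ = 1 / 2
  exp_eq : exp (θ * I) = 2 * sinh p * κ ^ 2

/-- The curve `p + 2 arcsinh (κ t)`. -/
def thimbleCurve (p κ : ℂ) (t : ℝ) : ℂ := p + 2 * arcsinh (κ * t)

/-- The cut would require `(κ t)² ≤ -1`, so `κ` would be purely imaginary. Geometrically, the curve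
would then run into the other critical point, at `κ t = ±i`. -/
lemma one_add_sq_mem_slitPlane {κ : ℂ} (h : κ.re ≠ 0) (t : ℝ) :
    1 + (κ * t) ^ 2 ∈ slitPlane := by
  rw [mem_slitPlane_iff]
  by_contra hn
  push Not at hn
  obtain ⟨h1, h2⟩ := hn
  simp only [pow_two, add_re, one_re, mul_re, ofReal_re, ofReal_im, add_im, one_im, mul_im] at h1 h2
  have h3 : (κ.re * t) * (κ.im * t) = 0 := by linarith
  rcases mul_eq_zero.1 h3 with h4 | h4
  · rcases mul_eq_zero.1 h4 with h5 | h5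
    · exact h h5
    · subst h5
      simp at h1
      linarith
  · nlinarith [sq_nonneg (κ.re * t)]

section Curve

variable {θ : ℝ} {p κ : ℂ}

lemma thimbleCurve_zero : thimbleCurve p κ 0 = p := by
  simp [thimbleCurve, arcsinh_zero]

lemma thimbleCurve_neg (hκ : κ.re ≠ 0) (t : ℝ) :
    thimbleCurve p κ (-t) = p - 2 * arcsinh (κ * t) := by
  rw [thimbleCurve, ofReal_neg, mul_neg, arcsinh_neg (one_add_sq_mem_slitPlane hκ t)]
  ring

lemma hasDerivAt_thimbleCurve (hκ : κ.re ≠ 0) (t : ℝ) :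
    HasDerivAt (thimbleCurve p κ) (2 * κ * (coshRoot (κ * t))⁻¹) t := by
  have h1 : HasDerivAt (fun t : ℝ => κ * (t : ℂ)) κ t := by
    simpa using (ofRealCLM.hasDerivAt (x := t)).const_mul κ
  have h2 := (hasDerivAt_arcsinh (one_add_sq_mem_slitPlane hκ t)).comp_of_eq t h1 rfl
  refine ((h2.const_mul 2).const_add p).congr_deriv ?_
  ring

lemma deriv_thimbleCurve (hκ : κ.re ≠ 0) (t : ℝ) :
    deriv (thimbleCurve p κ) t = 2 * κ * (coshRoot (κ * t))⁻¹ :=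
  (hasDerivAt_thimbleCurve hκ t).deriv

lemma coshRoot_mul_ne_zero (hκ : κ.re ≠ 0) (t : ℝ) : coshRoot (κ * t) ≠ 0 :=
  ne_zero_of_re_pos (coshRoot_re_pos (one_add_sq_mem_slitPlane hκ t))

lemma continuous_coshRoot_mul (hκ : κ.re ≠ 0) : Continuous fun t : ℝ => coshRoot (κ * t) := by
  refine continuous_iff_continuousAt.2 fun t => ?_
  exact ContinuousAt.comp (f := fun t : ℝ => κ * (t : ℂ))
    (hasDerivAt_coshRoot (one_add_sq_mem_slitPlane hκ t)).continuousAt (by fun_prop)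

lemma continuous_thimbleCurve (hκ : κ.re ≠ 0) : Continuous (thimbleCurve p κ) :=
  continuous_iff_continuousAt.2 fun t => (hasDerivAt_thimbleCurve hκ t).continuousAt

lemma contDiff_thimbleCurve (hκ : κ.re ≠ 0) : ContDiff ℝ 1 (thimbleCurve p κ) := by
  rw [contDiff_one_iff_deriv]
  refine ⟨fun t => (hasDerivAt_thimbleCurve hκ t).differentiableAt, ?_⟩
  rw [funext (deriv_thimbleCurve (p := p) hκ)]
  exact continuous_const.mul ((continuous_coshRoot_mul hκ).inv₀ (coshRoot_mul_ne_zero hκ))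

lemma half_thimbleCurve_sub (t : ℝ) : (thimbleCurve p κ t - p) / 2 = arcsinh (κ * t) := by
  rw [thimbleCurve]
  ring

lemma IsThimbleDir.sinh_thimbleCurve (h : IsThimbleDir θ p κ) (t : ℝ) :
    sinh (thimbleCurve p κ t) = sinh p + t ^ 2 * exp (θ * I) := by
  rw [thimbleCurve, sinh_add_of_cosh_eq_zero h.cosh_eq, mul_div_cancel_left₀ _ two_ne_zero,
    sinh_arcsinh, h.exp_eq]
  ring

lemma IsThimbleDir.sinh_sq (h : IsThimbleDir θ p κ) : sinh p ^ 2 = -1 := by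
  have := Complex.cosh_sq p
  rw [h.cosh_eq] at this
  linear_combination -this

lemma IsThimbleDir.ne_zero (h : IsThimbleDir θ p κ) : κ ≠ 0 := by
  rintro rfl
  exact h.re_ne rfl

/-- A point `w` with `sinh ((w - p)/2) = κ t` lies on the curve if `cosh ((w - p)/2)` is in the right
half plane. -/
lemma toCyl_eq_thimbleCurve (hκ : κ.re ≠ 0) {w : ℂ} {t : ℝ} (hs : sinh ((w - p) / 2) = κ * t)
    (hc : 0 < (cosh ((w - p) / 2)).re) : toCyl w = toCyl (thimbleCurve p κ t) := by
  have hq := eq_coshRoot (one_add_sq_mem_slitPlane hκ t) hc (by rw [Complex.cosh_sq, hs]; ring)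
  have he : exp ((w - p) / 2) = exp (arcsinh (κ * t)) := by
    rw [exp_arcsinh, ← hq, ← hs, add_comm, Complex.cosh_add_sinh]
  obtain ⟨n, hn⟩ := exp_eq_exp_iff_exists_int.1 he
  refine toCyl_eq_iff.2 ⟨2 * n, ?_⟩
  rw [thimbleCurve]
  push_cast
  linear_combination 2 * hn

/-- Conversely, along the curve and its translates. -/
lemma sinh_half_of_toCyl_eq (hκ : κ.re ≠ 0) {w : ℂ} {t : ℝ}
    (h : toCyl w = toCyl (thimbleCurve p κ t)) :
    (cosh ((w - p) / 2)).re ≠ 0 ∧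
      (0 < (cosh ((w - p) / 2)).re → sinh ((w - p) / 2) = κ * t) := by
  obtain ⟨n, hn⟩ := toCyl_eq_iff.1 h
  have e : (w - p) / 2 = arcsinh (κ * t) + n * (Real.pi * I) := by
    rw [hn, thimbleCurve]
    ring
  have hq := coshRoot_re_pos (one_add_sq_mem_slitPlane hκ t)
  rw [e, cosh_add_int_mul_pi, sinh_add_int_mul_pi, cosh_arcsinh, sinh_arcsinh]
  rcases Int.even_or_odd n with hn | hn
  · rw [hn.neg_one_zpow]
    simp [hq.ne']
  · rw [hn.neg_one_zpow]
    simp only [neg_mul, one_mul, neg_re]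
    exact ⟨by linarith, fun h => by linarith⟩

/-- On the cylinder the half angle `(w - p)/2` is only defined modulo `πi`, and its `sinh` only up
to sign. The condition that `cosh` has positive real part selects the sign, and then `sinh` returns
`κ t`. -/
lemma injective_toCyl_thimbleCurve (hκ : κ.re ≠ 0) :
    Function.Injective fun t => toCyl (thimbleCurve p κ t) := by
  intro t t' h
  have h0 : κ ≠ 0 := by
    rintro rfl
    exact hκ rfl
  have h1 := (sinh_half_of_toCyl_eq hκ h).2
  rw [half_thimbleCurve_sub, cosh_arcsinh, sinh_arcsinh] at h1
  have h2 := h1 (coshRoot_re_pos (one_add_sq_mem_slitPlane hκ t))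
  exact_mod_cast mul_left_cancel₀ h0 h2

/-- The curve is the preimage of the ray of values of the action. -/
lemma IsThimbleDir.exists_eq_of_sinh_eq (h : IsThimbleDir θ p κ) {w : ℂ} {r : ℝ} (hr : 0 ≤ r)
    (hw : sinh w = sinh p + r * exp (θ * I)) :
    ∃ t, toCyl w = toCyl (thimbleCurve p κ t) := by
  have hκ := h.re_ne
  have hS : sinh p ≠ 0 := fun h0 => by simpa [h0] using h.sinh_sq
  have h1 := sinh_add_of_cosh_eq_zero h.cosh_eq (w - p)
  rw [add_sub_cancel, hw, h.exp_eq] at h1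
  have h2 : sinh ((w - p) / 2) ^ 2 = (κ * (Real.sqrt r : ℝ)) ^ 2 := by
    have h3 : ((Real.sqrt r : ℝ) : ℂ) ^ 2 = r := by
      exact_mod_cast Real.sq_sqrt hr
    rw [mul_pow, h3]
    have h4 : 2 * sinh p * (κ ^ 2 * r) = 2 * sinh p * sinh ((w - p) / 2) ^ 2 := by
      linear_combination h1
    exact (mul_left_cancel₀ (mul_ne_zero two_ne_zero hS) h4).symm
  obtain ⟨t, ht⟩ : ∃ t : ℝ, sinh ((w - p) / 2) = κ * t := by
    rcases sq_eq_sq_iff_eq_or_eq_neg.1 h2 with h5 | h5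
    · exact ⟨_, h5⟩
    · exact ⟨-Real.sqrt r, by rw [h5]; push_cast; ring⟩
  have hc : cosh ((w - p) / 2) ^ 2 = coshRoot (κ * t) ^ 2 := by
    rw [coshRoot_sq, Complex.cosh_sq, ht]
    ring
  have hq := coshRoot_re_pos (one_add_sq_mem_slitPlane hκ t)
  rcases sq_eq_sq_iff_eq_or_eq_neg.1 hc with h5 | h5
  · exact ⟨t, toCyl_eq_thimbleCurve hκ ht (by rwa [h5])⟩
  -- If `cosh` has the wrong sign, a translation by one period shifts the half angle by `πi`. This
  -- reverses the signs of both `sinh` and `cosh`, so that `t` becomes `-t`.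
  · refine ⟨-t, ?_⟩
    have e : (w + (1 : ℤ) * (2 * Real.pi * I) - p) / 2 = (w - p) / 2 + (1 : ℤ) * (Real.pi * I) := by
      ring
    rw [← toCyl_add_int_mul w 1]
    refine toCyl_eq_thimbleCurve hκ ?_ ?_
    · rw [e, sinh_add_int_mul_pi, ht]
      push_cast
      simp
    · rw [e, cosh_add_int_mul_pi, h5]
      simpa using hq

/-! ### The flow -/

/-- Along a flow line the action in phase `θ` has real derivative. -/
lemma hasDerivWithinAt_rotAction {W : ℝ → ℂ} {u : Set ℝ} {s : ℝ}
    (h : HasDerivWithinAt W (flowField θ (W s)) u s) :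
    HasDerivWithinAt (fun s => rotAction θ (W s))
      ((-normSq (exp (-(θ * I)) * cosh (W s)) : ℝ) : ℂ) u s := by
  have h1 := ((Complex.hasDerivAt_sinh (W s)).comp_hasDerivWithinAt s h).const_mul
    (exp (-(θ * I)))
  refine h1.congr_deriv ?_
  rw [flowField, ← mul_assoc, mul_neg, mul_conj]
  push_cast
  rfl

lemma rotAction_periodic (θ : ℝ) : Function.Periodic (rotAction θ) (2 * Real.pi * I) := fun w => by
  rw [rotAction, sinh_periodic w, rotAction]

lemma continuous_rotAction (θ : ℝ) : Continuous (rotAction θ) :=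
  continuous_const.mul Complex.continuous_sinh

lemma exp_mul_rotAction (θ : ℝ) (w : ℂ) : exp (θ * I) * rotAction θ w = sinh w := by
  rw [rotAction, ← mul_assoc, ← Complex.exp_add]
  simp

/-- Along a flow line `Im S_θ` is constant and `Re S_θ` decreases. In the limit both take their
values at `p`, so the starting point has its action on the ray from the critical value, whose
preimage is the curve. -/
lemma IsThimbleDir.exists_of_mem_thimble (h : IsThimbleDir θ p κ) {z : Cylinder}
    (hz : z ∈ thimble θ (toCyl p)) : ∃ t, z = toCyl (thimbleCurve p κ t) := by
  obtain ⟨W, rfl, hW, hlim⟩ := hz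
  have hS := tendsto_of_tendsto_toCyl (continuous_rotAction θ) (rotAction_periodic θ) hlim
  have hd := fun s (hs : 0 ≤ s) => hasDerivWithinAt_rotAction (hW s hs)
  have hre : ∀ s, 0 ≤ s → HasDerivWithinAt (fun s => (rotAction θ (W s)).re)
      (-normSq (exp (-(θ * I)) * cosh (W s))) (Set.Ici 0) s := fun s hs => by
    refine (reCLM.hasFDerivAt.comp_hasDerivWithinAt s (hd s hs)).congr_deriv ?_
    rw [reCLM_apply, ofReal_re]
  have him : ∀ s, 0 ≤ s → HasDerivWithinAt (fun s => (rotAction θ (W s)).im) 0 (Set.Ici 0) s :=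
      fun s hs => by
    refine (imCLM.hasFDerivAt.comp_hasDerivWithinAt s (hd s hs)).congr_deriv ?_
    rw [imCLM_apply, ofReal_im]
  have hanti : AntitoneOn (fun s => (rotAction θ (W s)).re) (Set.Ici 0) := by
    refine antitoneOn_of_hasDerivWithinAt_nonpos (convex_Ici 0)
      (fun s hs => (hre s hs).continuousWithinAt)
      (fun s hs => (hre s (interior_subset hs)).mono interior_subset) fun s _ => ?_
    exact neg_nonpos.2 (normSq_nonneg _)
  have hconst : ∀ s, 0 ≤ s → (rotAction θ (W s)).im = (rotAction θ (W 0)).im := by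
    intro s hs
    refine constant_of_has_deriv_right_zero (f := fun s => (rotAction θ (W s)).im) (b := s)
      (fun x hx => ((him x hx.1).continuousWithinAt).mono fun y hy => hy.1)
      (fun x hx => (him x hx.1).mono (Set.Ici_subset_Ici.2 hx.1)) s ⟨hs, le_rfl⟩
  have hRe : (rotAction θ p).re ≤ (rotAction θ (W 0)).re := by
    refine le_of_tendsto ((continuous_re.tendsto _).comp hS) ?_
    filter_upwards [eventually_ge_atTop 0] with s hs
    exact hanti Set.self_mem_Ici hs hs
  have hIm : (rotAction θ p).im = (rotAction θ (W 0)).im := by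
    refine tendsto_nhds_unique ((continuous_im.tendsto _).comp hS) ?_
    refine tendsto_const_nhds.congr' ?_
    filter_upwards [eventually_ge_atTop 0] with s hs
    exact (hconst s hs).symm
  refine h.exists_eq_of_sinh_eq (r := (rotAction θ (W 0)).re - (rotAction θ p).re)
    (sub_nonneg.2 hRe) ?_
  rw [← exp_mul_rotAction θ (W 0), ← exp_mul_rotAction θ p]
  have e : rotAction θ (W 0) = rotAction θ p +
      (((rotAction θ (W 0)).re - (rotAction θ p).re : ℝ) : ℂ) := by
    apply Complex.ext <;> simp [hIm]
  conv_lhs => rw [e]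
  ring

end Curve

end

end BesselStokes

/-! ### The flow on the thimble, uniqueness of its parametrization, and its directions. -/

namespace BesselStokes

noncomputable section

section Flow

variable {θ : ℝ} {p κ : ℂ}

/-- The flow along the curve is the scalar equation `τ' = -τ |1 + κ² τ²|`. -/
lemma IsThimbleDir.flowField_thimbleCurve (h : IsThimbleDir θ p κ) (τ : ℝ) :
    flowField θ (thimbleCurve p κ τ) =
      ((-τ * ‖1 + (κ * τ) ^ 2‖ : ℝ) : ℂ) * (2 * κ * (coshRoot (κ * τ))⁻¹) := by
  have hq := coshRoot_mul_ne_zero h.re_ne τ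
  have hexp : conj (exp (-(θ * I))) = exp (θ * I) := by
    rw [← Complex.exp_conj]
    congr 1
    simp
  have hn : ((‖1 + (κ * τ) ^ 2‖ : ℝ) : ℂ) = coshRoot (κ * τ) * conj (coshRoot (κ * τ)) := by
    rw [mul_conj, ← coshRoot_sq, norm_pow, normSq_eq_norm_sq]
  have hk : κ * conj κ = 1 / 2 := by
    rw [mul_conj, h.normSq_eq]
    push_cast
    rfl
  have hS : sinh p * conj (sinh p) = 1 := by
    have h1 := h.sinh_sq
    have h2 : normSq (sinh p) = 1 := by
      have := congrArg norm h1
      rw [norm_pow, norm_neg, norm_one] at this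
      rw [normSq_eq_norm_sq, this]
    rw [mul_conj, h2, ofReal_one]
  rw [flowField, thimbleCurve, cosh_add_of_cosh_eq_zero h.cosh_eq,
    mul_div_cancel_left₀ _ two_ne_zero, sinh_arcsinh, cosh_arcsinh, map_mul, hexp, h.exp_eq]
  push_cast
  rw [hn]
  simp only [map_mul, conj_ofReal, map_ofNat]
  field_simp
  linear_combination (-2 * κ * τ * conj (coshRoot (κ * τ)) * (κ * conj κ)) * hS
    - 2 * κ * τ * conj (coshRoot (κ * τ)) * hk

/-- The explicit solution of the scalar equation. -/
lemma IsThimbleDir.exists_flow (h : IsThimbleDir θ p κ) {t : ℝ} (ht : t ≠ 0) :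
    ∃ τ : ℝ → ℝ, τ 0 = t ∧ (∀ s, 0 ≤ s → HasDerivAt τ (-τ s * ‖1 + (κ * τ s) ^ 2‖) s) ∧
      Tendsto τ atTop (𝓝 0) := by
  -- With `v = τ^{-2}` the scalar equation becomes `v' = 2 |v + κ²| = √((2v + k)² + m²)`. It is
  -- solved by `2v + k = m sinh (2s + s₀)`, and `m > 0` because `κ²` is not real.
  set k : ℝ := 2 * (κ ^ 2).re with hk
  set m : ℝ := 2 * |(κ ^ 2).im| with hm
  have hm0 : 0 < m := by
    have : (κ ^ 2).im ≠ 0 := by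
      rw [pow_two, mul_im]
      have := mul_ne_zero h.re_ne h.im_ne
      intro h'
      apply this
      linarith
    have := abs_pos.2 this
    linarith
  have hv0 : 0 < 1 / t ^ 2 := by positivity
  set s₀ : ℝ := Real.arsinh ((2 * (1 / t ^ 2) + k) / m) with hs₀
  set v : ℝ → ℝ := fun s => (m * Real.sinh (2 * s + s₀) - k) / 2 with hv
  have hv_zero : v 0 = 1 / t ^ 2 := by
    simp only [hv, mul_zero, zero_add, hs₀, Real.sinh_arsinh]
    field_simp
    ring
  have hv_pos : ∀ s, 0 ≤ s → 0 < v s := by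
    intro s hs
    refine hv0.trans_le ?_
    rw [← hv_zero]
    simp only [hv]
    have : Real.sinh (2 * 0 + s₀) ≤ Real.sinh (2 * s + s₀) := Real.sinh_le_sinh.2 (by linarith)
    have := mul_le_mul_of_nonneg_left this hm0.le
    exact div_le_div_of_nonneg_right (sub_le_sub_right this k) two_pos.le
  have hv_deriv : ∀ s, HasDerivAt v (m * Real.cosh (2 * s + s₀)) s := by
    intro s
    have h1 : HasDerivAt (fun s : ℝ => 2 * s + s₀) 2 s := by
      simpa using ((hasDerivAt_id s).const_mul 2).add_const s₀
    have h2 := (((Real.hasDerivAt_sinh _).comp s h1).const_mul m).sub_const k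
    refine (h2.div_const 2).congr_deriv ?_
    ring
  have hv_norm : ∀ s, 0 < v s →
      m * Real.cosh (2 * s + s₀) = 2 * v s * ‖1 + κ ^ 2 / (v s : ℂ)‖ := by
    intro s hs
    have hc : 0 < Real.cosh (2 * s + s₀) := Real.cosh_pos _
    refine (sq_eq_sq₀ (by positivity) (by positivity)).1 ?_
    have e1 : (m * Real.cosh (2 * s + s₀)) ^ 2 = m ^ 2 + (2 * v s + k) ^ 2 := by
      rw [mul_pow, Real.cosh_sq]
      simp only [hv]
      ring
    have e2 : (v s : ℂ) * (1 + κ ^ 2 / (v s : ℂ)) = v s + κ ^ 2 := by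
      have : (v s : ℂ) ≠ 0 := by exact_mod_cast hs.ne'
      field_simp
    have e3 : v s * ‖1 + κ ^ 2 / (v s : ℂ)‖ = ‖(v s : ℂ) + κ ^ 2‖ := by
      rw [← e2, norm_mul, norm_real, Real.norm_eq_abs, abs_of_pos hs]
    rw [e1, mul_assoc, e3, mul_pow 2 ‖(v s : ℂ) + κ ^ 2‖, ← normSq_eq_norm_sq, normSq_apply]
    simp only [add_re, ofReal_re, add_im, ofReal_im, zero_add]
    have : m ^ 2 = 4 * (κ ^ 2).im ^ 2 := by
      rw [hm, mul_pow, sq_abs]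
      norm_num
    rw [this, hk]
    ring
  -- The sign of `t`, which is lost in `v = τ^{-2}` and preserved by the flow.
  set c : ℝ := t / |t| with hc
  have hc2 : c ^ 2 = 1 := by
    rw [hc, div_pow, sq_abs, div_self (pow_ne_zero 2 ht)]
  refine ⟨fun s => c * (Real.sqrt (v s))⁻¹, ?_, ?_, ?_⟩
  · simp only
    rw [hv_zero, Real.sqrt_div zero_le_one, Real.sqrt_one, Real.sqrt_sq_eq_abs, one_div, inv_inv,
      hc, div_mul_cancel₀ _ (abs_ne_zero.2 ht)]
  · intro s hs
    have hs' := hv_pos s hs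
    have hr : 0 < Real.sqrt (v s) := Real.sqrt_pos.2 hs'
    have hr2 : Real.sqrt (v s) ^ 2 = v s := Real.sq_sqrt hs'.le
    have h1 := ((hv_deriv s).sqrt hs'.ne').inv hr.ne'
    refine (h1.const_mul c).congr_deriv ?_
    have e : (κ * ((c * (Real.sqrt (v s))⁻¹ : ℝ) : ℂ)) ^ 2 = κ ^ 2 / (v s : ℂ) := by
      rw [mul_pow, ← ofReal_pow, mul_pow, hc2, inv_pow, hr2]
      push_cast
      ring
    rw [e, hv_norm s hs', hr2]
    field_simp
  · have hlim : Tendsto v atTop atTop := by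
      have h1 : Tendsto (fun s : ℝ => (m * (2 * s + s₀) - k) / 2) atTop atTop := by
        refine Tendsto.atTop_div_const two_pos (tendsto_atTop_add_const_right _ _ ?_)
        refine Tendsto.const_mul_atTop hm0 (tendsto_atTop_add_const_right _ _ ?_)
        exact Tendsto.const_mul_atTop two_pos tendsto_id
      refine tendsto_atTop_mono' _ ?_ h1
      filter_upwards [eventually_ge_atTop (-s₀ / 2)] with s hs
      have : 2 * s + s₀ ≤ Real.sinh (2 * s + s₀) := Real.self_le_sinh_iff.2 (by linarith)
      have := mul_le_mul_of_nonneg_left this hm0.le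
      simp only [hv]
      linarith
    have h1 : Tendsto (fun s => (Real.sqrt (v s))⁻¹) atTop (𝓝 0) :=
      tendsto_inv_atTop_zero.comp (Real.tendsto_sqrt_atTop.comp hlim)
    simpa using h1.const_mul c

lemma IsThimbleDir.mem_thimble (h : IsThimbleDir θ p κ) (t : ℝ) :
    toCyl (thimbleCurve p κ t) ∈ thimble θ (toCyl p) := by
  rcases eq_or_ne t 0 with rfl | ht
  · refine ⟨fun _ => p, by rw [thimbleCurve_zero], fun s _ => ?_, tendsto_const_nhds⟩
    have : flowField θ p = 0 := by simp [flowField, h.cosh_eq]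
    simp only [this]
    exact hasDerivWithinAt_const _ _ _
  · obtain ⟨τ, h0, hτ, hlim⟩ := h.exists_flow ht
    refine ⟨fun s => thimbleCurve p κ (τ s), by simp only [h0], fun s hs => ?_, ?_⟩
    · have h1 := (hasDerivAt_thimbleCurve (p := p) h.re_ne (τ s)).scomp s (hτ s hs)
      refine (h1.congr_deriv ?_).hasDerivWithinAt
      rw [h.flowField_thimbleCurve, real_smul]
    · have h1 := ((continuous_toCyl.comp (continuous_thimbleCurve (p := p) h.re_ne)).tendsto 0).comp
        hlim
      simpa [thimbleCurve_zero, Function.comp_def] using h1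

lemma IsThimbleDir.range_thimbleCurve (h : IsThimbleDir θ p κ) :
    Set.range (fun t => toCyl (thimbleCurve p κ t)) = thimble θ (toCyl p) := by
  ext z
  constructor
  · rintro ⟨t, rfl⟩
    exact h.mem_thimble t
  · intro hz
    obtain ⟨t, rfl⟩ := h.exists_of_mem_thimble hz
    exact ⟨t, rfl⟩

end Flow

/-- The curve parametrizes the thimble. -/
lemma IsThimbleDir.isThimbleParam {θ : ℝ} {j : Fin 2} {κ : ℂ} (h : IsThimbleDir θ (critPt j) κ)
    (ho : 0 < (conj (orientDir j) * κ).re) : IsThimbleParam θ j (thimbleCurve (critPt j) κ) where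
  contDiff := contDiff_thimbleCurve h.re_ne
  deriv_ne t := by
    rw [deriv_thimbleCurve h.re_ne]
    exact mul_ne_zero (mul_ne_zero two_ne_zero h.ne_zero)
      (inv_ne_zero (coshRoot_mul_ne_zero h.re_ne t))
  injective := injective_toCyl_thimbleCurve h.re_ne
  range_eq := h.range_thimbleCurve
  base := by rw [thimbleCurve_zero]
  orient := by
    have e : conj (orientDir j) * deriv (thimbleCurve (critPt j) κ) 0 =
        (2 : ℝ) * (conj (orientDir j) * κ) := by
      rw [deriv_thimbleCurve h.re_ne]
      simp [coshRoot]
      ring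
    rw [e, re_ofReal_mul]
    linarith

/-! ### Uniqueness of the parametrization -/

lemma pos_of_continuous_of_ne_zero {f : ℝ → ℝ} (hf : Continuous f) (hne : ∀ t, f t ≠ 0) {a : ℝ}
    (ha : 0 < f a) (t : ℝ) : 0 < f t := by
  by_contra hn
  obtain ⟨s, hs⟩ := mem_range_of_exists_le_of_exists_ge hf ⟨t, not_lt.1 hn⟩ ⟨a, ha.le⟩
  exact hne s hs

/-- `Γ` is the curve `Γ₀`, up to translations by the periods, after an increasing change of
parameter `τ` with derivative `τ'`. -/
structure IsReparam (Γ₀ Γ : ℝ → ℂ) (τ τ' : ℝ → ℝ) : Prop where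
  hasDerivAt : ∀ t, HasDerivAt τ (τ' t) t
  deriv_pos : ∀ t, 0 < τ' t
  surjective : Function.Surjective τ
  toCyl_eq : ∀ t, toCyl (Γ t) = toCyl (Γ₀ (τ t))
  deriv_eq : ∀ t, deriv Γ t = (τ' t : ℂ) * deriv Γ₀ (τ t)

lemma IsReparam.strictMono {Γ₀ Γ : ℝ → ℂ} {τ τ' : ℝ → ℝ} (h : IsReparam Γ₀ Γ τ τ') :
    StrictMono τ :=
  strictMono_of_hasDerivAt_pos h.hasDerivAt h.deriv_pos

lemma IsReparam.continuous {Γ₀ Γ : ℝ → ℂ} {τ τ' : ℝ → ℝ} (h : IsReparam Γ₀ Γ τ τ') :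
    Continuous τ :=
  continuous_iff_continuousAt.2 fun t => (h.hasDerivAt t).continuousAt

/-- The change of parameter is `τ = sinh ((Γ - p)/2) / κ` for a suitable lift; it is real because
`Γ` stays on the model curve. Its derivative cannot vanish since that of `Γ` does not, and the
orientation at the critical point fixes the sign. Surjectivity holds because both curves fill the
thimble. -/
lemma IsThimbleDir.exists_isReparam {θ : ℝ} {j : Fin 2} {κ : ℂ}
    (h : IsThimbleDir θ (critPt j) κ) (ho : 0 < (conj (orientDir j) * κ).re) {Γ : ℝ → ℂ}
    (hΓ : IsThimbleParam θ j Γ) : ∃ τ τ', IsReparam (thimbleCurve (critPt j) κ) Γ τ τ' := by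
  set p := critPt j with hp
  have hκ := h.re_ne
  have hmem : ∀ t, ∃ t', toCyl (Γ t) = toCyl (thimbleCurve p κ t') := fun t =>
    h.exists_of_mem_thimble (by rw [← hΓ.range_eq]; exact ⟨t, rfl⟩)
  have hΓc := hΓ.contDiff.continuous
  have hΓd : ∀ t, HasDerivAt Γ (deriv Γ t) t := fun t =>
    (hΓ.contDiff.differentiable one_ne_zero t).hasDerivAt
  -- after a translation by a period, the curve lies over the right half plane
  obtain ⟨n, hn⟩ : ∃ n : ℤ, ∀ t, 0 < (cosh ((Γ t + n * (2 * Real.pi * I) - p) / 2)).re := by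
    have hne : ∀ t, (cosh ((Γ t - p) / 2)).re ≠ 0 := fun t =>
      (sinh_half_of_toCyl_eq hκ (hmem t).choose_spec).1
    have hc : Continuous fun t => (cosh ((Γ t - p) / 2)).re :=
      continuous_re.comp (Complex.continuous_cosh.comp (by fun_prop))
    rcases (hne 0).lt_or_gt with h0 | h0
    · refine ⟨1, fun t => ?_⟩
      have h1 := pos_of_continuous_of_ne_zero hc.neg (fun t => neg_ne_zero.2 (hne t)) (a := 0)
        (by simpa using h0) t
      have e : (Γ t + (1 : ℤ) * (2 * Real.pi * I) - p) / 2 =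
          (Γ t - p) / 2 + (1 : ℤ) * (Real.pi * I) := by ring
      rw [e, cosh_add_int_mul_pi]
      simpa using h1
    · refine ⟨0, fun t => ?_⟩
      simpa using pos_of_continuous_of_ne_zero hc hne h0 t
  set Γ₁ : ℝ → ℂ := fun t => Γ t + n * (2 * Real.pi * I) with hΓ₁
  have hcyl : ∀ t, toCyl (Γ₁ t) = toCyl (Γ t) := fun t => toCyl_add_int_mul _ n
  set F : ℝ → ℂ := fun t => sinh ((Γ₁ t - p) / 2) / κ with hF
  set τ : ℝ → ℝ := fun t => (F t).re with hτ
  have hsinh : ∀ t, sinh ((Γ₁ t - p) / 2) = κ * (τ t : ℂ) := by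
    intro t
    obtain ⟨t', ht'⟩ := hmem t
    have h1 := (sinh_half_of_toCyl_eq hκ ((hcyl t).trans ht')).2 (hn t)
    have h2 : τ t = t' := by
      simp only [hτ, hF, h1]
      rw [mul_div_cancel_left₀ _ h.ne_zero, ofReal_re]
    rw [h1, h2]
  have hτcyl : ∀ t, toCyl (Γ t) = toCyl (thimbleCurve p κ (τ t)) := fun t =>
    (hcyl t).symm.trans (toCyl_eq_thimbleCurve hκ (hsinh t) (hn t))
  have hcosh : ∀ t, cosh ((Γ₁ t - p) / 2) = coshRoot (κ * τ t) := fun t =>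
    eq_coshRoot (one_add_sq_mem_slitPlane hκ _) (hn t) (by rw [Complex.cosh_sq, hsinh]; ring)
  have hFd : ∀ t, HasDerivAt F (coshRoot (κ * τ t) * (deriv Γ t / 2) / κ) t := by
    intro t
    have h1 : HasDerivAt (fun t => (Γ₁ t - p) / 2) (deriv Γ t / 2) t :=
      (((hΓd t).add_const _).sub_const p).div_const 2
    have h2 := ((Complex.hasDerivAt_sinh _).comp t h1).div_const κ
    rwa [hcosh] at h2
  set τ' : ℝ → ℝ := fun t => (coshRoot (κ * τ t) * (deriv Γ t / 2) / κ).re with hτ'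
  have hτd : ∀ t, HasDerivAt τ (τ' t) t := fun t =>
    reCLM.hasFDerivAt.comp_hasDerivAt t (hFd t)
  have hFτ : ∀ t, F t = τ t := fun t => by
    simp only [hF]
    rw [hsinh, mul_div_cancel_left₀ _ h.ne_zero]
  -- The function `F` takes real values, hence so does its derivative in the real variable `t`.
  have hτ'c : ∀ t, coshRoot (κ * τ t) * (deriv Γ t / 2) / κ = (τ' t : ℂ) := by
    intro t
    have h1 : HasDerivAt F (τ' t : ℂ) t := by
      rw [funext hFτ]
      exact (hτd t).ofReal_comp
    exact (hFd t).unique h1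
  have hderiv : ∀ t, deriv Γ t = (τ' t : ℂ) * deriv (thimbleCurve p κ) (τ t) := by
    intro t
    have hq := coshRoot_mul_ne_zero hκ (τ t)
    have hk := h.ne_zero
    rw [deriv_thimbleCurve hκ, ← hτ'c]
    field_simp
  have hτcont : Continuous τ := continuous_iff_continuousAt.2 fun t => (hτd t).continuousAt
  have hτ'cont : Continuous τ' := by
    have h1 : Continuous fun t => coshRoot (κ * τ t) := (continuous_coshRoot_mul hκ).comp hτcont
    have h2 : Continuous (deriv Γ) := (contDiff_one_iff_deriv.1 hΓ.contDiff).2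
    exact continuous_re.comp ((h1.mul (h2.div_const 2)).div_const κ)
  have hτ'ne : ∀ t, τ' t ≠ 0 := by
    intro t h0
    apply hΓ.deriv_ne t
    rw [hderiv, h0]
    simp
  have hτ0 : τ 0 = 0 := by
    apply injective_toCyl_thimbleCurve (p := p) hκ
    simp only
    rw [← hτcyl, hΓ.base, thimbleCurve_zero]
  have hpos0 : 0 < τ' 0 := by
    have h1 := hΓ.orient
    have e : conj (orientDir j) * deriv Γ 0 =
        ((2 * τ' 0 : ℝ) : ℂ) * (conj (orientDir j) * κ) := by
      rw [hderiv, hτ0, deriv_thimbleCurve hκ]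
      simp [coshRoot]
      ring
    rw [e, re_ofReal_mul] at h1
    have := pos_of_mul_pos_left h1 ho.le
    linarith
  refine ⟨τ, τ', hτd, pos_of_continuous_of_ne_zero hτ'cont hτ'ne hpos0, fun s => ?_, hτcyl, hderiv⟩
  have h1 : toCyl (thimbleCurve p κ s) ∈ Set.range fun t => toCyl (Γ t) := by
    rw [hΓ.range_eq]
    exact h.mem_thimble s
  obtain ⟨t, ht⟩ := h1
  refine ⟨t, injective_toCyl_thimbleCurve (p := p) hκ ?_⟩
  simp only
  rw [← hτcyl]
  exact ht

/-! ### The directions of the two thimbles -/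

/-- The directions `e^{iβ/2}/√2` and `i e^{iβ/2}/√2` of the thimbles in phase `π/2 + β`. -/
def thimbleDir (β : ℝ) : Fin 2 → ℂ :=
  ![exp ((β / 2 : ℝ) * I) / (Real.sqrt 2 : ℂ), I * (exp ((β / 2 : ℝ) * I) / (Real.sqrt 2 : ℂ))]

lemma thimbleDir_zero_re (β : ℝ) : (thimbleDir β 0).re = Real.cos (β / 2) / Real.sqrt 2 := by
  simp only [thimbleDir, Matrix.cons_val_zero]
  rw [div_ofReal_re, exp_ofReal_mul_I_re]

lemma thimbleDir_zero_im (β : ℝ) : (thimbleDir β 0).im = Real.sin (β / 2) / Real.sqrt 2 := by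
  simp only [thimbleDir, Matrix.cons_val_zero]
  rw [div_ofReal_im, exp_ofReal_mul_I_im]

lemma thimbleDir_one (β : ℝ) : thimbleDir β 1 = I * thimbleDir β 0 := rfl

lemma ofReal_sqrt_two_sq : ((Real.sqrt 2 : ℝ) : ℂ) ^ 2 = 2 := by
  exact_mod_cast Real.sq_sqrt (show (0 : ℝ) ≤ 2 by norm_num)

lemma thimbleDir_zero_sq (β : ℝ) : thimbleDir β 0 ^ 2 = exp (β * I) / 2 := by
  simp only [thimbleDir, Matrix.cons_val_zero]
  rw [div_pow, ofReal_sqrt_two_sq, ← Complex.exp_nat_mul]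
  congr 2
  push_cast
  ring

lemma sinh_critPt_zero : sinh (critPt 0) = I := by
  simp [critPt, Complex.sinh_mul_I]

lemma sinh_critPt_one : sinh (critPt 1) = -I := by
  simp [critPt, Complex.sinh_mul_I]

lemma cosh_critPt (j : Fin 2) : cosh (critPt j) = 0 := by
  fin_cases j <;> simp [critPt, Complex.cosh_mul_I]

lemma exp_pi_div_two_add (β : ℝ) :
    exp (((Real.pi / 2 + β : ℝ) : ℂ) * I) = I * exp (β * I) := by
  push_cast
  rw [add_mul, Complex.exp_add, Complex.exp_pi_div_two_mul_I]

/-- Off the Stokes phase, `β ≠ 0` gives `sin (β/2) ≠ 0`, so the direction is neither real nor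
imaginary. -/
lemma isThimbleDir {β : ℝ} (h0 : β ≠ 0) (hβ : |β| < Real.pi / 4) (j : Fin 2) :
    IsThimbleDir (Real.pi / 2 + β) (critPt j) (thimbleDir β j) ∧
      0 < (conj (orientDir j) * thimbleDir β j).re := by
  have h2 : 0 < Real.sqrt 2 := Real.sqrt_pos.2 two_pos
  have hb := abs_lt.1 hβ
  have hpi := Real.pi_pos
  have hcos : 0 < Real.cos (β / 2) := Real.cos_pos_of_mem_Ioo ⟨by linarith, by linarith⟩
  have hsin : Real.sin (β / 2) ≠ 0 := by
    intro h
    have := (Real.sin_eq_zero_iff_of_lt_of_lt (by linarith) (by linarith)).1 h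
    exact h0 (by linarith)
  have hn : normSq (thimbleDir β 0) = 1 / 2 := by
    rw [normSq_apply, thimbleDir_zero_re, thimbleDir_zero_im]
    have := Real.sin_sq_add_cos_sq (β / 2)
    have h3 : Real.sqrt 2 ^ 2 = 2 := Real.sq_sqrt (by norm_num)
    field_simp
    rw [h3]
    linarith
  have hre0 : 0 < (thimbleDir β 0).re := by
    rw [thimbleDir_zero_re]
    positivity
  have him0 : (thimbleDir β 0).im ≠ 0 := by
    rw [thimbleDir_zero_im]
    exact div_ne_zero hsin h2.ne'
  fin_cases j
  · refine ⟨⟨cosh_critPt 0, hre0.ne', him0, hn, ?_⟩, ?_⟩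
    · change _ = 2 * sinh (critPt 0) * thimbleDir β 0 ^ 2
      rw [exp_pi_div_two_add, thimbleDir_zero_sq, sinh_critPt_zero]
      ring
    · simpa [orientDir] using hre0
  · refine ⟨⟨cosh_critPt 1, ?_, ?_, ?_, ?_⟩, ?_⟩
    · change (thimbleDir β 1).re ≠ 0
      rw [thimbleDir_one]
      simpa using him0
    · change (thimbleDir β 1).im ≠ 0
      rw [thimbleDir_one]
      simpa using hre0.ne'
    · change normSq (thimbleDir β 1) = _
      rw [thimbleDir_one, normSq_mul, normSq_I, one_mul, hn]
    · change _ = 2 * sinh (critPt 1) * thimbleDir β 1 ^ 2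
      rw [exp_pi_div_two_add, thimbleDir_one, mul_pow, thimbleDir_zero_sq, sinh_critPt_one, I_sq]
      ring
    · change 0 < (conj I * thimbleDir β 1).re
      rw [thimbleDir_one]
      simpa using hre0

end

end BesselStokes

/-! ### Convergence and asymptotic expansion of the thimble integrals. -/

namespace BesselStokes

noncomputable section

open MeasureTheory

/-! ### Integrals along reparametrized curves -/

lemma thimbleIntegrand_eq_of_isReparam {Γ₀ Γ : ℝ → ℂ} {τ τ' : ℝ → ℝ} (h : IsReparam Γ₀ Γ τ τ')
    (ħ : ℂ) (t : ℝ) : thimbleIntegrand Γ ħ t = |τ' t| • thimbleIntegrand Γ₀ ħ (τ t) := by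
  rw [thimbleIntegrand, thimbleIntegrand, h.deriv_eq, abs_of_pos (h.deriv_pos t), real_smul,
    rotAction, sinh_eq_of_toCyl_eq (h.toCyl_eq t), rotAction]
  ring

lemma IsReparam.integrable_iff {Γ₀ Γ : ℝ → ℂ} {τ τ' : ℝ → ℝ} (h : IsReparam Γ₀ Γ τ τ') (ħ : ℂ) :
    Integrable (thimbleIntegrand Γ ħ) ↔ Integrable (thimbleIntegrand Γ₀ ħ) := by
  have h1 := integrableOn_image_iff_integrableOn_abs_deriv_smul MeasurableSet.univ
    (fun t _ => (h.hasDerivAt t).hasDerivWithinAt) h.strictMono.injective.injOn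
    (thimbleIntegrand Γ₀ ħ)
  rw [Set.image_univ, h.surjective.range_eq, integrableOn_univ, integrableOn_univ] at h1
  rw [h1, funext (thimbleIntegrand_eq_of_isReparam h ħ)]

lemma IsReparam.thimbleIntegral_eq {Γ₀ Γ : ℝ → ℂ} {τ τ' : ℝ → ℝ} (h : IsReparam Γ₀ Γ τ τ')
    (ħ : ℂ) : thimbleIntegral Γ ħ = thimbleIntegral Γ₀ ħ := by
  have h1 := integral_image_eq_integral_abs_deriv_smul MeasurableSet.univ
    (fun t _ => (h.hasDerivAt t).hasDerivWithinAt) h.strictMono.injective.injOn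
    (thimbleIntegrand Γ₀ ħ)
  rw [Set.image_univ, h.surjective.range_eq, setIntegral_univ, setIntegral_univ] at h1
  rw [thimbleIntegral, thimbleIntegral, h1, funext (thimbleIntegrand_eq_of_isReparam h ħ)]

/-! ### Gaussian moments -/

lemma norm_pow_mul_cexp (b : ℂ) (k : ℕ) (t : ℝ) :
    ‖(t : ℂ) ^ k * exp (-b * t ^ 2)‖ = |t| ^ k * Real.exp (-b.re * t ^ 2) := by
  rw [norm_mul, norm_pow, norm_real, Real.norm_eq_abs, norm_exp, ← ofReal_pow, ← neg_re,
    re_mul_ofReal]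

lemma integrable_pow_mul_cexp {b : ℂ} (hb : 0 < b.re) (k : ℕ) :
    Integrable fun t : ℝ => (t : ℂ) ^ k * exp (-b * t ^ 2) := by
  have h1 := (integrable_rpow_mul_exp_neg_mul_sq hb (s := k)
    (by have : (0 : ℝ) ≤ k := k.cast_nonneg
        linarith)).norm
  refine h1.mono (by fun_prop) (Eventually.of_forall fun t => ?_)
  rw [norm_pow_mul_cexp, norm_norm, norm_mul, Real.rpow_natCast, norm_pow, Real.norm_eq_abs,
    Real.norm_eq_abs, abs_of_pos (Real.exp_pos _)]

/-- Integration by parts: the derivative of `t^{2m+1} e^{-b t²}` has integral `0`, which expresses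
each even moment through the preceding one. -/
lemma gaussian_moment {b : ℂ} (hb : 0 < b.re) (m : ℕ) :
    ∫ t : ℝ, (t : ℂ) ^ (2 * m) * exp (-b * t ^ 2) =
      ((2 * m - 1)‼ : ℂ) / 2 ^ m / b ^ m * (Real.pi / b) ^ (1 / 2 : ℂ) := by
  have hb0 := ne_zero_of_re_pos hb
  induction m with
  | zero => simpa using integral_gaussian_complex hb
  | succ m ih =>
    have hd : ∀ t : ℝ, HasDerivAt (fun t : ℝ => (t : ℂ) ^ (2 * m + 1) * exp (-b * t ^ 2))
        ((2 * m + 1) * ((t : ℂ) ^ (2 * m) * exp (-b * t ^ 2)) -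
          2 * b * ((t : ℂ) ^ (2 * (m + 1)) * exp (-b * t ^ 2))) t := by
      intro t
      have h1 : HasDerivAt (fun z : ℂ => z ^ (2 * m + 1) * exp (-b * z ^ 2))
          ((2 * m + 1) * ((t : ℂ) ^ (2 * m) * exp (-b * t ^ 2)) -
            2 * b * ((t : ℂ) ^ (2 * (m + 1)) * exp (-b * t ^ 2))) (t : ℂ) := by
        have h2 := (hasDerivAt_pow (2 * m + 1) (t : ℂ)).mul
          (((hasDerivAt_pow 2 (t : ℂ)).const_mul (-b)).cexp)
        refine h2.congr_deriv ?_
        push_cast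
        ring
      exact h1.comp_ofReal
    have hi1 := (integrable_pow_mul_cexp hb (2 * m)).const_mul (2 * m + 1 : ℂ)
    have hi2 := (integrable_pow_mul_cexp hb (2 * (m + 1))).const_mul (2 * b)
    have h0 := integral_eq_zero_of_hasDerivAt_of_integrable hd (hi1.sub hi2)
      (integrable_pow_mul_cexp hb (2 * m + 1))
    rw [integral_sub hi1 hi2, integral_const_mul, integral_const_mul, ih] at h0
    have h3 : ∫ t : ℝ, (t : ℂ) ^ (2 * (m + 1)) * exp (-b * t ^ 2) =
        (2 * m + 1) * (((2 * m - 1)‼ : ℂ) / 2 ^ m / b ^ m * (Real.pi / b) ^ (1 / 2 : ℂ)) /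
          (2 * b) := by
      rw [eq_div_iff (mul_ne_zero two_ne_zero hb0)]
      linear_combination -h0
    rw [h3, doubleFactorial_two_mul_succ_sub_one]
    push_cast
    rw [pow_succ, pow_succ]
    field_simp

/-- The absolute moments. -/
lemma gaussian_abs_moment {b : ℂ} (hb : 0 < b.re) (m : ℕ) :
    ∫ t : ℝ, ‖(t : ℂ) ^ (2 * m) * exp (-b * t ^ 2)‖ =
      ((2 * m - 1)‼ : ℝ) / 2 ^ m / b.re ^ m * (Real.pi / b.re) ^ (1 / 2 : ℝ) := by
  have h1 := gaussian_moment (b := (b.re : ℂ)) (by simpa using hb) m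
  have h2 : ∀ t : ℝ, (t : ℂ) ^ (2 * m) * exp (-(b.re : ℂ) * t ^ 2) =
      ((‖(t : ℂ) ^ (2 * m) * exp (-b * t ^ 2)‖ : ℝ) : ℂ) := by
    intro t
    rw [norm_pow_mul_cexp, (even_two_mul m).pow_abs]
    push_cast
    rfl
  have h3 : ((Real.pi : ℂ) / (b.re : ℂ)) ^ (1 / 2 : ℂ) =
      (((Real.pi / b.re) ^ (1 / 2 : ℝ) : ℝ) : ℂ) := by
    rw [ofReal_cpow (by positivity)]
    push_cast
    rfl
  rw [integral_congr_ae (Eventually.of_forall h2), integral_complex_ofReal, h3] at h1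
  apply ofReal_injective
  rw [h1]
  simp only [ofReal_mul, ofReal_div, ofReal_pow, ofReal_natCast, ofReal_ofNat]

/-! ### The integrand along the thimbles -/

section Estimates

variable {κ : ℂ}

lemma inv_coshRoot (ζ : ℂ) : (coshRoot ζ)⁻¹ = (1 - -ζ ^ 2) ^ (-(1 / 2) : ℂ) := by
  rw [coshRoot, cpow_neg, sub_neg_eq_add]

/-- Since `|κ²| = 1/2`, the number `2 |Im κ²|` is the distance of `-1` from the line `ℝ κ²`, on
which `(κ t)²` moves. It is positive because `κ²` is not real. -/
lemma exists_inv_coshRoot_bound (hre : κ.re ≠ 0) (him : κ.im ≠ 0) (hn : normSq κ = 1 / 2) :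
    ∃ M, ∀ t : ℝ, ‖(coshRoot (κ * t))⁻¹‖ ≤ M := by
  set m : ℝ := 2 * |(κ ^ 2).im| with hm
  have hm0 : 0 < m := by
    have : (κ ^ 2).im ≠ 0 := by
      rw [pow_two, mul_im]
      intro h'
      exact mul_ne_zero hre him (by linarith)
    have := abs_pos.2 this
    linarith
  refine ⟨1 / Real.sqrt m, fun t => ?_⟩
  have h1 : m ≤ ‖coshRoot (κ * t)‖ ^ 2 := by
    rw [← norm_pow, coshRoot_sq]
    refine le_of_sq_le_sq ?_ (norm_nonneg _)
    rw [← normSq_eq_norm_sq, hm, mul_pow 2 |_|, sq_abs, normSq_apply]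
    have h2 : normSq (κ ^ 2) = 1 / 4 := by
      rw [map_pow, hn]
      norm_num
    rw [normSq_apply] at h2
    have e1 : (1 + (κ * t) ^ 2).re = 1 + (κ ^ 2).re * t ^ 2 := by
      rw [mul_pow, ← ofReal_pow, add_re, one_re, re_mul_ofReal]
    have e2 : (1 + (κ * t) ^ 2).im = (κ ^ 2).im * t ^ 2 := by
      rw [mul_pow, ← ofReal_pow, add_im, one_im, im_mul_ofReal, zero_add]
    rw [e1, e2]
    have h4 : ((κ ^ 2).re ^ 2 + (κ ^ 2).im ^ 2) * (t ^ 2) ^ 2 = 1 / 4 * (t ^ 2) ^ 2 := by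
      rw [← h2]
      ring
    -- With `κ² = a + ib`, `a² + b² = 1/4` and `x = t²`, one has `(1 + a x)² + b² x² = (x/2 + 2a)² +
    -- 4b²`.
    nlinarith [sq_nonneg (t ^ 2 / 2 + 2 * (κ ^ 2).re)]
  rw [norm_inv, one_div]
  refine inv_anti₀ (Real.sqrt_pos.2 hm0) (Real.sqrt_le_iff.2 ⟨norm_nonneg _, h1⟩)

/-- The Taylor polynomials approximate `(1 + κ² t²)^{-1/2}` uniformly on the real line. -/
lemma exists_taylor_bound (hre : κ.re ≠ 0) (him : κ.im ≠ 0) (hn : normSq κ = 1 / 2) (N : ℕ) :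
    ∃ C, ∀ t : ℝ, ‖(coshRoot (κ * t))⁻¹ -
      ∑ m ∈ Finset.range N, halfBinom m * (-κ ^ 2) ^ m * (t : ℂ) ^ (2 * m)‖ ≤ C * |t| ^ (2 * N) := by
  obtain ⟨M, hM⟩ := exists_inv_coshRoot_bound hre him hn
  have hM0 : 0 ≤ M := (norm_nonneg _).trans (hM 0)
  have hO := hasFPowerSeriesOnBall_inv_sqrt_one_sub.hasFPowerSeriesAt.isBigO_sub_partialSum_pow N
  obtain ⟨C, hC⟩ := hO.bound
  obtain ⟨r, hr, hrC⟩ := Metric.eventually_nhds_iff.1 hC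
  have hpoly : ∀ t : ℝ, ∑ m ∈ Finset.range N, halfBinom m * (-κ ^ 2) ^ m * (t : ℂ) ^ (2 * m) =
      (FormalMultilinearSeries.ofScalars ℂ halfBinom).partialSum N (-(κ * t) ^ 2) := by
    intro t
    rw [FormalMultilinearSeries.partialSum]
    refine Finset.sum_congr rfl fun m _ => ?_
    rw [FormalMultilinearSeries.ofScalars_apply_eq, smul_eq_mul, pow_mul, mul_assoc, ← mul_pow]
    congr 2
    ring
  have hnorm : ∀ t : ℝ, ‖-(κ * t) ^ 2‖ = |t| ^ 2 / 2 := by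
    intro t
    rw [norm_neg, norm_pow, norm_mul, mul_pow, ← normSq_eq_norm_sq, hn, norm_real,
      Real.norm_eq_abs]
    ring
  refine ⟨|C| / 2 ^ N + (M / r ^ N + ∑ m ∈ Finset.range N, ‖halfBinom m‖ / r ^ (N - m)) / 2 ^ N,
    fun t => ?_⟩
  set x : ℝ := |t| ^ 2 / 2 with hx
  have hx0 : 0 ≤ x := by positivity
  have hxN : |t| ^ (2 * N) = 2 ^ N * x ^ N := by
    rw [pow_mul, ← mul_pow, hx, mul_div_cancel₀ _ two_ne_zero]
  have hrhs : (|C| / 2 ^ N +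
      (M / r ^ N + ∑ m ∈ Finset.range N, ‖halfBinom m‖ / r ^ (N - m)) / 2 ^ N) * |t| ^ (2 * N) =
      |C| * x ^ N + (M / r ^ N + ∑ m ∈ Finset.range N, ‖halfBinom m‖ / r ^ (N - m)) * x ^ N := by
    rw [hxN]
    field_simp
  have hsum0 : 0 ≤ M / r ^ N + ∑ m ∈ Finset.range N, ‖halfBinom m‖ / r ^ (N - m) := by positivity
  rw [hrhs]
  by_cases hxr : x < r
  · have h1 := hrC (y := -(κ * t) ^ 2) (by rw [dist_zero_right, hnorm]; exact hxr)
    rw [zero_add, ← inv_coshRoot, ← hpoly, norm_pow, norm_norm, hnorm, ← hx] at h1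
    refine h1.trans ?_
    have h2 : C * x ^ N ≤ |C| * x ^ N := mul_le_mul_of_nonneg_right (le_abs_self C) (by positivity)
    have h3 := mul_nonneg hsum0 (pow_nonneg hx0 N)
    linarith
  -- Away from `0` no cancellation is needed: the function is bounded and every term of the
  -- polynomial has degree below `N`, so each is at most a constant times `x^N`.
  · have hxr' : r ≤ x := not_lt.1 hxr
    have h1 : ‖(coshRoot (κ * t))⁻¹‖ ≤ M / r ^ N * x ^ N := by
      refine (hM t).trans ?_
      rw [div_mul_eq_mul_div, le_div_iff₀ (by positivity)]
      exact mul_le_mul_of_nonneg_left (pow_le_pow_left₀ hr.le hxr' N) hM0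
    have h2 : ‖∑ m ∈ Finset.range N, halfBinom m * (-κ ^ 2) ^ m * (t : ℂ) ^ (2 * m)‖ ≤
        (∑ m ∈ Finset.range N, ‖halfBinom m‖ / r ^ (N - m)) * x ^ N := by
      rw [Finset.sum_mul]
      refine norm_sum_le_of_le _ fun m hm => ?_
      have hm' := (Finset.mem_range.1 hm).le
      have e : halfBinom m * (-κ ^ 2) ^ m * (t : ℂ) ^ (2 * m) = halfBinom m * (-(κ * t) ^ 2) ^ m := by
        rw [pow_mul, mul_assoc, ← mul_pow]
        congr 2
        ring
      rw [e, norm_mul, norm_pow, hnorm, ← hx, div_mul_eq_mul_div, le_div_iff₀ (by positivity),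
        mul_assoc]
      refine mul_le_mul_of_nonneg_left ?_ (norm_nonneg _)
      calc x ^ m * r ^ (N - m) ≤ x ^ m * x ^ (N - m) :=
            mul_le_mul_of_nonneg_left (pow_le_pow_left₀ hr.le hxr' _) (by positivity)
        _ = x ^ N := by rw [← pow_add, Nat.add_sub_cancel' hm']
    have h3 : 0 ≤ |C| * x ^ N := by positivity
    calc _ ≤ _ := norm_sub_le _ _
      _ ≤ _ := by rw [add_mul]; linarith

end Estimates

lemma exp_neg_pi_div_two_mul_I : exp (-(((Real.pi / 2 : ℝ) : ℂ) * I)) = -I := by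
  rw [← exp_neg_pi_div_two]
  push_cast
  ring_nf

lemma rotAction_thimbleCurve {β : ℝ} {p κ : ℂ} (h : IsThimbleDir (Real.pi / 2 + β) p κ) (t : ℝ) :
    rotAction (Real.pi / 2) (thimbleCurve p κ t) =
      rotAction (Real.pi / 2) p + t ^ 2 * exp (β * I) := by
  rw [rotAction, rotAction, h.sinh_thimbleCurve, exp_pi_div_two_add, exp_neg_pi_div_two_mul_I]
  linear_combination -t ^ 2 * exp (β * I) * I_mul_I

lemma thimbleIntegrand_thimbleCurve {β : ℝ} {p κ : ℂ} (h : IsThimbleDir (Real.pi / 2 + β) p κ)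
    (ħ : ℂ) (t : ℝ) : thimbleIntegrand (thimbleCurve p κ) ħ t =
      exp (-rotAction (Real.pi / 2) p / ħ) *
        (exp (-(exp (β * I) / ħ) * t ^ 2) * (2 * κ * (coshRoot (κ * t))⁻¹)) := by
  rw [thimbleIntegrand, deriv_thimbleCurve h.re_ne, rotAction_thimbleCurve h]
  have e : exp (-(rotAction (Real.pi / 2) p + t ^ 2 * exp (β * I)) / ħ) =
      exp (-rotAction (Real.pi / 2) p / ħ) * exp (-(exp (β * I) / ħ) * t ^ 2) := by
    rw [← Complex.exp_add]
    congr 1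
    ring
  rw [e, mul_assoc]

lemma exp_div_re (β : ℝ) {ħ : ℂ} (hħ : ħ ≠ 0) :
    (exp (β * I) / ħ).re = Real.cos (arg ħ - β) / ‖ħ‖ := by
  have h0 : ‖ħ‖ ≠ 0 := norm_ne_zero_iff.2 hħ
  have h1 : exp (β * I) / ħ = (((‖ħ‖)⁻¹ : ℝ) : ℂ) * exp ((β - arg ħ : ℝ) * I) := by
    conv_lhs => rw [← norm_mul_exp_arg_mul_I ħ]
    push_cast
    rw [sub_mul, Complex.exp_sub]
    field_simp
  rw [h1, re_ofReal_mul, exp_ofReal_mul_I_re, ← Real.cos_neg, neg_sub]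
  ring

lemma exp_div_re_pos {β : ℝ} {ħ : ℂ} (h : ħ ∈ sector β (Real.pi / 2)) :
    0 < (exp (β * I) / ħ).re := by
  rw [exp_div_re β h.1]
  have := abs_lt.1 h.2
  exact div_pos (Real.cos_pos_of_mem_Ioo ⟨by linarith, this.2⟩) (norm_pos_iff.2 h.1)

/-- The thimble integrals converge absolutely. -/
lemma integrable_thimbleIntegrand {β : ℝ} {p κ : ℂ} (h : IsThimbleDir (Real.pi / 2 + β) p κ)
    {ħ : ℂ} (hħ : ħ ∈ sector β (Real.pi / 2)) :
    Integrable (thimbleIntegrand (thimbleCurve p κ) ħ) := by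
  rw [funext (thimbleIntegrand_thimbleCurve h ħ)]
  refine Integrable.const_mul ?_ _
  obtain ⟨M, hM⟩ := exists_inv_coshRoot_bound h.re_ne h.im_ne h.normSq_eq
  refine (integrable_cexp_neg_mul_sq (exp_div_re_pos hħ)).mul_bdd (c := ‖2 * κ‖ * M) ?_ ?_
  · exact (continuous_const.mul ((continuous_coshRoot_mul h.re_ne).inv₀
      (coshRoot_mul_ne_zero h.re_ne))).aestronglyMeasurable
  · refine Eventually.of_forall fun t => ?_
    rw [norm_mul]
    exact mul_le_mul_of_nonneg_left (hM t) (norm_nonneg _)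

/-! ### The asymptotic expansion -/

/-- In the sector the argument of `ħ e^{-iβ}` stays within `(-π, π)`, so the root splits. The factor
`e^{-iβ/2}` cancels the phase of the thimble direction, and the expansion becomes independent of
`β`. -/
lemma sqrt_pi_div {β : ℝ} (hβ : |β| < Real.pi / 4) {ħ : ℂ} (hħ : ħ ∈ sector β (Real.pi / 2)) :
    (Real.pi / (exp (β * I) / ħ)) ^ (1 / 2 : ℂ) =
      (Real.sqrt Real.pi : ℂ) * (ħ ^ (1 / 2 : ℂ) * exp (-((β / 2 : ℝ) * I))) := by
  have hb := abs_lt.1 hβ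
  have ha := abs_lt.1 hħ.2
  have e : (Real.pi : ℂ) / (exp (β * I) / ħ) = Real.pi * (ħ * exp ((-β : ℝ) * I)) := by
    push_cast
    rw [neg_mul, Complex.exp_neg]
    field_simp
  have e2 : ((Real.pi : ℝ) : ℂ) ^ (1 / 2 : ℂ) = (Real.sqrt Real.pi : ℂ) := by
    rw [Real.sqrt_eq_rpow, ofReal_cpow Real.pi_pos.le]
    push_cast
    rfl
  rw [e, real_mul_cpow Real.pi_pos (mul_ne_zero hħ.1 (exp_ne_zero _)), e2,
    cpow_mul_exp_I hħ.1 (by linarith) (by linarith)]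
  congr 3
  push_cast
  ring

lemma neg_thimbleDir_sq (β : ℝ) (j : Fin 2) :
    -thimbleDir β j ^ 2 = (![-1, 1] : Fin 2 → ℂ) j * (exp (β * I) / 2) := by
  fin_cases j
  · change -thimbleDir β 0 ^ 2 = -1 * _
    rw [thimbleDir_zero_sq]
    ring
  · change -thimbleDir β 1 ^ 2 = 1 * _
    rw [thimbleDir_one, mul_pow, thimbleDir_zero_sq, I_sq]
    ring

lemma two_mul_thimbleDir (β : ℝ) (j : Fin 2) :
    2 * thimbleDir β j =
      (![1, I] : Fin 2 → ℂ) j * (Real.sqrt 2 : ℂ) * exp ((β / 2 : ℝ) * I) := by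
  have h0 : (Real.sqrt 2 : ℂ) ≠ 0 := by
    simp
  have h : 2 * thimbleDir β 0 = (Real.sqrt 2 : ℂ) * exp ((β / 2 : ℝ) * I) := by
    simp only [thimbleDir, Matrix.cons_val_zero]
    field_simp
    rw [ofReal_sqrt_two_sq]
  fin_cases j
  · change 2 * thimbleDir β 0 = 1 * _ * _
    rw [h, one_mul]
  · change 2 * thimbleDir β 1 = I * _ * _
    rw [thimbleDir_one, mul_left_comm, h, mul_assoc]

lemma coeff_saddleSeries (j : Fin 2) (m : ℕ) :
    PowerSeries.coeff m (saddleSeries j) =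
      (![1, I] : Fin 2 → ℂ) j * ((Real.sqrt 2 : ℂ) * (Real.sqrt Real.pi : ℂ)) *
        ((![-1, 1] : Fin 2 → ℂ) j ^ m * besselCoeff m) := by
  fin_cases j
  · simp [saddleSeries]
  · simp [saddleSeries]

/-- The contribution of the Taylor coefficients to the expansion. -/
lemma saddle_term {β : ℝ} (hβ : |β| < Real.pi / 4) {ħ : ℂ} (hħ : ħ ∈ sector β (Real.pi / 2))
    (j : Fin 2) (m : ℕ) :
    2 * thimbleDir β j * (halfBinom m * (-thimbleDir β j ^ 2) ^ m *
        (((2 * m - 1)‼ : ℂ) / 2 ^ m / (exp (β * I) / ħ) ^ m *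
          (Real.pi / (exp (β * I) / ħ)) ^ (1 / 2 : ℂ))) =
      ħ ^ (1 / 2 : ℂ) * (PowerSeries.coeff m (saddleSeries j) * ħ ^ m) := by
  have hħ0 := hħ.1
  have h2 : (m ! : ℂ) ≠ 0 := by exact_mod_cast m.factorial_ne_zero
  have hE := exp_ne_zero (β * I)
  have hE2 := exp_ne_zero ((β / 2 : ℝ) * I)
  rw [sqrt_pi_div hβ hħ, neg_thimbleDir_sq, two_mul_thimbleDir, coeff_saddleSeries, Complex.exp_neg,
    halfBinom, besselCoeff, mul_pow, div_pow, div_pow, show (8 : ℂ) = 2 * 2 * 2 by norm_num,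
    mul_pow (2 * 2 : ℂ), mul_pow (2 : ℂ)]
  field_simp

/-- Watson's lemma. The Taylor polynomial of `(1 + κ² t²)^{-1/2}` integrates to the first `N` terms.
The remainder is bounded by `C t^{2N}` on the whole line, and its absolute Gaussian moment is of
order `|ħ|^{N + 1/2}` because `Re (e^{iβ}/ħ) ≥ cos (π/4) / |ħ|` in the sector. -/
lemma hasSaddleExpansion_thimbleCurve {β δ : ℝ} (h0 : β ≠ 0) (hβ : |β| < Real.pi / 4)
    (hδ : δ < Real.pi / 4) (j : Fin 2) :
    HasSaddleExpansion (thimbleIntegral (thimbleCurve (critPt j) (thimbleDir β j)))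
      (sector β δ) (rotAction (Real.pi / 2) (critPt j)) (saddleSeries j) := by
  intro N
  have hD := (isThimbleDir h0 hβ j).1
  set κ := thimbleDir β j with hκ
  set p := critPt j with hp
  obtain ⟨C, hC⟩ := exists_taylor_bound hD.re_ne hD.im_ne hD.normSq_eq N
  have hpi := Real.pi_pos
  have hcos : 0 < Real.cos (Real.pi / 4) := by
    rw [Real.cos_pi_div_four]
    positivity
  set c := Real.cos (Real.pi / 4) with hc
  set D : ℝ := ((2 * N - 1)‼ : ℝ) / 2 ^ N with hDdef
  refine IsBigO.of_bound (‖2 * κ‖ * (|C| * (D / c ^ N * (Real.pi / c) ^ (1 / 2 : ℝ)))) ?_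
  filter_upwards [self_mem_nhdsWithin] with ħ hħ
  have hħ' : ħ ∈ sector β (Real.pi / 2) := ⟨hħ.1, hħ.2.trans (by linarith)⟩
  have hħ0 := hħ.1
  have hnħ : 0 < ‖ħ‖ := norm_pos_iff.2 hħ0
  set b := exp (β * I) / ħ with hb
  have hbpos : 0 < b.re := exp_div_re_pos hħ'
  have hbc : c / ‖ħ‖ ≤ b.re := by
    rw [hb, exp_div_re β hħ0]
    refine div_le_div_of_nonneg_right ?_ hnħ.le
    rw [hc, ← Real.cos_abs (arg ħ - β)]
    exact Real.cos_le_cos_of_nonneg_of_le_pi (abs_nonneg _) (by linarith) (hħ.2.le.trans hδ.le)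
  -- the error term
  set R : ℝ → ℂ := fun t => (coshRoot (κ * t))⁻¹ -
      ∑ m ∈ Finset.range N, halfBinom m * (-κ ^ 2) ^ m * (t : ℂ) ^ (2 * m) with hR
  have hRcont : Continuous R := by
    refine ((continuous_coshRoot_mul hD.re_ne).inv₀ (coshRoot_mul_ne_zero hD.re_ne)).sub ?_
    fun_prop
  have hRb : ∀ t : ℝ, ‖exp (-b * t ^ 2) * R t‖ ≤
      |C| * ‖(t : ℂ) ^ (2 * N) * exp (-b * t ^ 2)‖ := by
    intro t
    rw [norm_mul, norm_mul, norm_pow, norm_real, Real.norm_eq_abs]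
    have h1 : ‖R t‖ ≤ |C| * |t| ^ (2 * N) :=
      (hC t).trans (mul_le_mul_of_nonneg_right (le_abs_self C) (by positivity))
    calc _ ≤ ‖exp (-b * t ^ 2)‖ * (|C| * |t| ^ (2 * N)) :=
          mul_le_mul_of_nonneg_left h1 (norm_nonneg _)
      _ = _ := by ring
  have hRi : Integrable fun t : ℝ => exp (-b * t ^ 2) * R t := by
    refine (((integrable_pow_mul_cexp hbpos (2 * N)).norm).const_mul |C|).mono' ?_
      (Eventually.of_forall hRb)
    exact (Continuous.mul (by fun_prop) hRcont).aestronglyMeasurable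
  have hterm : ∀ m, Integrable fun t : ℝ =>
      halfBinom m * (-κ ^ 2) ^ m * ((t : ℂ) ^ (2 * m) * exp (-b * t ^ 2)) := fun m =>
    (integrable_pow_mul_cexp hbpos (2 * m)).const_mul _
  have hint : exp (rotAction (Real.pi / 2) p / ħ) * thimbleIntegral (thimbleCurve p κ) ħ =
      ħ ^ (1 / 2 : ℂ) * ∑ m ∈ Finset.range N, PowerSeries.coeff m (saddleSeries j) * ħ ^ m +
        2 * κ * ∫ t : ℝ, exp (-b * t ^ 2) * R t := by
    have e1 : ∀ t : ℝ, exp (-b * t ^ 2) * (2 * κ * (coshRoot (κ * t))⁻¹) =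
        2 * κ * (∑ m ∈ Finset.range N,
          halfBinom m * (-κ ^ 2) ^ m * ((t : ℂ) ^ (2 * m) * exp (-b * t ^ 2)) +
          exp (-b * t ^ 2) * R t) := by
      intro t
      have : ∑ m ∈ Finset.range N,
          halfBinom m * (-κ ^ 2) ^ m * ((t : ℂ) ^ (2 * m) * exp (-b * t ^ 2)) =
          (∑ m ∈ Finset.range N, halfBinom m * (-κ ^ 2) ^ m * (t : ℂ) ^ (2 * m)) *
            exp (-b * t ^ 2) := by
        rw [Finset.sum_mul]
        exact Finset.sum_congr rfl fun m _ => by ring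
      rw [this]
      simp only [hR]
      ring
    rw [thimbleIntegral, funext (thimbleIntegrand_thimbleCurve hD ħ), integral_const_mul,
      ← mul_assoc, ← Complex.exp_add, ← add_div, add_neg_cancel, zero_div, Complex.exp_zero, one_mul,
      ← hb, funext e1, integral_const_mul,
      integral_add (integrable_finsetSum _ fun m _ => hterm m) hRi,
      integral_finsetSum _ fun m _ => hterm m, mul_add, Finset.mul_sum, Finset.mul_sum]
    congr 1
    refine Finset.sum_congr rfl fun m _ => ?_
    rw [integral_const_mul, gaussian_moment hbpos]
    exact saddle_term hβ hħ' j m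
  rw [hint, add_sub_cancel_left, norm_mul]
  have hbound : ‖∫ t : ℝ, exp (-b * t ^ 2) * R t‖ ≤
      |C| * (D / b.re ^ N * (Real.pi / b.re) ^ (1 / 2 : ℝ)) := by
    refine (norm_integral_le_of_norm_le
      (((integrable_pow_mul_cexp hbpos (2 * N)).norm).const_mul |C|)
      (Eventually.of_forall hRb)).trans_eq ?_
    rw [integral_const_mul, gaussian_abs_moment hbpos]
  have hnorm : ‖ħ ^ (1 / 2 : ℂ) * ħ ^ N‖ = ‖ħ‖ ^ (1 / 2 : ℝ) * ‖ħ‖ ^ N := by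
    rw [norm_mul, norm_pow]
    congr 1
    have := norm_cpow_real ħ (1 / 2)
    push_cast at this
    exact this
  rw [hnorm, mul_assoc ‖2 * κ‖]
  refine mul_le_mul_of_nonneg_left ?_ (norm_nonneg _)
  refine hbound.trans ?_
  rw [mul_assoc]
  refine mul_le_mul_of_nonneg_left ?_ (abs_nonneg C)
  have hD0 : 0 ≤ D := by positivity
  have i1 : D / b.re ^ N ≤ D / c ^ N * ‖ħ‖ ^ N := by
    calc D / b.re ^ N ≤ D / (c / ‖ħ‖) ^ N := by gcongr
      _ = D / c ^ N * ‖ħ‖ ^ N := by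
        rw [div_pow]
        field_simp
  have i2 : (Real.pi / b.re) ^ (1 / 2 : ℝ) ≤ (Real.pi / c) ^ (1 / 2 : ℝ) * ‖ħ‖ ^ (1 / 2 : ℝ) := by
    rw [← Real.mul_rpow (by positivity) hnħ.le]
    refine Real.rpow_le_rpow (by positivity) ?_ (by norm_num)
    rw [div_mul_eq_mul_div, div_le_div_iff₀ hbpos hcos]
    rw [div_le_iff₀ hnħ] at hbc
    nlinarith
  calc _ ≤ D / c ^ N * ‖ħ‖ ^ N * ((Real.pi / c) ^ (1 / 2 : ℝ) * ‖ħ‖ ^ (1 / 2 : ℝ)) :=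
        mul_le_mul i1 i2 (by positivity) (by positivity)
    _ = _ := by ring

end

end BesselStokes

/-! ### The ends of the thimbles and the jump of the integrals. -/

namespace BesselStokes

noncomputable section

open MeasureTheory

/-! ### The ends of the thimbles -/

/-- `f` runs to the right, asymptotically to `2 log t + c` with `|Im c - π/2| < π/4`. -/
def IsRightEnd (f : ℝ → ℂ) : Prop :=
  ∃ c : ℂ, Tendsto (fun t : ℝ => f t - (2 * Real.log t : ℝ)) atTop (𝓝 c) ∧
    |c.im - Real.pi / 2| < Real.pi / 4

/-- `f` runs to the left: its image under the symmetry `w ↦ iπ - w` of the action runs to the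
right. -/
def IsLeftEnd (f : ℝ → ℂ) : Prop := IsRightEnd fun t => Real.pi * I - f t

/-- For `t > 0` a factor `t` comes out of `κ t + √(1 + (κ t)²)`, leaving `κ + √(t^{-2} + κ²)`. As
`Re κ > 0`, the principal root of `κ²` is `κ`, and the limit is `2κ`. -/
lemma tendsto_arcsinh_sub_log {κ : ℂ} (hκ : 0 < κ.re) :
    Tendsto (fun t : ℝ => arcsinh (κ * t) - (Real.log t : ℝ)) atTop (𝓝 (log (2 * κ))) := by
  have hsq : (κ ^ 2) ^ (1 / 2 : ℂ) = κ := by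
    have h := abs_lt.1 (abs_arg_lt_pi_div_two_iff.2 (Or.inl hκ))
    rw [one_div]
    exact pow_cpow_nat_inv two_ne_zero (by simpa [neg_div] using h.1) (by simpa using h.2.le)
  have hslit : κ ^ 2 ∈ slitPlane := by
    rw [mem_slitPlane_iff]
    by_contra hn
    push Not at hn
    obtain ⟨h1, h2⟩ := hn
    rw [pow_two, mul_re] at h1
    rw [pow_two, mul_im] at h2
    have h3 : κ.im = 0 := by
      have : κ.re * κ.im = 0 := by linarith
      exact (mul_eq_zero.1 this).resolve_left hκ.ne'
    rw [h3] at h1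
    nlinarith
  have hinv : Tendsto (fun t : ℝ => ((t : ℂ) ^ 2)⁻¹) atTop (𝓝 0) := by
    have h1 : Tendsto (fun t : ℝ => (t ^ 2)⁻¹) atTop (𝓝 0) :=
      tendsto_inv_atTop_zero.comp (tendsto_pow_atTop two_ne_zero)
    have h2 := (continuous_ofReal.tendsto 0).comp h1
    simpa [Function.comp_def] using h2
  have h1 : Tendsto (fun t : ℝ => (((t : ℂ) ^ 2)⁻¹ + κ ^ 2) ^ (1 / 2 : ℂ)) atTop (𝓝 κ) := by
    have hc : ContinuousAt (fun z : ℂ => z ^ (1 / 2 : ℂ)) (κ ^ 2) :=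
      continuousAt_cpow_const hslit
    have h2 : Tendsto (fun t : ℝ => ((t : ℂ) ^ 2)⁻¹ + κ ^ 2) atTop (𝓝 (κ ^ 2)) := by
      simpa using hinv.add_const (κ ^ 2)
    have h3 := hc.tendsto.comp h2
    rwa [hsq] at h3
  have h2κ : 2 * κ ∈ slitPlane := mem_slitPlane_iff.2 (Or.inl (by simpa using hκ))
  have h2 : Tendsto (fun t : ℝ => log (κ + (((t : ℂ) ^ 2)⁻¹ + κ ^ 2) ^ (1 / 2 : ℂ))) atTop
      (𝓝 (log (2 * κ))) := by
    have h3 := (tendsto_const_nhds (x := κ)).add h1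
    rw [← two_mul] at h3
    exact h3.clog h2κ
  refine h2.congr' ?_
  filter_upwards [eventually_gt_atTop 0] with t ht
  have ht0 : (t : ℂ) ≠ 0 := by exact_mod_cast ht.ne'
  have e : κ * t + coshRoot (κ * t) = t * (κ + (((t : ℂ) ^ 2)⁻¹ + κ ^ 2) ^ (1 / 2 : ℂ)) := by
    have e1 : (1 : ℂ) + (κ * t) ^ 2 = ((t ^ 2 : ℝ) : ℂ) * (((t : ℂ) ^ 2)⁻¹ + κ ^ 2) := by
      push_cast
      field_simp
    have hne : ((t : ℂ) ^ 2)⁻¹ + κ ^ 2 ≠ 0 := by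
      intro h0
      have := slitPlane_ne_zero (one_add_sq_mem_slitPlane hκ.ne' t)
      rw [e1, h0, mul_zero] at this
      exact this rfl
    have e2 : (((t ^ 2 : ℝ) : ℂ)) ^ (1 / 2 : ℂ) = t := by
      have := Real.sqrt_sq ht.le
      rw [Real.sqrt_eq_rpow] at this
      have h4 := ofReal_cpow (sq_nonneg t) (1 / 2)
      rw [this] at h4
      push_cast at h4 ⊢
      exact h4.symm
    rw [coshRoot, e1, real_mul_cpow (by positivity) hne, e2]
    ring
  have hne' := left_ne_zero_of_mul_eq_one (add_coshRoot_mul_sub (κ * t))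
  rw [e] at hne'
  rw [arcsinh, e, log_ofReal_mul ht (right_ne_zero_of_mul hne')]
  ring

/-- The end approaches the height `Im p + 2 arg κ`. -/
lemma isRightEnd_add_two_mul_arcsinh {p κ : ℂ} (hκ : 0 < κ.re)
    (him : |p.im + 2 * arg κ - Real.pi / 2| < Real.pi / 4) :
    IsRightEnd fun t => p + 2 * arcsinh (κ * t) := by
  refine ⟨p + 2 * log (2 * κ), ?_, ?_⟩
  · have h := ((tendsto_arcsinh_sub_log hκ).const_mul 2).const_add p
    refine h.congr fun t => ?_
    push_cast
    ring
  · have e1 : (2 * log (2 * κ)).im = 2 * arg κ := by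
      have h1 := im_ofReal_mul 2 (log (2 * κ))
      have h2 := arg_real_mul κ (r := 2) two_pos
      push_cast at h1 h2
      rw [h1, log_im, h2]
    rw [add_im, e1]
    exact him

lemma arg_exp_div_sqrt_two {x : ℝ} (h1 : -Real.pi < x) (h2 : x ≤ Real.pi) :
    arg (exp (x * I) / (Real.sqrt 2 : ℂ)) = x := by
  have e : exp (x * I) / (Real.sqrt 2 : ℂ) =
      ((Real.sqrt 2)⁻¹ : ℝ) * (Complex.cos x + Complex.sin x * I) := by
    rw [Complex.exp_mul_I]
    push_cast
    ring
  rw [e]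
  exact arg_mul_cos_add_sin_mul_I (by positivity) ⟨h1, h2⟩

/-- The thimble of `w_±` in phase `π/2 + β`. -/
abbrev stdThimble (β : ℝ) (j : Fin 2) : ℝ → ℂ := thimbleCurve (critPt j) (thimbleDir β j)

section Ends

variable {β : ℝ}

lemma critPt_zero_im : (critPt 0).im = Real.pi / 2 := by
  simp [critPt]

lemma critPt_one_im : (critPt 1).im = -(Real.pi / 2) := by
  simp [critPt]

lemma thimbleDir_one_eq_exp (β : ℝ) :
    thimbleDir β 1 = exp ((Real.pi / 2 + β / 2 : ℝ) * I) / (Real.sqrt 2 : ℂ) := by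
  rw [exp_pi_div_two_add, mul_div_assoc]
  rfl

lemma neg_thimbleDir_one_eq_exp (β : ℝ) :
    -thimbleDir β 1 = exp ((-(Real.pi / 2) + β / 2 : ℝ) * I) / (Real.sqrt 2 : ℂ) := by
  have : exp ((-(Real.pi / 2) + β / 2 : ℝ) * I) = -exp ((Real.pi / 2 + β / 2 : ℝ) * I) := by
    have e : ((-(Real.pi / 2) + β / 2 : ℝ) : ℂ) * I =
        ((Real.pi / 2 + β / 2 : ℝ) : ℂ) * I - Real.pi * I := by
      push_cast
      ring
    rw [e, Complex.exp_sub, Complex.exp_pi_mul_I, div_neg, div_one]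
  rw [this, thimbleDir_one_eq_exp]
  ring

lemma exp_div_sqrt_two_re (x : ℝ) :
    (exp (x * I) / (Real.sqrt 2 : ℂ)).re = Real.cos x / Real.sqrt 2 := by
  rw [div_ofReal_re, exp_ofReal_mul_I_re]

lemma isRightEnd_stdThimble_zero (hβ : |β| < Real.pi / 4) : IsRightEnd (stdThimble β 0) := by
  have hb := abs_lt.1 hβ
  have h2 : 0 < Real.sqrt 2 := Real.sqrt_pos.2 two_pos
  have hpi := Real.pi_pos
  refine isRightEnd_add_two_mul_arcsinh ?_ ?_
  · rw [thimbleDir_zero_re]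
    exact div_pos (Real.cos_pos_of_mem_Ioo ⟨by linarith, by linarith⟩) h2
  · have : arg (thimbleDir β 0) = β / 2 := by
      simp only [thimbleDir, Matrix.cons_val_zero]
      exact arg_exp_div_sqrt_two (by linarith) (by linarith)
    rw [critPt_zero_im, this]
    convert hβ using 2
    ring

/-- The symmetry `w ↦ iπ - w` fixes `w_+` and reverses the upper thimble. -/
lemma isLeftEnd_stdThimble_zero (h0 : β ≠ 0) (hβ : |β| < Real.pi / 4) :
    IsLeftEnd fun t => stdThimble β 0 (-t) := by
  have hD := (isThimbleDir h0 hβ 0).1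
  have e : (fun t => Real.pi * I - stdThimble β 0 (-t)) = stdThimble β 0 := by
    funext t
    rw [stdThimble, thimbleCurve_neg hD.re_ne, thimbleCurve]
    simp only [critPt, Matrix.cons_val_zero]
    ring
  rw [IsLeftEnd, e]
  exact isRightEnd_stdThimble_zero hβ

/-- For `β < 0` the direction `e^{i(π/2 + β/2)}` leans to the right, so the upward end turns right
and approaches the height `-π/2 + 2 (π/2 + β/2) = π/2 + β`. For `β > 0` the same end turns left;
this exchange of sides is the Stokes phenomenon. -/
lemma isRightEnd_stdThimble_one_of_neg (h0 : β < 0) (hβ : |β| < Real.pi / 4) :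
    IsRightEnd (stdThimble β 1) := by
  have hb := abs_lt.1 hβ
  have h2 : 0 < Real.sqrt 2 := Real.sqrt_pos.2 two_pos
  have hpi := Real.pi_pos
  refine isRightEnd_add_two_mul_arcsinh ?_ ?_
  · rw [thimbleDir_one_eq_exp, exp_div_sqrt_two_re]
    exact div_pos (Real.cos_pos_of_mem_Ioo ⟨by linarith, by linarith⟩) h2
  · rw [critPt_one_im, thimbleDir_one_eq_exp, arg_exp_div_sqrt_two (by linarith) (by linarith)]
    convert hβ using 2
    ring

/-- The symmetry `w ↦ iπ - w` sends `w_-` to `w_- + 2πi`, so the downward end has to be lifted by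
one period to arrive in the same strip. -/
lemma isLeftEnd_stdThimble_one_of_neg (h0 : β < 0) (hβ : |β| < Real.pi / 4) :
    IsLeftEnd fun t => stdThimble β 1 (-t) + 2 * Real.pi * I := by
  have hD := (isThimbleDir h0.ne hβ 1).1
  have e : (fun t => Real.pi * I - (stdThimble β 1 (-t) + 2 * Real.pi * I)) = stdThimble β 1 := by
    funext t
    rw [stdThimble, thimbleCurve_neg hD.re_ne, thimbleCurve]
    simp only [critPt, Matrix.cons_val_one, Matrix.cons_val_fin_one]
    ring
  rw [IsLeftEnd, e]
  exact isRightEnd_stdThimble_one_of_neg h0 hβ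

lemma isRightEnd_stdThimble_one_of_pos (h0 : 0 < β) (hβ : |β| < Real.pi / 4) :
    IsRightEnd fun t => stdThimble β 1 (-t) + 2 * Real.pi * I := by
  have hb := abs_lt.1 hβ
  have h2 : 0 < Real.sqrt 2 := Real.sqrt_pos.2 two_pos
  have hpi := Real.pi_pos
  have e : (fun t => stdThimble β 1 (-t) + 2 * Real.pi * I) =
      fun t : ℝ => (critPt 1 + 2 * Real.pi * I) + 2 * arcsinh (-thimbleDir β 1 * t) := by
    funext t
    rw [stdThimble, thimbleCurve, ofReal_neg, mul_neg, neg_mul]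
    ring
  rw [e]
  refine isRightEnd_add_two_mul_arcsinh ?_ ?_
  · rw [neg_thimbleDir_one_eq_exp, exp_div_sqrt_two_re]
    exact div_pos (Real.cos_pos_of_mem_Ioo ⟨by linarith, by linarith⟩) h2
  · rw [add_im, critPt_one_im, neg_thimbleDir_one_eq_exp,
      arg_exp_div_sqrt_two (by linarith) (by linarith)]
    convert hβ using 2
    simp
    ring

lemma isLeftEnd_stdThimble_one_of_pos (h0 : 0 < β) (hβ : |β| < Real.pi / 4) :
    IsLeftEnd (stdThimble β 1) := by
  have hD := (isThimbleDir h0.ne' hβ 1).1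
  have e : (fun t => Real.pi * I - stdThimble β 1 t) =
      fun t => stdThimble β 1 (-t) + 2 * Real.pi * I := by
    funext t
    rw [stdThimble, thimbleCurve_neg hD.re_ne, thimbleCurve]
    simp only [critPt, Matrix.cons_val_one, Matrix.cons_val_fin_one]
    ring
  rw [IsLeftEnd, e]
  exact isRightEnd_stdThimble_one_of_pos h0 hβ

end Ends

/-! ### Growth of the action at the ends -/

lemma rotAction_re (α : ℝ) (w : ℂ) : (rotAction α w).re =
    (Real.exp w.re * Real.cos (w.im - α) - Real.exp (-w.re) * Real.cos (w.im + α)) / 2 := by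
  have h : rotAction α w = ((1 / 2 : ℝ) : ℂ) * (exp (w - α * I) - exp (-w - α * I)) := by
    rw [rotAction, Complex.sinh, Complex.exp_sub, Complex.exp_sub, Complex.exp_neg (α * I)]
    push_cast
    ring
  rw [h, re_ofReal_mul, sub_re, exp_re, exp_re]
  simp only [sub_re, sub_im, neg_re, neg_im, mul_re, mul_im, ofReal_re, ofReal_im, I_re, I_im,
    mul_zero, mul_one, sub_zero, add_zero, sub_self]
  rw [show -w.im - α = -(w.im + α) by ring, Real.cos_neg]
  ring

/-- The leading term is `e^{Re w} cos (Im w - α) / 2`. In the strip `|Im w - α|` is less than `π/4 +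
|α - π/2| < π/2`, so the cosine is bounded below; the other exponential is bounded for `Re w ≥ 0`.
-/
lemma exists_le_rotAction_re {α : ℝ} (hα : |α - Real.pi / 2| < Real.pi / 4) (R : ℝ) :
    ∃ X : ℝ, ∀ w : ℂ, X ≤ w.re → |w.im - Real.pi / 2| < Real.pi / 4 →
      R ≤ (rotAction α w).re := by
  have hpi := Real.pi_pos
  set c := Real.cos (Real.pi / 4 + |α - Real.pi / 2|) with hc
  have hc0 : 0 < c := by
    have := abs_nonneg (α - Real.pi / 2)
    exact Real.cos_pos_of_mem_Ioo ⟨by linarith, by linarith⟩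
  refine ⟨max 0 (Real.log ((2 * |R| + 1) / c)), fun w hw him => ?_⟩
  have hw0 := (le_max_left _ _).trans hw
  have hwl := (le_max_right _ _).trans hw
  have h1 : (2 * |R| + 1) / c ≤ Real.exp w.re := by
    rwa [← Real.log_le_iff_le_exp (by positivity)]
  have h2 : c ≤ Real.cos (w.im - α) := by
    rw [hc, ← Real.cos_abs (w.im - α)]
    have h3 : |w.im - α| ≤ Real.pi / 4 + |α - Real.pi / 2| := by
      have := abs_sub_le w.im (Real.pi / 2) α
      rw [abs_sub_comm (Real.pi / 2) α] at this
      linarith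
    exact Real.cos_le_cos_of_nonneg_of_le_pi (abs_nonneg _) (by linarith) h3
  have h4 : Real.exp (-w.re) * Real.cos (w.im + α) ≤ 1 := by
    have h5 : Real.exp (-w.re) ≤ 1 := Real.exp_le_one_iff.2 (by linarith)
    calc Real.exp (-w.re) * Real.cos (w.im + α) ≤ Real.exp (-w.re) * 1 :=
          mul_le_mul_of_nonneg_left (Real.cos_le_one _) (Real.exp_pos _).le
      _ ≤ 1 := by linarith
  have h6 : 2 * |R| + 1 ≤ Real.exp w.re * Real.cos (w.im - α) := by
    rw [div_le_iff₀ hc0] at h1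
    exact h1.trans (mul_le_mul_of_nonneg_left h2 (Real.exp_pos _).le)
  rw [rotAction_re]
  linarith [le_abs_self R]

lemma convex_strip (X : ℝ) : Convex ℝ {w : ℂ | X ≤ w.re ∧ |w.im - Real.pi / 2| < Real.pi / 4} := by
  have e : {w : ℂ | X ≤ w.re ∧ |w.im - Real.pi / 2| < Real.pi / 4} =
      {w : ℂ | X ≤ w.re} ∩ ({w : ℂ | Real.pi / 2 - Real.pi / 4 < w.im} ∩
        {w : ℂ | w.im < Real.pi / 2 + Real.pi / 4}) := by
    ext w
    simp only [Set.mem_inter_iff, Set.mem_ofPred_eq, abs_lt]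
    constructor
    · rintro ⟨h1, h2, h3⟩
      exact ⟨h1, by linarith, by linarith⟩
    · rintro ⟨h1, h2, h3⟩
      exact ⟨h1, by linarith, by linarith⟩
  rw [e]
  exact (convex_halfSpace_re_ge X).inter
    ((convex_halfSpace_im_gt _).inter (convex_halfSpace_im_lt _))

lemma IsRightEnd.eventually_mem_strip {f : ℝ → ℂ} (hf : IsRightEnd f) (X : ℝ) :
    ∀ᶠ t in atTop, f t ∈ {w : ℂ | X ≤ w.re ∧ |w.im - Real.pi / 2| < Real.pi / 4} := by
  obtain ⟨c, hc, him⟩ := hf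
  have h1 : Tendsto (fun t => (f t).im) atTop (𝓝 c.im) := by
    refine ((continuous_im.tendsto c).comp hc).congr fun t => ?_
    simp only [Function.comp_apply, sub_im, ofReal_im, sub_zero]
  have h2 : Tendsto (fun t => (f t).re) atTop atTop := by
    have h3 : Tendsto (fun t => (f t).re - 2 * Real.log t) atTop (𝓝 c.re) := by
      refine ((continuous_re.tendsto c).comp hc).congr fun t => ?_
      simp only [Function.comp_apply, sub_re, ofReal_re]
    have h4 := h3.add_atTop (Real.tendsto_log_atTop.const_mul_atTop two_pos)
    simpa using h4
  filter_upwards [h2.eventually_ge_atTop X,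
    (h1.sub_const (Real.pi / 2)).abs.eventually_lt_const him] with t h3 h4
  exact ⟨h3, h4⟩

lemma rotAction_reflect (α : ℝ) (w : ℂ) : rotAction α (Real.pi * I - w) = rotAction α w := by
  rw [rotAction, rotAction, Complex.sinh_sub, Complex.sinh_mul_I, Complex.cosh_mul_I]
  simp

/-- The action in phase `α` is large on the segments between curves that run to the same end. -/
lemma IsRightEnd.le_rotAction_re {f g : ℝ → ℂ} (hf : IsRightEnd f) (hg : IsRightEnd g) {α : ℝ}
    (hα : |α - Real.pi / 2| < Real.pi / 4) (R : ℝ) :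
    ∀ᶠ t in atTop, ∀ w ∈ segment ℝ (f t) (g t), R ≤ (rotAction α w).re := by
  obtain ⟨X, hX⟩ := exists_le_rotAction_re hα R
  filter_upwards [hf.eventually_mem_strip X, hg.eventually_mem_strip X] with t h1 h2 w hw
  have := (convex_strip X).segment_subset h1 h2 hw
  exact hX w this.1 this.2

lemma IsLeftEnd.le_rotAction_re {f g : ℝ → ℂ} (hf : IsLeftEnd f) (hg : IsLeftEnd g) {α : ℝ}
    (hα : |α - Real.pi / 2| < Real.pi / 4) (R : ℝ) :
    ∀ᶠ t in atTop, ∀ w ∈ segment ℝ (f t) (g t), R ≤ (rotAction α w).re := by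
  filter_upwards [IsRightEnd.le_rotAction_re hf hg hα R] with t ht w hw
  rw [← rotAction_reflect]
  refine ht _ ?_
  obtain ⟨a, b, ha, hb, hab, rfl⟩ := hw
  refine ⟨a, b, ha, hb, hab, ?_⟩
  have hab' : (a : ℂ) + b = 1 := by exact_mod_cast hab
  simp only [real_smul]
  linear_combination (Real.pi * I) * hab'

lemma IsRightEnd.norm_sub_bounded {f g : ℝ → ℂ} (hf : IsRightEnd f) (hg : IsRightEnd g) :
    ∃ B : ℝ, ∀ᶠ t in atTop, ‖f t - g t‖ ≤ B := by
  obtain ⟨c, hc, -⟩ := hf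
  obtain ⟨d, hd, -⟩ := hg
  refine ⟨‖c - d‖ + 1, ?_⟩
  have h : Tendsto (fun t => f t - g t) atTop (𝓝 (c - d)) := by
    refine (hc.sub hd).congr fun t => ?_
    ring
  exact (h.norm.eventually_lt_const (lt_add_one _)).mono fun t ht => ht.le

lemma IsLeftEnd.norm_sub_bounded {f g : ℝ → ℂ} (hf : IsLeftEnd f) (hg : IsLeftEnd g) :
    ∃ B : ℝ, ∀ᶠ t in atTop, ‖f t - g t‖ ≤ B := by
  obtain ⟨B, hB⟩ := IsRightEnd.norm_sub_bounded hf hg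
  refine ⟨B, hB.mono fun t ht => ?_⟩
  have e : f t - g t = -((Real.pi * I - f t) - (Real.pi * I - g t)) := by ring
  rw [e, norm_neg]
  exact ht

/-! ### The jump of the integrals -/

/-- A primitive of `e^{-𝒜/ħ}` has the same limits along two curves that run to the same end. -/
lemma tendsto_primitive_sub {ħ : ℂ} {P : ℂ → ℂ}
    (hP : ∀ w, HasDerivAt P (exp (-rotAction (Real.pi / 2) w / ħ)) w) (hħ : ħ ≠ 0) {f g : ℝ → ℂ}
    (hseg : ∀ R, ∀ᶠ t in atTop, ∀ w ∈ segment ℝ (f t) (g t),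
      R ≤ (rotAction (Real.pi / 2 + arg ħ) w).re)
    (hB : ∃ B : ℝ, ∀ᶠ t in atTop, ‖f t - g t‖ ≤ B) :
    Tendsto (fun t => P (f t) - P (g t)) atTop (𝓝 0) := by
  obtain ⟨B, hB⟩ := hB
  have hn : 0 < ‖ħ‖ := norm_pos_iff.2 hħ
  -- The decay of `e^{-𝒜/ħ}` is governed by the real part of the action in the phase `π/2 + arg ħ`.
  have hnorm : ∀ w, ‖exp (-rotAction (Real.pi / 2) w / ħ)‖ =
      Real.exp (-((rotAction (Real.pi / 2 + arg ħ) w).re / ‖ħ‖)) := by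
    intro w
    have e : -rotAction (Real.pi / 2) w / ħ =
        ((-(‖ħ‖)⁻¹ : ℝ) : ℂ) * rotAction (Real.pi / 2 + arg ħ) w := by
      have hn' : ((‖ħ‖ : ℝ) : ℂ) ≠ 0 := by exact_mod_cast hn.ne'
      have hE := exp_ne_zero (arg ħ * I)
      conv_lhs => rw [← norm_mul_exp_arg_mul_I ħ]
      rw [rotAction, rotAction]
      push_cast
      rw [add_mul, neg_add, Complex.exp_add, Complex.exp_neg (arg ħ * I)]
      field_simp
    rw [norm_exp, e, re_ofReal_mul]
    congr 1
    ring
  rw [Metric.tendsto_nhds]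
  intro ε hε
  obtain ⟨R, hR⟩ : ∃ R : ℝ, Real.exp (-(R / ‖ħ‖)) * (|B| + 1) < ε := by
    have h1 : Tendsto (fun R : ℝ => Real.exp (-(R / ‖ħ‖)) * (|B| + 1)) atTop (𝓝 (0 * (|B| + 1))) :=
      (Real.tendsto_exp_neg_atTop_nhds_zero.comp
        (tendsto_id.atTop_div_const hn)).mul_const _
    rw [zero_mul] at h1
    exact (h1.eventually_lt_const hε).exists
  filter_upwards [hseg R, hB] with t h1 h2
  rw [dist_zero_right]
  -- Mean value inequality on a segment of bounded length along which the derivative of `P` is as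
  -- small as desired.
  have h3 := (convex_segment (f t) (g t)).norm_image_sub_le_of_norm_hasDerivWithin_le (𝕜 := ℂ)
    (f := P) (C := Real.exp (-(R / ‖ħ‖)))
    (fun w _ => (hP w).hasDerivWithinAt) (fun w hw => ?_) (right_mem_segment ℝ _ _)
    (left_mem_segment ℝ _ _)
  · refine (h3.trans ?_).trans_lt hR
    refine mul_le_mul_of_nonneg_left ?_ (Real.exp_pos _).le
    linarith [le_abs_self B]
  · rw [hnorm]
    exact Real.exp_le_exp.2 (neg_le_neg (div_le_div_of_nonneg_right (h1 w hw) hn.le))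

lemma sector_zero_subset {β δ : ℝ} (hβ : |β| ≤ δ) (hδ : δ < Real.pi / 4) {ħ : ℂ}
    (hħ : ħ ∈ sector 0 δ) : ħ ∈ sector β (Real.pi / 2) := by
  refine ⟨hħ.1, ?_⟩
  have h := hħ.2
  rw [sub_zero] at h
  have := abs_sub (arg ħ) β
  linarith

lemma tendsto_primitive_stdThimble {ħ : ℂ} {P : ℂ → ℂ}
    (hP : ∀ w, HasDerivAt P (exp (-rotAction (Real.pi / 2) w / ħ)) w) {β : ℝ} (h0 : β ≠ 0)
    (hβ : |β| < Real.pi / 4) (hħ : ħ ∈ sector β (Real.pi / 2)) (j : Fin 2) :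
    Tendsto (fun t => P (stdThimble β j t) - P (stdThimble β j (-t))) atTop
      (𝓝 (thimbleIntegral (stdThimble β j) ħ)) := by
  have hD := (isThimbleDir h0 hβ j).1
  have hi := integrable_thimbleIntegrand hD hħ
  have h1 := intervalIntegral_tendsto_integral hi tendsto_neg_atTop_atBot tendsto_id
  refine h1.congr fun t => ?_
  refine intervalIntegral.integral_eq_sub_of_hasDerivAt (f := fun t => P (stdThimble β j t))
    (fun s _ => ?_) hi.intervalIntegrable
  have h2 := (hP (stdThimble β j s)).comp s (hasDerivAt_thimbleCurve (p := critPt j) hD.re_ne s)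
  refine h2.congr_deriv ?_
  rw [thimbleIntegrand, deriv_thimbleCurve hD.re_ne]

/-- The integrand is entire and `2πi`-periodic, so its primitive exists on `ℂ` and changes by a
constant under a period. -/
lemma exists_primitive (ħ : ℂ) : ∃ (P : ℂ → ℂ) (c : ℂ),
    (∀ w, HasDerivAt P (exp (-rotAction (Real.pi / 2) w / ħ)) w) ∧
      ∀ w, P (w + 2 * Real.pi * I) = P w + c := by
  have hdiff : Differentiable ℂ fun w => exp (-rotAction (Real.pi / 2) w / ħ) := by
    unfold rotAction
    exact (((Complex.differentiable_sinh.const_mul _).neg).div_const _).cexp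
  obtain ⟨P, hP⟩ := hdiff.isExactOn_univ
  have hP' : ∀ w, HasDerivAt P (exp (-rotAction (Real.pi / 2) w / ħ)) w := fun w =>
    hP w (Set.mem_univ w)
  refine ⟨P, P (0 + 2 * Real.pi * I) - P 0, hP', fun w => ?_⟩
  have hd : ∀ w, HasDerivAt (fun w => P (w + 2 * Real.pi * I) - P w) 0 w := by
    intro w
    have h1 := (hP' (w + 2 * Real.pi * I)).comp_add_const w (2 * Real.pi * I)
    rw [rotAction_periodic] at h1
    exact (h1.sub (hP' w)).congr_deriv (sub_self _)
  have h2 := is_const_of_deriv_eq_zero (fun w => (hd w).differentiableAt) (fun w => (hd w).deriv)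
    w 0
  linear_combination h2

/-- Each integral is a difference of values of `P` at the ends, and only ends in the same strip are
compared. The increment `c` enters both lower thimbles with the same sign and cancels. -/
lemma thimbleIntegral_jump {δ : ℝ} (h0 : 0 < δ) (hδ : δ < Real.pi / 4) {ħ : ℂ}
    (hħ : ħ ∈ sector 0 δ) :
    thimbleIntegral (stdThimble (-δ) 0) ħ = thimbleIntegral (stdThimble δ 0) ħ ∧
      thimbleIntegral (stdThimble (-δ) 1) ħ =
        2 * thimbleIntegral (stdThimble δ 0) ħ + thimbleIntegral (stdThimble δ 1) ħ := by
  obtain ⟨P, c, hP, hc⟩ := exists_primitive ħ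
  have hb : |δ| < Real.pi / 4 := by rwa [abs_of_pos h0]
  have hb' : |-δ| < Real.pi / 4 := by rwa [abs_neg]
  have hn : -δ < 0 := neg_lt_zero.2 h0
  have hα : |Real.pi / 2 + arg ħ - Real.pi / 2| < Real.pi / 4 := by
    have := hħ.2
    rw [sub_zero] at this
    rw [add_sub_cancel_left]
    linarith
  have hR : ∀ {f g : ℝ → ℂ}, IsRightEnd f → IsRightEnd g →
      Tendsto (fun t => P (f t) - P (g t)) atTop (𝓝 0) := fun hf hg =>
    tendsto_primitive_sub hP hħ.1 (hf.le_rotAction_re hg hα) (hf.norm_sub_bounded hg)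
  have hL : ∀ {f g : ℝ → ℂ}, IsLeftEnd f → IsLeftEnd g →
      Tendsto (fun t => P (f t) - P (g t)) atTop (𝓝 0) := fun hf hg =>
    tendsto_primitive_sub hP hħ.1 (hf.le_rotAction_re hg hα) (hf.norm_sub_bounded hg)
  have hl := fun j => tendsto_primitive_stdThimble hP hn.ne hb'
    (sector_zero_subset (by rw [abs_neg, abs_of_pos h0]) hδ hħ) j
  have hr := fun j => tendsto_primitive_stdThimble hP h0.ne' hb
    (sector_zero_subset (by rw [abs_of_pos h0]) hδ hħ) j
  constructor
  · have h1 := (hR (isRightEnd_stdThimble_zero hb') (isRightEnd_stdThimble_zero hb)).sub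
      (hL (isLeftEnd_stdThimble_zero hn.ne hb') (isLeftEnd_stdThimble_zero h0.ne' hb))
    have h2 := ((hl 0).sub (hr 0)).congr (f₂ := fun t =>
      (P (stdThimble (-δ) 0 t) - P (stdThimble δ 0 t)) -
        (P (stdThimble (-δ) 0 (-t)) - P (stdThimble δ 0 (-t)))) fun t => by ring
    have h3 := tendsto_nhds_unique h2 h1
    linear_combination h3
  · have h1 := ((hR (isRightEnd_stdThimble_one_of_neg hn hb') (isRightEnd_stdThimble_zero hb)).sub
      (hL (isLeftEnd_stdThimble_one_of_neg hn hb') (isLeftEnd_stdThimble_zero h0.ne' hb))).add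
      ((hR (isRightEnd_stdThimble_one_of_pos h0 hb) (isRightEnd_stdThimble_zero hb)).sub
        (hL (isLeftEnd_stdThimble_one_of_pos h0 hb) (isLeftEnd_stdThimble_zero h0.ne' hb)))
    have h2 := ((hl 1).sub (((hr 0).const_mul 2).add (hr 1))).congr' (f₂ := fun t =>
      ((P (stdThimble (-δ) 1 t) - P (stdThimble δ 0 t)) -
        (P (stdThimble (-δ) 1 (-t) + 2 * Real.pi * I) - P (stdThimble δ 0 (-t)))) +
      ((P (stdThimble δ 1 (-t) + 2 * Real.pi * I) - P (stdThimble δ 0 t)) -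
        (P (stdThimble δ 1 t) - P (stdThimble δ 0 (-t)))))
      (Eventually.of_forall fun t => by simp only [hc]; ring)
    have h3 := tendsto_nhds_unique h2 h1
    linear_combination h3

end

end BesselStokes

/-! ### Classes of paths in the chain group of the cylinder. -/

namespace BesselStokes

noncomputable section

/-! ### Singular chains of the cylinder -/

lemma faceMap_succAbove (n : ℕ) (i : Fin (n + 2)) (y : stdSimplex ℝ (Fin (n + 1)))
    (k : Fin (n + 1)) : faceMap n i y (i.succAbove k) = y k := by
  classical
  change stdSimplex.map i.succAbove y (i.succAbove k) = y k
  rw [stdSimplex.map_coe, FunOnFinite.linearMap_apply_apply]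
  rw [Finset.sum_eq_single k]
  · intro b hb hbk
    exact absurd (Fin.succAbove_right_injective (Finset.mem_filter.1 hb).2) hbk
  · intro h
    simp at h

lemma faceMap_self (n : ℕ) (i : Fin (n + 2)) (y : stdSimplex ℝ (Fin (n + 1))) :
    faceMap n i y i = 0 := by
  classical
  change stdSimplex.map i.succAbove y i = 0
  rw [stdSimplex.map_coe, FunOnFinite.linearMap_apply_apply]
  refine Finset.sum_eq_zero fun b hb => ?_
  exact absurd (Finset.mem_filter.1 hb).2 (Fin.succAbove_ne i b)

lemma boundary_single_two (σ : C(stdSimplex ℝ (Fin 3), Cylinder)) :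
    boundary Cylinder 1 (Finsupp.single σ 1) =
      Finsupp.single (σ.comp (faceMap 1 0)) 1 - Finsupp.single (σ.comp (faceMap 1 1)) 1 +
        Finsupp.single (σ.comp (faceMap 1 2)) 1 := by
  rw [boundary, Finsupp.linearCombination_single, one_smul, Fin.sum_univ_three]
  simp [sub_eq_add_neg]

lemma boundary_single_one (σ : C(stdSimplex ℝ (Fin 2), Cylinder)) :
    boundary Cylinder 0 (Finsupp.single σ 1) =
      Finsupp.single (σ.comp (faceMap 0 0)) 1 - Finsupp.single (σ.comp (faceMap 0 1)) 1 := by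
  rw [boundary, Finsupp.linearCombination_single, one_smul, Fin.sum_univ_two]
  simp [sub_eq_add_neg]

lemma stdSimplex_continuous_apply {n : ℕ} (i : Fin n) :
    Continuous fun x : stdSimplex ℝ (Fin n) => x i :=
  (continuous_apply i).comp continuous_subtype_val

/-- The projection to the cylinder of the path `γ` in `ℂ`, restricted to `[0, 1]`. -/
def pathSimplex (γ : C(ℝ, ℂ)) : C(stdSimplex ℝ (Fin 2), Cylinder) :=
  ⟨fun x => toCyl (γ (x 1)),
    continuous_toCyl.comp (γ.continuous.comp (stdSimplex_continuous_apply 1))⟩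

lemma stdSimplex_two_add (x : stdSimplex ℝ (Fin 2)) : x 0 + x 1 = 1 := by
  have := stdSimplex.sum_eq_one x
  rwa [Fin.sum_univ_two] at this

lemma stdSimplex_two_mem_Icc (x : stdSimplex ℝ (Fin 2)) : x 1 ∈ Set.Icc (0 : ℝ) 1 :=
  mem_Icc_of_mem_stdSimplex x.2 1

section Classes

variable (A : Set Cylinder)

/-- The chain group modulo boundaries and chains in `A`. -/
abbrev ChainQuot : Type := SingularChain Cylinder 1 ⧸ relBoundaries A 0

/-- The class of the projection of a path in `ℂ` to the cylinder. -/
def pathClass (γ : C(ℝ, ℂ)) : ChainQuot A :=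
  Submodule.Quotient.mk (Finsupp.single (pathSimplex γ) 1)

variable {A}

lemma mk_boundary (c : SingularChain Cylinder 2) :
    (Submodule.Quotient.mk (boundary Cylinder 1 c) : ChainQuot A) = 0 :=
  (Submodule.Quotient.mk_eq_zero _).2 (Submodule.mem_sup_left ⟨c, rfl⟩)

lemma mk_single_eq (σ : C(stdSimplex ℝ (Fin 3), Cylinder)) {γ₀ γ₁ γ₂ : C(ℝ, ℂ)}
    (h0 : σ.comp (faceMap 1 0) = pathSimplex γ₀) (h1 : σ.comp (faceMap 1 1) = pathSimplex γ₁)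
    (h2 : σ.comp (faceMap 1 2) = pathSimplex γ₂) :
    pathClass A γ₀ - pathClass A γ₁ + pathClass A γ₂ = 0 := by
  have h := mk_boundary (A := A) (Finsupp.single σ 1)
  rw [boundary_single_two, h0, h1, h2] at h
  exact h

lemma faceMap_one_zero (y : stdSimplex ℝ (Fin 2)) :
    faceMap 1 0 y 0 = 0 ∧ faceMap 1 0 y 1 = y 0 ∧ faceMap 1 0 y 2 = y 1 :=
  ⟨faceMap_self 1 0 y, faceMap_succAbove 1 0 y 0, faceMap_succAbove 1 0 y 1⟩

lemma faceMap_one_one (y : stdSimplex ℝ (Fin 2)) :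
    faceMap 1 1 y 0 = y 0 ∧ faceMap 1 1 y 1 = 0 ∧ faceMap 1 1 y 2 = y 1 :=
  ⟨faceMap_succAbove 1 1 y 0, faceMap_self 1 1 y, faceMap_succAbove 1 1 y 1⟩

lemma faceMap_one_two (y : stdSimplex ℝ (Fin 2)) :
    faceMap 1 2 y 0 = y 0 ∧ faceMap 1 2 y 1 = y 1 ∧ faceMap 1 2 y 2 = 0 :=
  ⟨faceMap_succAbove 1 2 y 0, faceMap_succAbove 1 2 y 1, faceMap_self 1 2 y⟩

/-- The boundary of the constant 2-simplex has three equal faces with signs `+ - +`, hence is the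
constant 1-simplex. -/
lemma pathClass_const (p : ℂ) : pathClass A (ContinuousMap.const ℝ p) = 0 := by
  have h := mk_single_eq (A := A) (ContinuousMap.const _ (toCyl p))
    (γ₀ := ContinuousMap.const ℝ p) (γ₁ := ContinuousMap.const ℝ p)
    (γ₂ := ContinuousMap.const ℝ p) rfl rfl rfl
  simpa using h

/-- The boundary of a square. -/
lemma pathClass_square (H : C(ℝ × ℝ, ℂ)) :
    pathClass A (H.comp ⟨fun s => (1, s), by fun_prop⟩) +
        pathClass A (H.comp ⟨fun s => (s, 0), by fun_prop⟩) =
      pathClass A (H.comp ⟨fun s => (s, 1), by fun_prop⟩) +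
        pathClass A (H.comp ⟨fun s => (0, s), by fun_prop⟩) := by
  have hc := fun i => stdSimplex_continuous_apply (n := 3) i
  -- The square is cut along its diagonal into two simplices; the common face drops out on comparing
  -- their boundaries.
  have h1 := mk_single_eq (A := A)
    ⟨fun x => toCyl (H (x 1 + x 2, x 2)), continuous_toCyl.comp (H.continuous.comp
      (((hc 1).add (hc 2)).prodMk (hc 2)))⟩
    (γ₀ := H.comp ⟨fun s => (1, s), by fun_prop⟩) (γ₁ := H.comp ⟨fun s => (s, s), by fun_prop⟩)
    (γ₂ := H.comp ⟨fun s => (s, 0), by fun_prop⟩) ?_ ?_ ?_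
  · have h2 := mk_single_eq (A := A)
      ⟨fun x => toCyl (H (x 2, x 1 + x 2)), continuous_toCyl.comp (H.continuous.comp
        ((hc 2).prodMk ((hc 1).add (hc 2))))⟩
      (γ₀ := H.comp ⟨fun s => (s, 1), by fun_prop⟩) (γ₁ := H.comp ⟨fun s => (s, s), by fun_prop⟩)
      (γ₂ := H.comp ⟨fun s => (0, s), by fun_prop⟩) ?_ ?_ ?_
    · rw [sub_add_eq_add_sub, sub_eq_zero] at h1 h2
      rw [h1, h2]
    · ext y
      change toCyl (H (faceMap 1 0 y 2, faceMap 1 0 y 1 + faceMap 1 0 y 2)) = toCyl (H (y 1, 1))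
      rw [(faceMap_one_zero y).2.1, (faceMap_one_zero y).2.2, stdSimplex_two_add]
    · ext y
      change toCyl (H (faceMap 1 1 y 2, faceMap 1 1 y 1 + faceMap 1 1 y 2)) = toCyl (H (y 1, y 1))
      rw [(faceMap_one_one y).2.1, (faceMap_one_one y).2.2, zero_add]
    · ext y
      change toCyl (H (faceMap 1 2 y 2, faceMap 1 2 y 1 + faceMap 1 2 y 2)) = toCyl (H (0, y 1))
      rw [(faceMap_one_two y).2.1, (faceMap_one_two y).2.2, add_zero]
  · ext y
    change toCyl (H (faceMap 1 0 y 1 + faceMap 1 0 y 2, faceMap 1 0 y 2)) = toCyl (H (1, y 1))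
    rw [(faceMap_one_zero y).2.1, (faceMap_one_zero y).2.2, stdSimplex_two_add]
  · ext y
    change toCyl (H (faceMap 1 1 y 1 + faceMap 1 1 y 2, faceMap 1 1 y 2)) = toCyl (H (y 1, y 1))
    rw [(faceMap_one_one y).2.1, (faceMap_one_one y).2.2, zero_add]
  · ext y
    change toCyl (H (faceMap 1 2 y 1 + faceMap 1 2 y 2, faceMap 1 2 y 2)) = toCyl (H (y 1, 0))
    rw [(faceMap_one_two y).2.1, (faceMap_one_two y).2.2, add_zero]

/-- The class of a path depends only on the end points of its lift. -/
lemma pathClass_eq_of_endpoints {γ γ' : C(ℝ, ℂ)} (h0 : γ 0 = γ' 0) (h1 : γ 1 = γ' 1) :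
    pathClass A γ = pathClass A γ' := by
  -- The straight-line homotopy in `ℂ` is constant on the two lateral sides of the square because
  -- the end points agree.
  have h := pathClass_square (A := A)
    ⟨fun x : ℝ × ℝ => γ x.1 + x.2 * (γ' x.1 - γ x.1), by fun_prop⟩
  have e1 : (⟨fun x : ℝ × ℝ => γ x.1 + x.2 * (γ' x.1 - γ x.1), by fun_prop⟩ : C(ℝ × ℝ, ℂ)).comp
      ⟨fun s => (1, s), by fun_prop⟩ = ContinuousMap.const ℝ (γ 1) := by
    ext s
    simp [h1]
  have e2 : (⟨fun x : ℝ × ℝ => γ x.1 + x.2 * (γ' x.1 - γ x.1), by fun_prop⟩ : C(ℝ × ℝ, ℂ)).comp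
      ⟨fun s => (s, 0), by fun_prop⟩ = γ := by
    ext s
    simp
  have e3 : (⟨fun x : ℝ × ℝ => γ x.1 + x.2 * (γ' x.1 - γ x.1), by fun_prop⟩ : C(ℝ × ℝ, ℂ)).comp
      ⟨fun s => (s, 1), by fun_prop⟩ = γ' := by
    ext s
    simp
  have e4 : (⟨fun x : ℝ × ℝ => γ x.1 + x.2 * (γ' x.1 - γ x.1), by fun_prop⟩ : C(ℝ × ℝ, ℂ)).comp
      ⟨fun s => (0, s), by fun_prop⟩ = ContinuousMap.const ℝ (γ 0) := by
    ext s
    simp [h0]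
  rw [e1, e2, e3, e4, pathClass_const, pathClass_const, zero_add, add_zero] at h
  exact h

/-- The straight path from `p` to `q`. -/
def segPath (p q : ℂ) : C(ℝ, ℂ) := ⟨fun s => p + s * (q - p), by fun_prop⟩

lemma segPath_zero (p q : ℂ) : segPath p q 0 = p := by
  change p + ((0 : ℝ) : ℂ) * (q - p) = p
  simp

lemma segPath_one (p q : ℂ) : segPath p q 1 = q := by
  change p + ((1 : ℝ) : ℂ) * (q - p) = q
  simp

lemma pathClass_segPath_add (p q r : ℂ) :
    pathClass A (segPath p q) + pathClass A (segPath q r) = pathClass A (segPath p r) := by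
  have hc := fun i => stdSimplex_continuous_apply (n := 3) i
  have h1 := mk_single_eq (A := A)
    ⟨fun x => toCyl (x 0 * p + x 1 * q + x 2 * r), continuous_toCyl.comp
      ((((continuous_ofReal.comp (hc 0)).mul continuous_const).add
        ((continuous_ofReal.comp (hc 1)).mul continuous_const)).add
          ((continuous_ofReal.comp (hc 2)).mul continuous_const))⟩
    (γ₀ := segPath q r) (γ₁ := segPath p r) (γ₂ := segPath p q) ?_ ?_ ?_
  · rw [sub_add_eq_add_sub, sub_eq_zero, add_comm] at h1
    exact h1
  · ext y
    change toCyl ((faceMap 1 0 y 0 : ℝ) * p + (faceMap 1 0 y 1 : ℝ) * q + (faceMap 1 0 y 2 : ℝ) * r)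
      = toCyl (q + (y 1 : ℝ) * (r - q))
    rw [(faceMap_one_zero y).1, (faceMap_one_zero y).2.1, (faceMap_one_zero y).2.2,
      eq_sub_of_add_eq (stdSimplex_two_add y)]
    congr 1
    push_cast
    ring
  · ext y
    change toCyl ((faceMap 1 1 y 0 : ℝ) * p + (faceMap 1 1 y 1 : ℝ) * q + (faceMap 1 1 y 2 : ℝ) * r)
      = toCyl (p + (y 1 : ℝ) * (r - p))
    rw [(faceMap_one_one y).1, (faceMap_one_one y).2.1, (faceMap_one_one y).2.2,
      eq_sub_of_add_eq (stdSimplex_two_add y)]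
    congr 1
    push_cast
    ring
  · ext y
    change toCyl ((faceMap 1 2 y 0 : ℝ) * p + (faceMap 1 2 y 1 : ℝ) * q + (faceMap 1 2 y 2 : ℝ) * r)
      = toCyl (p + (y 1 : ℝ) * (q - p))
    rw [(faceMap_one_two y).1, (faceMap_one_two y).2.1, (faceMap_one_two y).2.2,
      eq_sub_of_add_eq (stdSimplex_two_add y)]
    congr 1
    push_cast
    ring

variable (A) in
/-- The class of the paths from `0` to `w`. -/
def potential (w : ℂ) : ChainQuot A := pathClass A (segPath 0 w)

/-- The homological counterpart of the fundamental theorem of calculus: `potential` plays the part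
of the primitive `P`. -/
lemma pathClass_eq_sub (γ : C(ℝ, ℂ)) :
    pathClass A γ = potential A (γ 1) - potential A (γ 0) := by
  rw [pathClass_eq_of_endpoints (γ := γ) (γ' := segPath (γ 0) (γ 1)) (segPath_zero _ _).symm
    (segPath_one _ _).symm, potential, potential, eq_sub_iff_add_eq, add_comm,
    pathClass_segPath_add]

/-- A path and its translate by a period have the same projection, so `potential`, like `P`, changes
by a constant. -/
lemma potential_add_period (w : ℂ) :
    potential A (w + 2 * Real.pi * I) = potential A w + potential A (2 * Real.pi * I) := by
  have h1 : pathClass A (segPath (2 * Real.pi * I) (w + 2 * Real.pi * I)) =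
      pathClass A (segPath 0 w) := by
    unfold pathClass
    congr 2
    ext y
    change toCyl (2 * Real.pi * I + (y 1 : ℝ) * (w + 2 * Real.pi * I - 2 * Real.pi * I)) =
      toCyl (0 + (y 1 : ℝ) * (w - 0))
    refine toCyl_eq_iff.2 ⟨1, ?_⟩
    push_cast
    ring
  rw [potential, ← pathClass_segPath_add 0 (2 * Real.pi * I) (w + 2 * Real.pi * I), h1, add_comm]
  rfl

lemma pathClass_eq_zero {γ : C(ℝ, ℂ)} (h : ∀ s ∈ Set.Icc (0 : ℝ) 1, toCyl (γ s) ∈ A) :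
    pathClass A γ = 0 := by
  refine (Submodule.Quotient.mk_eq_zero _).2 (Submodule.mem_sup_right ?_)
  exact Finsupp.single_mem_supported ℤ 1 fun x => h _ (stdSimplex_two_mem_Icc x)

lemma potential_eq_of_segment {p q : ℂ} (h : ∀ w ∈ segment ℝ p q, toCyl w ∈ A) :
    potential A p = potential A q := by
  have h1 : pathClass A (segPath q p) = 0 := by
    refine pathClass_eq_zero fun s hs => h _ ?_
    rw [segment_symm, segment_eq_image']
    exact ⟨s, hs, by simp [segPath]⟩
  rw [pathClass_eq_sub, segPath_zero, segPath_one, sub_eq_zero] at h1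
  exact h1

variable (A) in
/-- Relative homology embeds into the quotient of the chain group. -/
def homologyIncl : RelHomologySucc A 0 →ₗ[ℤ] ChainQuot A :=
  Submodule.mapQ _ _ (relCycles A 0).subtype le_rfl

lemma homologyIncl_mk (z : relCycles A 0) :
    homologyIncl A (Submodule.Quotient.mk z) = Submodule.Quotient.mk (z : SingularChain Cylinder 1) :=
  rfl

lemma homologyIncl_injective : Function.Injective (homologyIncl A) := by
  rw [injective_iff_map_eq_zero]
  intro h hh
  obtain ⟨z, rfl⟩ := Submodule.Quotient.mk_surjective _ h
  rw [homologyIncl_mk, Submodule.Quotient.mk_eq_zero] at hh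
  exact (Submodule.Quotient.mk_eq_zero _).2 hh

end Classes

end

end BesselStokes

/-! ### Existence, uniqueness and jump of the thimble classes. -/

namespace BesselStokes

noncomputable section

/-! ### The classes of the thimbles -/

lemma mem_posEnd {θ R : ℝ} {w : ℂ} (h : R ≤ (rotAction θ w).re) : toCyl w ∈ posEnd θ R :=
  ⟨w, h, rfl⟩

section ThimbleClasses

variable {A : Set Cylinder} {β : ℝ}

/-- The class of a thimble is determined by the values of the potential far out. -/
lemma eventually_homologyIncl_eq (h0 : β ≠ 0) (hβ : |β| < Real.pi / 4) {j : Fin 2}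
    {h : RelHomologySucc A 0} (hh : IsThimbleClass A (Real.pi / 2 + β) j h) :
    ∀ᶠ t in atTop, homologyIncl A h =
      potential A (stdThimble β j t) - potential A (stdThimble β j (-t)) := by
  obtain ⟨Γ, a, b, σ, z, hΓ, -, ha, hb, hσ, hz, rfl⟩ := hh
  obtain ⟨hD, ho⟩ := isThimbleDir h0 hβ j
  obtain ⟨τ, τ', hτ⟩ := hD.exists_isReparam ho hΓ
  have hc := continuous_thimbleCurve (p := critPt j) hD.re_ne
  set γ : ℝ → ℝ → C(ℝ, ℂ) := fun x y =>
    ⟨fun s => stdThimble β j (x + s * (y - x)), hc.comp (by fun_prop)⟩ with hγ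
  have hγ0 : ∀ x y, γ x y 0 = stdThimble β j x := fun x y => by simp [hγ]
  have hγ1 : ∀ x y, γ x y 1 = stdThimble β j y := fun x y => by simp [hγ]
  have hout : ∀ u, τ b ≤ u → toCyl (stdThimble β j u) ∈ A := by
    intro u hu
    obtain ⟨t, rfl⟩ := hτ.surjective u
    rw [← hτ.toCyl_eq]
    exact hb t (hτ.strictMono.le_iff_le.1 hu)
  have hout' : ∀ u, u ≤ τ a → toCyl (stdThimble β j u) ∈ A := by
    intro u hu
    obtain ⟨t, rfl⟩ := hτ.surjective u
    rw [← hτ.toCyl_eq]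
    exact ha t (hτ.strictMono.le_iff_le.1 hu)
  have hcl : homologyIncl A (Submodule.Quotient.mk z) =
      potential A (stdThimble β j (τ b)) - potential A (stdThimble β j (τ a)) := by
    set η : C(ℝ, ℂ) := ⟨fun s => stdThimble β j (τ (a + s * (b - a))),
      hc.comp (hτ.continuous.comp (by fun_prop))⟩ with hη
    have e : σ = pathSimplex η := by
      ext x
      rw [hσ, hτ.toCyl_eq]
      change _ = toCyl (stdThimble β j (τ (a + x 1 * (b - a))))
      rw [eq_sub_of_add_eq (stdSimplex_two_add x)]
      congr 3
      ring
    have h1 := pathClass_eq_sub (A := A) η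
    have h2 : η 0 = stdThimble β j (τ a) := by simp [hη]
    have h3 : η 1 = stdThimble β j (τ b) := by simp [hη]
    rw [h2, h3] at h1
    rw [homologyIncl_mk, hz, e]
    exact h1
  filter_upwards [eventually_ge_atTop (τ b), eventually_ge_atTop (-τ a)] with t h1 h2
  -- Beyond the chosen arc the thimble stays in `A`, so lengthening the arc at either side does not
  -- change the class.
  have h3 : pathClass A (γ (τ b) t) = 0 := by
    refine pathClass_eq_zero fun s hs => hout _ ?_
    nlinarith [hs.1]
  have h4 : pathClass A (γ (τ a) (-t)) = 0 := by
    refine pathClass_eq_zero fun s hs => hout' _ ?_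
    nlinarith [hs.1]
  rw [pathClass_eq_sub, hγ0, hγ1, sub_eq_zero] at h3 h4
  rw [hcl, h3, h4]

lemma rotAction_stdThimble_re (h0 : β ≠ 0) (hβ : |β| < Real.pi / 4) (j : Fin 2) (α t : ℝ) :
    (rotAction (Real.pi / 2 + α) (stdThimble β j t)).re =
      (rotAction (Real.pi / 2 + α) (critPt j)).re + t ^ 2 * Real.cos (β - α) := by
  have hD := (isThimbleDir h0 hβ j).1
  have e : rotAction (Real.pi / 2 + α) (stdThimble β j t) =
      rotAction (Real.pi / 2 + α) (critPt j) +
        ((t ^ 2 : ℝ) : ℂ) * exp ((β - α : ℝ) * I) := by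
    rw [rotAction, rotAction, hD.sinh_thimbleCurve, mul_add, mul_left_comm, ← Complex.exp_add]
    push_cast
    congr 3
    ring
  rw [e, add_re, re_ofReal_mul, exp_ofReal_mul_I_re]

/-- For `|α|, |β| ≤ δ < π/4` one has `cos (β - α) > 0`, so the action in phase `π/2 + α` grows
quadratically along the thimble of phase `π/2 + β`. With `α = ±δ` both tails lie in both ends, hence
in `A`. -/
lemma exists_isThimbleClass {δ R : ℝ} (h0 : 0 < δ) (hδ : δ < Real.pi / 4)
    (hA : posEnd (Real.pi / 2 - δ) R ∩ posEnd (Real.pi / 2 + δ) R ⊆ A) (hβ0 : β ≠ 0)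
    (hβ : |β| ≤ δ) (j : Fin 2) : ∃ h, IsThimbleClass A (Real.pi / 2 + β) j h := by
  have hβ' : |β| < Real.pi / 4 := hβ.trans_lt hδ
  have hpi := Real.pi_pos
  have hb := abs_le.1 hβ
  obtain ⟨hD, ho⟩ := isThimbleDir hβ0 hβ' j
  have hlarge : ∀ α, |α| ≤ δ → ∀ᶠ t : ℝ in atTop, ∀ s : ℝ, t ≤ |s| →
      R ≤ (rotAction (Real.pi / 2 + α) (stdThimble β j s)).re := by
    intro α hα
    have ha := abs_le.1 hα
    have hcos : 0 < Real.cos (β - α) := Real.cos_pos_of_mem_Ioo ⟨by linarith, by linarith⟩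
    have h1 : Tendsto (fun t : ℝ => (rotAction (Real.pi / 2 + α) (critPt j)).re +
        t ^ 2 * Real.cos (β - α)) atTop atTop :=
      tendsto_atTop_add_const_left _ _ ((tendsto_pow_atTop two_ne_zero).atTop_mul_const hcos)
    filter_upwards [h1.eventually_ge_atTop R, eventually_ge_atTop 0] with t ht ht0 s hs
    rw [rotAction_stdThimble_re hβ0 hβ']
    have h2 : t ^ 2 ≤ s ^ 2 := by
      rw [← sq_abs s]
      exact pow_le_pow_left₀ ht0 hs 2
    have := mul_le_mul_of_nonneg_right h2 hcos.le
    linarith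
  obtain ⟨T, hT1, hT2, hT0⟩ := ((hlarge δ (by rw [abs_of_pos h0])).and
    ((hlarge (-δ) (by rw [abs_neg, abs_of_pos h0])).and (eventually_gt_atTop 0))).exists
  have hmem : ∀ s : ℝ, T ≤ |s| → toCyl (stdThimble β j s) ∈ A := fun s hs =>
    hA ⟨mem_posEnd (by rw [sub_eq_add_neg]; exact hT2 s hs), mem_posEnd (hT1 s hs)⟩
  have hneg : ∀ t ≤ -T, toCyl (stdThimble β j t) ∈ A := fun t ht =>
    hmem t (by rw [le_abs]; right; linarith)
  have hpos : ∀ t ≥ T, toCyl (stdThimble β j t) ∈ A := fun t ht =>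
    hmem t (by rw [le_abs]; left; exact ht)
  set σ : C(stdSimplex ℝ (Fin 2), Cylinder) :=
    ⟨fun x => toCyl (stdThimble β j (-T * x 0 + T * x 1)), continuous_toCyl.comp
      ((continuous_thimbleCurve hD.re_ne).comp (((stdSimplex_continuous_apply 0).const_mul _).add
        ((stdSimplex_continuous_apply 1).const_mul _)))⟩ with hσ
  have hy : ∀ y : stdSimplex ℝ (Fin 1), y 0 = 1 := fun y => by
    simp
  have hcyc : Finsupp.single σ 1 ∈ relCycles A 0 := by
    change boundary Cylinder 0 (Finsupp.single σ 1) ∈ chainsIn A 0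
    rw [boundary_single_one]
    refine Submodule.sub_mem _ (Finsupp.single_mem_supported ℤ 1 fun y => ?_)
      (Finsupp.single_mem_supported ℤ 1 fun y => ?_)
    · change toCyl (stdThimble β j (-T * faceMap 0 0 y 0 + T * faceMap 0 0 y 1)) ∈ A
      have e1 : faceMap 0 0 y 0 = 0 := faceMap_self 0 0 y
      have e2 : faceMap 0 0 y 1 = 1 := (faceMap_succAbove 0 0 y 0).trans (hy y)
      rw [e1, e2]
      exact hpos _ (by simp)
    · change toCyl (stdThimble β j (-T * faceMap 0 1 y 0 + T * faceMap 0 1 y 1)) ∈ A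
      have e1 : faceMap 0 1 y 1 = 0 := faceMap_self 0 1 y
      have e2 : faceMap 0 1 y 0 = 1 := (faceMap_succAbove 0 1 y 0).trans (hy y)
      rw [e1, e2]
      exact hneg _ (by simp)
  exact ⟨_, stdThimble β j, -T, T, σ, ⟨_, hcyc⟩, hD.isThimbleParam ho, by linarith, hneg, hpos,
    fun x => rfl, rfl, rfl⟩

lemma isThimbleClass_unique (h0 : β ≠ 0) (hβ : |β| < Real.pi / 4) {j : Fin 2}
    {h h' : RelHomologySucc A 0} (hh : IsThimbleClass A (Real.pi / 2 + β) j h)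
    (hh' : IsThimbleClass A (Real.pi / 2 + β) j h') : h = h' := by
  obtain ⟨t, h1, h2⟩ := ((eventually_homologyIncl_eq h0 hβ hh).and
    (eventually_homologyIncl_eq h0 hβ hh')).exists
  exact homologyIncl_injective (h1.trans h2.symm)

end ThimbleClasses

/-- The jump of the classes of the thimbles. -/
lemma thimbleClass_jump {A : Set Cylinder} {δ R : ℝ} (h0 : 0 < δ) (hδ : δ < Real.pi / 4)
    (hA : posEnd (Real.pi / 2 - δ) R ∩ posEnd (Real.pi / 2 + δ) R ⊆ A)
    {Jl Jr : Fin 2 → RelHomologySucc A 0}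
    (hl : ∀ j, IsThimbleClass A (Real.pi / 2 + -δ) j (Jl j))
    (hr : ∀ j, IsThimbleClass A (Real.pi / 2 + δ) j (Jr j)) :
    Jl 0 = Jr 0 ∧ Jl 1 = (2 : ℤ) • Jr 0 + Jr 1 := by
  have hb : |δ| < Real.pi / 4 := by rwa [abs_of_pos h0]
  have hb' : |-δ| < Real.pi / 4 := by rwa [abs_neg]
  have hn : -δ < 0 := neg_lt_zero.2 h0
  have hα : |Real.pi / 2 - δ - Real.pi / 2| < Real.pi / 4 := by
    rwa [sub_sub_cancel_left]
  have hα' : |Real.pi / 2 + δ - Real.pi / 2| < Real.pi / 4 := by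
    rwa [add_sub_cancel_left]
  -- A segment between two curves in the strip eventually has large action in both phases at once;
  -- it then lies in the intersection of the ends, and the potential agrees at its end points.
  have hR : ∀ {f g : ℝ → ℂ}, IsRightEnd f → IsRightEnd g →
      ∀ᶠ t in atTop, potential A (f t) = potential A (g t) := by
    intro f g hf hg
    filter_upwards [hf.le_rotAction_re hg hα R, hf.le_rotAction_re hg hα' R] with t h1 h2
    exact potential_eq_of_segment fun w hw => hA ⟨mem_posEnd (h1 w hw), mem_posEnd (h2 w hw)⟩
  have hL : ∀ {f g : ℝ → ℂ}, IsLeftEnd f → IsLeftEnd g →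
      ∀ᶠ t in atTop, potential A (f t) = potential A (g t) := by
    intro f g hf hg
    filter_upwards [hf.le_rotAction_re hg hα R, hf.le_rotAction_re hg hα' R] with t h1 h2
    exact potential_eq_of_segment fun w hw => hA ⟨mem_posEnd (h1 w hw), mem_posEnd (h2 w hw)⟩
  have el := fun j => eventually_homologyIncl_eq hn.ne hb' (hl j)
  have er := fun j => eventually_homologyIncl_eq h0.ne' hb (hr j)
  constructor
  · obtain ⟨t, h1, h2, h3, h4⟩ := ((el 0).and ((er 0).and
      ((hR (isRightEnd_stdThimble_zero hb') (isRightEnd_stdThimble_zero hb)).and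
        (hL (isLeftEnd_stdThimble_zero hn.ne hb') (isLeftEnd_stdThimble_zero h0.ne' hb))))).exists
    apply homologyIncl_injective
    rw [h1, h2, h3, h4]
  · obtain ⟨t, h1, h2, h3, h4, h5, h6, h7⟩ := ((el 1).and ((er 0).and ((er 1).and
      ((hR (isRightEnd_stdThimble_one_of_neg hn hb') (isRightEnd_stdThimble_zero hb)).and
        ((hL (isLeftEnd_stdThimble_one_of_neg hn hb') (isLeftEnd_stdThimble_zero h0.ne' hb)).and
          ((hR (isRightEnd_stdThimble_one_of_pos h0 hb) (isRightEnd_stdThimble_zero hb)).and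
            (hL (isLeftEnd_stdThimble_one_of_pos h0 hb)
              (isLeftEnd_stdThimble_zero h0.ne' hb)))))))).exists
    -- The two lower thimbles are `R - (L - c)` and `L - (R - c)` with `c = potential A (2πi)`, so
    -- their difference is `2 (R - L)`.
    rw [potential_add_period] at h5 h6
    apply homologyIncl_injective
    rw [map_add, map_zsmul, h1, h2, h3, h4, h7, eq_sub_of_add_eq h5, eq_sub_of_add_eq h6]
    module

end

end BesselStokes

/-! ### Trajectories of the flow between the critical points at the Stokes phase. -/

namespace BesselStokes

noncomputable section

/-! ### The connecting trajectories -/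

/-- The Gudermannian-type function `2 arctan e^x`. -/
def gud (x : ℝ) : ℝ := 2 * Real.arctan (Real.exp x)

lemma sin_gud (x : ℝ) : Real.sin (gud x) = 2 * Real.exp x / (1 + Real.exp x ^ 2) := by
  have h : 0 < 1 + Real.exp x ^ 2 := by positivity
  rw [gud, Real.sin_two_mul, Real.sin_arctan, Real.cos_arctan]
  rw [mul_assoc, div_mul_div_comm, mul_one, Real.mul_self_sqrt h.le, mul_div_assoc]

lemma sin_gud_pos (x : ℝ) : 0 < Real.sin (gud x) := by
  rw [sin_gud]
  positivity

lemma hasDerivAt_gud (x : ℝ) : HasDerivAt gud (Real.sin (gud x)) x := by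
  have h := ((Real.hasDerivAt_exp x).arctan).const_mul 2
  refine h.congr_deriv ?_
  rw [sin_gud]
  ring

lemma tendsto_gud_atBot : Tendsto gud atBot (𝓝 0) := by
  have h := ((Real.continuous_arctan.tendsto 0).comp Real.tendsto_exp_atBot).const_mul 2
  rw [Real.arctan_zero, mul_zero] at h
  exact h

lemma tendsto_gud_atTop : Tendsto gud atTop (𝓝 Real.pi) := by
  have h := ((Real.tendsto_arctan_atTop.mono_right nhdsWithin_le_nhds).comp
    Real.tendsto_exp_atTop).const_mul 2
  rw [mul_div_cancel₀ _ two_ne_zero] at h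
  exact h

lemma gud_log_tan {u : ℝ} (h0 : 0 < u) (h1 : u < Real.pi) :
    gud (Real.log (Real.tan (u / 2))) = u := by
  have hpi := Real.pi_pos
  rw [gud, Real.exp_log (Real.tan_pos_of_pos_of_lt_pi_div_two (by linarith) (by linarith)),
    Real.arctan_tan (by linarith) (by linarith)]
  ring

/-- The height of the trajectories that descend from `π/2` to `-π/2`. -/
def descHeight (s₀ s : ℝ) : ℝ := gud (-(s - s₀)) - Real.pi / 2

/-- The height of the trajectories that ascend from `π/2` to `3π/2`. -/
def ascHeight (s₀ s : ℝ) : ℝ := gud (s - s₀) + Real.pi / 2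

lemma cos_descHeight (s₀ s : ℝ) : Real.cos (descHeight s₀ s) = Real.sin (gud (-(s - s₀))) := by
  rw [descHeight, Real.cos_sub_pi_div_two]

lemma cos_ascHeight (s₀ s : ℝ) : Real.cos (ascHeight s₀ s) = -Real.sin (gud (s - s₀)) := by
  rw [ascHeight, Real.cos_add_pi_div_two]

lemma hasDerivAt_descHeight (s₀ s : ℝ) :
    HasDerivAt (descHeight s₀) (-Real.cos (descHeight s₀ s)) s := by
  have h1 : HasDerivAt (fun s : ℝ => -(s - s₀)) (-1) s := ((hasDerivAt_id s).sub_const s₀).neg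
  refine (((hasDerivAt_gud _).comp s h1).sub_const (Real.pi / 2)).congr_deriv ?_
  rw [cos_descHeight]
  ring

lemma hasDerivAt_ascHeight (s₀ s : ℝ) :
    HasDerivAt (ascHeight s₀) (-Real.cos (ascHeight s₀ s)) s := by
  have h1 : HasDerivAt (fun s : ℝ => s - s₀) 1 s := (hasDerivAt_id s).sub_const s₀
  refine (((hasDerivAt_gud _).comp s h1).add_const (Real.pi / 2)).congr_deriv ?_
  rw [cos_ascHeight]
  ring

lemma flowField_mul_I (y : ℝ) : flowField (Real.pi / 2) (y * I) = (-Real.cos y : ℝ) * I := by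
  rw [flowField, exp_neg_pi_div_two_mul_I, Complex.cosh_mul_I, ← ofReal_cos, map_mul, map_neg,
    conj_I, conj_ofReal]
  push_cast
  ring

lemma hasDerivAt_mul_I {y : ℝ → ℝ} {s : ℝ} (h : HasDerivAt y (-Real.cos (y s)) s) :
    HasDerivAt (fun s => (y s : ℂ) * I) (flowField (Real.pi / 2) ((y s : ℂ) * I)) s := by
  rw [flowField_mul_I]
  exact h.ofReal_comp.mul_const I

lemma tendsto_toCyl_mul_I {y : ℝ → ℝ} {l : Filter ℝ} {c : ℝ} (h : Tendsto y l (𝓝 c)) :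
    Tendsto (fun s => toCyl ((y s : ℂ) * I)) l (𝓝 (toCyl (c * I))) :=
  ((continuous_toCyl.comp (continuous_ofReal.mul continuous_const)).tendsto c).comp h

lemma isConnecting_descHeight (s₀ : ℝ) :
    IsConnecting (Real.pi / 2) (toCyl (critPt 0)) (toCyl (critPt 1))
      fun s => toCyl ((descHeight s₀ s : ℝ) * I) := by
  refine ⟨⟨_, fun s => hasDerivAt_mul_I (hasDerivAt_descHeight s₀ s), fun s => rfl⟩, ?_, ?_⟩
  · have h1 : Tendsto (fun s : ℝ => -(s - s₀)) atBot atTop :=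
      tendsto_neg_atBot_atTop.comp (tendsto_atBot_add_const_right _ (-s₀) tendsto_id)
    have h2 := (tendsto_gud_atTop.comp h1).sub_const (Real.pi / 2)
    have h3 := tendsto_toCyl_mul_I h2
    have e : ((Real.pi - Real.pi / 2 : ℝ) : ℂ) * I = critPt 0 := by
      simp only [critPt, Matrix.cons_val_zero]
      push_cast
      ring
    rw [e] at h3
    exact h3
  · have h1 : Tendsto (fun s : ℝ => -(s - s₀)) atTop atBot :=
      tendsto_neg_atTop_atBot.comp (tendsto_atTop_add_const_right _ (-s₀) tendsto_id)
    have h2 := (tendsto_gud_atBot.comp h1).sub_const (Real.pi / 2)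
    have h3 := tendsto_toCyl_mul_I h2
    have e : ((0 - Real.pi / 2 : ℝ) : ℂ) * I = critPt 1 := by
      simp only [critPt, Matrix.cons_val_one, Matrix.cons_val_fin_one]
      push_cast
      ring
    rw [e] at h3
    exact h3

lemma isConnecting_ascHeight (s₀ : ℝ) :
    IsConnecting (Real.pi / 2) (toCyl (critPt 0)) (toCyl (critPt 1))
      fun s => toCyl ((ascHeight s₀ s : ℝ) * I) := by
  refine ⟨⟨_, fun s => hasDerivAt_mul_I (hasDerivAt_ascHeight s₀ s), fun s => rfl⟩, ?_, ?_⟩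
  · have h1 : Tendsto (fun s : ℝ => s - s₀) atBot atBot :=
      tendsto_atBot_add_const_right _ (-s₀) tendsto_id
    have h2 := (tendsto_gud_atBot.comp h1).add_const (Real.pi / 2)
    have h3 := tendsto_toCyl_mul_I h2
    have e : ((0 + Real.pi / 2 : ℝ) : ℂ) * I = critPt 0 := by
      simp only [critPt, Matrix.cons_val_zero]
      push_cast
      ring
    rw [e] at h3
    exact h3
  · have h1 : Tendsto (fun s : ℝ => s - s₀) atTop atTop :=
      tendsto_atTop_add_const_right _ (-s₀) tendsto_id
    have h2 := (tendsto_gud_atTop.comp h1).add_const (Real.pi / 2)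
    have h3 := tendsto_toCyl_mul_I h2
    have e : ((Real.pi + Real.pi / 2 : ℝ) : ℂ) * I =
        critPt 1 + (1 : ℤ) * (2 * Real.pi * I) := by
      simp only [critPt, Matrix.cons_val_one, Matrix.cons_val_fin_one]
      push_cast
      ring
    rw [e, toCyl_add_int_mul] at h3
    exact h3

lemma sinh_re_im (w : ℂ) : (sinh w).re = Real.sinh w.re * Real.cos w.im ∧
    (sinh w).im = Real.cosh w.re * Real.sin w.im := by
  have h : sinh w = (Real.sinh w.re * Real.cos w.im : ℝ) +
      (Real.cosh w.re * Real.sin w.im : ℝ) * I := by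
    conv_lhs => rw [← re_add_im w]
    rw [Complex.sinh_add, Complex.sinh_mul_I, Complex.cosh_mul_I]
    push_cast
    ring
  rw [h]
  simp only [add_re, ofReal_re, mul_re, I_re, mul_zero, ofReal_im, I_im, sub_self, add_zero, add_im,
    mul_im, mul_one, zero_add, and_self]

/-- A point with vanishing imaginary part of the action, between the critical values, lies on the
circle `Re w = 0`. -/
lemma re_eq_zero_of_rotAction {w : ℂ} (him : (rotAction (Real.pi / 2) w).im = 0)
    (h1 : -1 ≤ (rotAction (Real.pi / 2) w).re) (h2 : (rotAction (Real.pi / 2) w).re ≤ 1) :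
    w.re = 0 := by
  rw [rotAction, exp_neg_pi_div_two_mul_I] at him h1 h2
  simp only [neg_mul, neg_re, neg_im, I_mul_re, I_mul_im, neg_neg] at him h1 h2
  rw [(sinh_re_im w).1, neg_eq_zero] at him
  rw [(sinh_re_im w).2] at h1 h2
  rcases mul_eq_zero.1 him with h | h
  · exact Real.sinh_eq_zero.1 h
  · have hs : Real.sin w.im ^ 2 = 1 := by
      have := Real.sin_sq_add_cos_sq w.im
      rw [h] at this
      linarith
    have h3 : (Real.cosh w.re * Real.sin w.im) ^ 2 ≤ 1 := by
      rw [sq_le_one_iff_abs_le_one, abs_le]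
      exact ⟨h1, h2⟩
    rw [mul_pow, hs, mul_one, Real.cosh_sq] at h3
    have h4 : Real.sinh w.re ^ 2 = 0 := le_antisymm (by linarith) (sq_nonneg _)
    exact Real.sinh_eq_zero.1 (pow_eq_zero_iff two_ne_zero |>.1 h4)

lemma eq_of_hasDerivAt_neg_cos {y z : ℝ → ℝ} (hy : ∀ s, HasDerivAt y (-Real.cos (y s)) s)
    (hz : ∀ s, HasDerivAt z (-Real.cos (z s)) s) (h : y 0 = z 0) : y = z := by
  have hlip : LipschitzWith 1 fun x : ℝ => -Real.cos x := Real.lipschitzWith_cos.neg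
  exact ODE_solution_unique_univ (v := fun _ x => -Real.cos x) (s := fun _ => Set.univ) (t₀ := 0)
    (fun _ => hlip.lipschitzOnWith) (fun t => ⟨hy t, Set.mem_univ _⟩)
    (fun t => ⟨hz t, Set.mem_univ _⟩) h

/-- The solutions of `y' = -cos y` which are not constant. -/
lemma exists_height_eq {y : ℝ → ℝ} (hy : ∀ s, HasDerivAt y (-Real.cos (y s)) s)
    (h0 : Real.cos (y 0) ≠ 0) : ∃ (k : ℤ) (s₀ : ℝ),
      (∀ s, y s = descHeight s₀ s + k * (2 * Real.pi)) ∨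
        ∀ s, y s = ascHeight s₀ s + k * (2 * Real.pi) := by
  have hpi := Real.pi_pos
  -- Whole periods are removed so that `u` lies in `[-π/2, 3π/2)`. The zeros of the cosine split
  -- this window into the ranges of the descending and the ascending solutions.
  set k : ℤ := ⌊(y 0 + Real.pi / 2) / (2 * Real.pi)⌋ with hk
  set u : ℝ := y 0 - k * (2 * Real.pi) with hu
  have hk1 : (k : ℝ) * (2 * Real.pi) ≤ y 0 + Real.pi / 2 := by
    rw [← le_div_iff₀ (by positivity)]
    exact Int.floor_le _
  have hk2 : y 0 + Real.pi / 2 < (k + 1) * (2 * Real.pi) := by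
    rw [← div_lt_iff₀ (by positivity)]
    exact Int.lt_floor_add_one _
  have hcos : Real.cos u ≠ 0 := by
    rwa [hu, Real.cos_sub_int_mul_two_pi]
  have hu1 : -(Real.pi / 2) < u := by
    refine lt_of_le_of_ne (by linarith) fun h => hcos ?_
    rw [← h, Real.cos_neg, Real.cos_pi_div_two]
  have hshift : ∀ {z : ℝ → ℝ}, (∀ s, HasDerivAt z (-Real.cos (z s)) s) → z 0 = u →
      ∀ s, y s = z s + k * (2 * Real.pi) := by
    intro z hz hz0
    have h1 := eq_of_hasDerivAt_neg_cos hy (z := fun s => z s + k * (2 * Real.pi))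
      (fun s => by
        rw [Real.cos_add_int_mul_two_pi]
        exact (hz s).add_const _) (by simp only [hz0, hu]; ring)
    exact fun s => congrFun h1 s
  rcases lt_trichotomy u (Real.pi / 2) with h | h | h
  -- The inverse of `gud` is `u ↦ log tan (u/2)`; this `s₀` gives the explicit solution the initial
  -- value `u`.
  · refine ⟨k, Real.log (Real.tan ((u + Real.pi / 2) / 2)), Or.inl ?_⟩
    refine hshift (hasDerivAt_descHeight _) ?_
    rw [descHeight, zero_sub, neg_neg, gud_log_tan (by linarith) (by linarith)]
    ring
  · exact absurd (by rw [h, Real.cos_pi_div_two]) hcos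
  · refine ⟨k, -Real.log (Real.tan ((u - Real.pi / 2) / 2)), Or.inr ?_⟩
    refine hshift (hasDerivAt_ascHeight _) ?_
    rw [ascHeight, zero_sub, neg_neg, gud_log_tan (by linarith) (by linarith)]
    ring

/-- The limits make the action real along the trajectory and confine it to `[-1, 1]`. This forces
`Re w = 0`, and the flow becomes `y' = -cos y`. -/
lemma exists_of_isConnecting {w : ℝ → Cylinder}
    (hw : IsConnecting (Real.pi / 2) (toCyl (critPt 0)) (toCyl (critPt 1)) w) : ∃ s₀ : ℝ,
      (∀ s, w s = toCyl ((descHeight s₀ s : ℝ) * I)) ∨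
        ∀ s, w s = toCyl ((ascHeight s₀ s : ℝ) * I) := by
  obtain ⟨⟨W, hW, hwW⟩, hbot, htop⟩ := hw
  rw [funext hwW] at hbot htop
  have hSb := tendsto_of_tendsto_toCyl (continuous_rotAction (Real.pi / 2))
    (rotAction_periodic (Real.pi / 2)) hbot
  have hSt := tendsto_of_tendsto_toCyl (continuous_rotAction (Real.pi / 2))
    (rotAction_periodic (Real.pi / 2)) htop
  rw [rotAction_critPt_zero] at hSb
  rw [rotAction_critPt_one] at hSt
  have hd : ∀ s, HasDerivAt (fun s => rotAction (Real.pi / 2) (W s))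
      ((-normSq (exp (-((Real.pi / 2 : ℝ) * I)) * cosh (W s)) : ℝ) : ℂ) s := fun s =>
    hasDerivWithinAt_univ.1 (hasDerivWithinAt_rotAction (hW s).hasDerivWithinAt)
  have hre : ∀ s, HasDerivAt (fun s => (rotAction (Real.pi / 2) (W s)).re)
      (-normSq (exp (-((Real.pi / 2 : ℝ) * I)) * cosh (W s))) s := fun s => by
    refine (reCLM.hasFDerivAt.comp_hasDerivAt s (hd s)).congr_deriv ?_
    rw [reCLM_apply, ofReal_re]
  have him : ∀ s, HasDerivAt (fun s => (rotAction (Real.pi / 2) (W s)).im) 0 s := fun s => by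
    refine (imCLM.hasFDerivAt.comp_hasDerivAt s (hd s)).congr_deriv ?_
    rw [imCLM_apply, ofReal_im]
  have hanti : Antitone fun s => (rotAction (Real.pi / 2) (W s)).re :=
    antitone_of_hasDerivAt_nonpos hre fun s => neg_nonpos.2 (normSq_nonneg _)
  have hle : ∀ s, (rotAction (Real.pi / 2) (W s)).re ≤ 1 := fun s => by
    simpa using hanti.ge_of_tendsto ((continuous_re.tendsto _).comp hSb) s
  have hge : ∀ s, -1 ≤ (rotAction (Real.pi / 2) (W s)).re := fun s => by
    simpa using hanti.le_of_tendsto ((continuous_re.tendsto _).comp hSt) s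
  have him0 : ∀ s, (rotAction (Real.pi / 2) (W s)).im = 0 := by
    intro s
    have h1 : ∀ x, (rotAction (Real.pi / 2) (W x)).im = (rotAction (Real.pi / 2) (W s)).im :=
      fun x => is_const_of_deriv_eq_zero (fun x => (him x).differentiableAt)
        (fun x => (him x).deriv) x s
    have h2 : Tendsto (fun x => (rotAction (Real.pi / 2) (W x)).im) atTop (𝓝 (-1 : ℂ).im) :=
      (continuous_im.tendsto _).comp hSt
    rw [funext h1] at h2
    simpa using tendsto_nhds_unique tendsto_const_nhds h2
  have hx : ∀ s, (W s).re = 0 := fun s => re_eq_zero_of_rotAction (him0 s) (hge s) (hle s)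
  set y : ℝ → ℝ := fun s => (W s).im with hy
  have hWy : ∀ s, W s = (y s : ℂ) * I := fun s => by
    apply Complex.ext <;> simp [hx, hy]
  have hyd : ∀ s, HasDerivAt y (-Real.cos (y s)) s := fun s => by
    refine (imCLM.hasFDerivAt.comp_hasDerivAt s (hW s)).congr_deriv ?_
    rw [hWy, flowField_mul_I, imCLM_apply, im_ofReal_mul, I_im, mul_one]
  -- A zero of the cosine would make the trajectory constant, while the action has the different
  -- limits `1` and `-1`.
  have hcos : Real.cos (y 0) ≠ 0 := by
    intro h
    have h1 := eq_of_hasDerivAt_neg_cos hyd (z := fun _ => y 0)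
      (fun s => by rw [h, neg_zero]; exact hasDerivAt_const _ _) rfl
    have h2 : ∀ s, W s = W 0 := fun s => by rw [hWy, hWy, h1]
    simp only [h2] at hSb hSt
    have h3 := tendsto_nhds_unique hSb tendsto_const_nhds
    have h4 := tendsto_nhds_unique hSt tendsto_const_nhds
    have h5 := congrArg re (h3.trans h4.symm)
    norm_num at h5
  have hcyl : ∀ (x : ℝ) (k : ℤ), toCyl (((x + k * (2 * Real.pi) : ℝ) : ℂ) * I) =
      toCyl ((x : ℂ) * I) := by
    intro x k
    refine toCyl_eq_iff.2 ⟨k, ?_⟩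
    push_cast
    ring
  obtain ⟨k, s₀, h | h⟩ := exists_height_eq hyd hcos
  · exact ⟨s₀, Or.inl fun s => by rw [hwW, hWy, h, hcyl]⟩
  · exact ⟨s₀, Or.inr fun s => by rw [hwW, hWy, h, hcyl]⟩

lemma isConnecting_iff (w : ℝ → Cylinder) :
    IsConnecting (Real.pi / 2) (toCyl (critPt 0)) (toCyl (critPt 1)) w ↔ ∃ s₀ : ℝ,
      (∀ s, w s = toCyl ((descHeight s₀ s : ℝ) * I)) ∨
        ∀ s, w s = toCyl ((ascHeight s₀ s : ℝ) * I) := by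
  refine ⟨exists_of_isConnecting, ?_⟩
  rintro ⟨s₀, h | h⟩
  · rw [funext h]
    exact isConnecting_descHeight s₀
  · rw [funext h]
    exact isConnecting_ascHeight s₀

/-- The parameter `s₀` is a translation of time, so there is one class for each family. The sign of
`cosh w`, positive on descending and negative on ascending trajectories, tells the two families
apart. -/
lemma card_connecting : Nat.card (Quotient
    (shiftSetoid (Real.pi / 2) (toCyl (critPt 0)) (toCyl (critPt 1)))) = 2 := by
  rw [Nat.card_eq_two_iff]
  refine ⟨Quotient.mk _ ⟨_, isConnecting_descHeight 0⟩, Quotient.mk _ ⟨_, isConnecting_ascHeight 0⟩,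
    fun h => ?_, Set.eq_univ_of_forall fun q => ?_⟩
  · obtain ⟨c, hc⟩ := Quotient.exact h
    have h1 := cosh_eq_of_toCyl_eq (hc 0)
    rw [Complex.cosh_mul_I, Complex.cosh_mul_I, ← ofReal_cos, ← ofReal_cos, cos_descHeight,
      cos_ascHeight] at h1
    have h2 := ofReal_injective h1
    linarith [sin_gud_pos (0 - 0), sin_gud_pos (-(0 + c - 0))]
  · induction q using Quotient.inductionOn with
    | h w =>
      obtain ⟨w, hw⟩ := w
      obtain ⟨s₀, h | h⟩ := exists_of_isConnecting hw
      · refine Or.inl (Quotient.sound ⟨s₀, fun s => ?_⟩)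
        simp only [h, descHeight]
        congr 5
        ring
      · refine Or.inr (Quotient.sound ⟨s₀, fun s => ?_⟩)
        simp only [h, ascHeight]
        congr 5
        ring

end

end BesselStokes

/-! ### Transfer from the explicit curves to arbitrary parametrizations. -/

namespace BesselStokes

noncomputable section

/-! ### The Stokes phenomenon -/

lemma isThimbleParam_stdThimble {β : ℝ} (h0 : β ≠ 0) (hβ : |β| < Real.pi / 4) (j : Fin 2) :
    IsThimbleParam (Real.pi / 2 + β) j (stdThimble β j) :=
  (isThimbleDir h0 hβ j).1.isThimbleParam (isThimbleDir h0 hβ j).2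

lemma IsThimbleParam.exists_isReparam_stdThimble {β : ℝ} (h0 : β ≠ 0) (hβ : |β| < Real.pi / 4)
    {j : Fin 2} {Γ : ℝ → ℂ} (hΓ : IsThimbleParam (Real.pi / 2 + β) j Γ) :
    ∃ τ τ', IsReparam (stdThimble β j) Γ τ τ' :=
  (isThimbleDir h0 hβ j).1.exists_isReparam (isThimbleDir h0 hβ j).2 hΓ

lemma IsThimbleParam.thimbleIntegral_eq_stdThimble {β : ℝ} (h0 : β ≠ 0) (hβ : |β| < Real.pi / 4)
    {j : Fin 2} {Γ : ℝ → ℂ} (hΓ : IsThimbleParam (Real.pi / 2 + β) j Γ) :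
    thimbleIntegral Γ = thimbleIntegral (stdThimble β j) := by
  obtain ⟨τ, τ', h⟩ := hΓ.exists_isReparam_stdThimble h0 hβ
  exact funext h.thimbleIntegral_eq

lemma IsThimbleParam.integrable {β : ℝ} (h0 : β ≠ 0) (hβ : |β| < Real.pi / 4)
    {j : Fin 2} {Γ : ℝ → ℂ} (hΓ : IsThimbleParam (Real.pi / 2 + β) j Γ) {ħ : ℂ}
    (hħ : ħ ∈ sector β (Real.pi / 2)) : MeasureTheory.Integrable (thimbleIntegrand Γ ħ) := by
  obtain ⟨τ, τ', h⟩ := hΓ.exists_isReparam_stdThimble h0 hβ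
  exact (h.integrable_iff ħ).2 (integrable_thimbleIntegrand (isThimbleDir h0 hβ j).1 hħ)

lemma IsThimbleParam.hasSaddleExpansion {β δ : ℝ} (h0 : β ≠ 0) (hβ : |β| < Real.pi / 4)
    (hδ : δ < Real.pi / 4) {j : Fin 2} {Γ : ℝ → ℂ} (hΓ : IsThimbleParam (Real.pi / 2 + β) j Γ) :
    HasSaddleExpansion (thimbleIntegral Γ) (sector β δ)
      (rotAction (Real.pi / 2) (critPt j)) (saddleSeries j) := by
  rw [hΓ.thimbleIntegral_eq_stdThimble h0 hβ]
  exact hasSaddleExpansion_thimbleCurve h0 hβ hδ j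

end

end BesselStokes

theorem mainTheorem4 :
    -- the alien operators
    (HasPointedAlien 2 (saddleExpansion 1) ((2 : ℤ) • saddleExpansion 0) ∧
      HasPointedAlien 2 (saddleExpansion 0) 0 ∧
      HasPointedAlien (-2) (saddleExpansion 0) ((-2 : ℤ) • saddleExpansion 1) ∧
      HasPointedAlien (-2) (saddleExpansion 1) 0) ∧
    -- the Stokes matrix
    (∀ j, HasStokes (saddleExpansion j)
      (∑ i, (!![1, 2; 0, 1] : Matrix (Fin 2) (Fin 2) ℤ) i j • saddleExpansion i)) ∧
    (∀ δ : ℝ, 0 < δ → δ < Real.pi / 4 →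
      -- in both adjacent phases the thimbles are regular curves, and the saddle series are the
      -- asymptotic expansions of the integrals along them
      (∀ θ ∈ ({Real.pi / 2 - δ, Real.pi / 2 + δ} : Set ℝ), ∀ j,
        (∃ Γ, IsThimbleParam θ j Γ) ∧
        ∀ Γ, IsThimbleParam θ j Γ →
          (∀ ħ ∈ sector (θ - Real.pi / 2) (Real.pi / 2),
            MeasureTheory.Integrable (thimbleIntegrand Γ ħ)) ∧
          HasSaddleExpansion (thimbleIntegral Γ) (sector (θ - Real.pi / 2) δ)
            (rotAction (Real.pi / 2) (critPt j)) (saddleSeries j)) ∧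
      -- the jump of the thimble integrals
      (∀ Γl Γr : Fin 2 → ℝ → ℂ,
        (∀ j, IsThimbleParam (Real.pi / 2 - δ) j (Γl j)) →
        (∀ j, IsThimbleParam (Real.pi / 2 + δ) j (Γr j)) →
        ∀ ħ ∈ sector 0 δ, ∀ j,
          thimbleIntegral (Γl j) ħ =
              ∑ i, thimbleIntegral (Γr i) ħ * ((!![1, 2; 0, 1] : Matrix (Fin 2) (Fin 2) ℂ) i j) ∧
          thimbleIntegral (Γr j) ħ =
              ∑ i, thimbleIntegral (Γl i) ħ *
                ((!![1, -2; 0, 1] : Matrix (Fin 2) (Fin 2) ℂ) i j)) ∧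
      -- the jump of the thimbles, in the homology relative to the common part of the two ends,
      -- and so relative to each of the ends `posEnd θ R` with `|θ - π/2| ≤ δ`
      (∀ R : ℝ, 1 < R → ∀ A : Set Cylinder,
        posEnd (Real.pi / 2 - δ) R ∩ posEnd (Real.pi / 2 + δ) R ⊆ A →
        ∃ Jl Jr : Fin 2 → RelHomologySucc A 0,
          (∀ j h, IsThimbleClass A (Real.pi / 2 - δ) j h ↔ h = Jl j) ∧
          (∀ j h, IsThimbleClass A (Real.pi / 2 + δ) j h ↔ h = Jr j) ∧
          (∀ j, Jr j = ∑ i, (!![1, -2; 0, 1] : Matrix (Fin 2) (Fin 2) ℤ) i j • Jl i) ∧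
          (∀ j, Jl j = ∑ i, (!![1, 2; 0, 1] : Matrix (Fin 2) (Fin 2) ℤ) i j • Jr i) ∧
          Jr 1 = Jl 1 - (2 : ℤ) • Jl 0)) ∧
    -- the connecting trajectories from `w_+` to `w_-` at the Stokes phase
    (∀ w : ℝ → Cylinder,
      IsConnecting (Real.pi / 2) (toCyl (critPt 0)) (toCyl (critPt 1)) w ↔
        ∃ s₀ : ℝ,
          (∀ s, w s = toCyl
            ((2 * Real.arctan (Real.exp (-(s - s₀))) - Real.pi / 2 : ℝ) * Complex.I)) ∨
          (∀ s, w s = toCyl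
            ((2 * Real.arctan (Real.exp (s - s₀)) + Real.pi / 2 : ℝ) * Complex.I))) ∧
    Nat.card (Quotient
      (shiftSetoid (Real.pi / 2) (toCyl (critPt 0)) (toCyl (critPt 1)))) = 2 := by
  refine ⟨⟨hasPointedAlien_two_saddleExpansion_one,
    by simpa using hasPointedAlien_saddleExpansion_zero two_pos,
    hasPointedAlien_neg_two_saddleExpansion_zero, hasPointedAlien_neg_two_saddleExpansion_one⟩,
    hasStokes_saddleExpansion, fun δ h0 hδ => ?_, isConnecting_iff, card_connecting⟩
  have habs : |δ| < Real.pi / 4 := by rwa [abs_of_pos h0]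
  have habs' : |-δ| < Real.pi / 4 := by rwa [abs_neg]
  have hn : -δ ≠ 0 := (neg_neg_of_pos h0).ne
  -- The two phases become `π/2 + β` with `β = -δ` and `β = δ`.
  rw [sub_eq_add_neg (Real.pi / 2) δ]
  refine ⟨?_, ?_, ?_⟩
  · rintro θ (rfl | rfl) j
    · rw [add_sub_cancel_left]
      exact ⟨⟨_, isThimbleParam_stdThimble hn habs' j⟩, fun Γ hΓ =>
        ⟨fun ħ hħ => hΓ.integrable hn habs' hħ, hΓ.hasSaddleExpansion hn habs' hδ⟩⟩
    · rw [add_sub_cancel_left]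
      exact ⟨⟨_, isThimbleParam_stdThimble h0.ne' habs j⟩, fun Γ hΓ =>
        ⟨fun ħ hħ => hΓ.integrable h0.ne' habs hħ, hΓ.hasSaddleExpansion h0.ne' habs hδ⟩⟩
  · intro Γl Γr hl hr ħ hħ j
    simp only [fun i => (hl i).thimbleIntegral_eq_stdThimble hn habs',
      fun i => (hr i).thimbleIntegral_eq_stdThimble h0.ne' habs]
    obtain ⟨e0, e1⟩ := thimbleIntegral_jump h0 hδ hħ
    fin_cases j
    · simp [Fin.sum_univ_two, e0]
    · simp only [Fin.sum_univ_two, Fin.mk_one, e0, e1]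
      constructor <;> simp <;> ring
  · intro R _ A hA
    choose Jl hJl using fun j => exists_isThimbleClass h0 hδ hA hn (by rw [abs_neg, abs_of_pos h0]) j
    choose Jr hJr using fun j => exists_isThimbleClass h0 hδ hA h0.ne' (abs_of_pos h0).le j
    obtain ⟨e0, e1⟩ := thimbleClass_jump h0 hδ hA hJl hJr
    refine ⟨Jl, Jr, fun j h => ⟨fun hh => isThimbleClass_unique hn habs' hh (hJl j), ?_⟩,
      fun j h => ⟨fun hh => isThimbleClass_unique h0.ne' habs hh (hJr j), ?_⟩, ?_, ?_, ?_⟩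
    · rintro rfl
      exact hJl j
    · rintro rfl
      exact hJr j
    · intro j
      fin_cases j
      · simp [Fin.sum_univ_two, e0]
      · simp [Fin.sum_univ_two, e0, e1]
    · intro j
      fin_cases j
      · simp [Fin.sum_univ_two, e0]
      · simp [Fin.sum_univ_two, e1]
    · rw [e0, e1]
      abel
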